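/- Let $\mathbb{F}_q$ be a finite field with $q$ elements and let $X$ be a Noetherian scheme which is separated over $\mathbb{F}_q$. Let $F : X \to X$ be the $q$-power Frobenius (the identity on the underlying space and $r \mapsto r^q$ on sections of $\mathcal{O}_X$). A *coherent Cartier module* on a Noetherian scheme $Y$ over $\mathbb{F}_q$ is a coherent $\mathcal{O}_Y$-module $M$ with an additive endomorphism $C = C_M$ satisfying $C(r^q m) = r\,C(m)$ for all local sections $r$ of $\mathcal{O}_Y$ and $m$ of $M$. Morphisms are $\mathcal{O}_Y$-linear maps that commute with the maps $C$. Kernels, cokernels, quotients and stalks carry the induced map $C$, and $M$ is *nilpotent* if $C^e = 0$ on $M$ for some $e \ge 0$. A morphism is a *nil-isomorphism* if its kernel and its cokernel are nilpotent. The category of *Cartier crystals* on $X$ is the localization of the category of coherent Cartier modules on $X$ with respect to the nil-isomorphisms. Assume that one of the following holds. 1. $X$ is $F$-finite, i.e. $F$ is a finite morphism. 2. For every integral closed subscheme $Z \subseteq X$ and every coherent Cartier module $M$ on $Z$ there is a non-empty open subset $U \subseteq Z$ such that for every $x \in U$ other than the generic point of $Z$, every Cartier module quotient of the stalk $M_x$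 which has finite length as an $\mathcal{O}_{Z,x}$-module is nilpotent. Then: (a) For every coherent Cartier module $M$ on $X$ and every descending chain $M \supseteq M_1 \supseteq M_2 \supseteq \cdots$ of Cartier submodules of $M$, the chain stabilizes up to nilpotence: there is $i_0$ such that $M_i/M_{i+1}$ is nilpotent for all $i \ge i_0$. (b) Every Cartier crystal on $X$ is Noetherian and Artinian (ascending as well as descending chains of its subcrystals are eventually constant), and it has finite length, i.e. it has a finite composition series. -/

import Mathlib

open CategoryTheory AlgebraicGeometry Opposite TopologicalSpace

universe u

noncomputable section

namespace CartierModules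

/-! ### The Frobenius morphism of a scheme over a finite field -/

section Frobenius

variable {𝔽 : Type u} [Field 𝔽] [Fintype 𝔽] {X : Scheme.{u}} (s : X ⟶ Spec (CommRingCat.of 𝔽))

/-- The map `𝔽 → Γ(X, U)` given by the structure morphism of an `𝔽`-scheme `X`. -/
def scalar (U : X.Opens) : 𝔽 →+* Γ(X, U) :=
  ((Scheme.ΓSpecIso (CommRingCat.of 𝔽)).inv ≫ s.appTop ≫ X.presheaf.map U.leTop.op).hom

theorem add_pow_card {𝔽 : Type u} [Field 𝔽] [Fintype 𝔽] {X : Scheme.{u}}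
    (s : X ⟶ Spec (CommRingCat.of 𝔽)) (U : X.Opens) (a b : Γ(X, U)) :
    (a + b) ^ Fintype.card 𝔽 = a ^ Fintype.card 𝔽 + b ^ Fintype.card 𝔽 := by
  let _ : Algebra 𝔽 Γ(X, U) := (scalar s U).toAlgebra
  exact map_add (FiniteField.frobeniusAlgHom 𝔽 Γ(X, U)) a b

/-- The `q`-th power map on the sections of `𝒪_X`, where `q` is the cardinality of `𝔽`. -/
def powHom (U : X.Opens) : Γ(X, U) →+* Γ(X, U) where
  toFun a := a ^ Fintype.card 𝔽
  map_one' := one_pow _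
  map_mul' a b := mul_pow a b _
  map_zero' := zero_pow Fintype.card_ne_zero
  map_add' := add_pow_card s U

/-- The `q`-power Frobenius as a morphism of presheafed spaces. -/
def frobeniusPre : X.toPresheafedSpace ⟶ X.toPresheafedSpace where
  base := 𝟙 _
  c :=
    { app := fun U => CommRingCat.ofHom (powHom s U.unop)
      naturality := by
        intro U V f
        ext a
        exact (map_pow (X.presheaf.map f).hom a (Fintype.card 𝔽)).symm }

theorem frobeniusPre_stalkMap (x : X) (a : X.presheaf.stalk x) :
    ((frobeniusPre s).stalkMap x).hom a = a ^ Fintype.card 𝔽 := by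
  obtain ⟨U, hx, t, rfl⟩ := X.presheaf.exists_germ_eq a
  have h := PresheafedSpace.stalkMap_germ_apply (frobeniusPre s) U x hx t
  refine h.trans ?_
  exact map_pow (X.presheaf.germ U x hx).hom t (Fintype.card 𝔽)

/-- The `q`-power Frobenius `F : X ⟶ X` of a scheme over the field `𝔽` with `q` elements: the
identity on the underlying space, and `r ↦ r ^ q` on sections of `𝒪_X`. -/
def frobenius : X ⟶ X where
  toHom := frobeniusPre s
  prop x := ⟨fun a ha => by
    have h : ((frobeniusPre s).stalkMap x).hom a = a ^ Fintype.card 𝔽 :=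
      frobeniusPre_stalkMap s x a
    rw [h] at ha
    exact (isUnit_pow_iff Fintype.card_ne_zero).1 ha⟩

/-- `X` is `F`-finite: the Frobenius is a finite morphism of schemes. -/
def IsFFinite : Prop := IsFinite (frobenius s)

end Frobenius

/-! ### Coherent Cartier modules -/

/-- A coherent Cartier module `(M, C)` on `X` (which is locally Noetherian in all uses): a
quasi-coherent `𝒪_X`-module `M` whose modules of sections over affine opens are finitely generated,
with an additive endomorphism `C` of the sheaf `M` such that `C (r ^ q • m) = r • C m`. -/
structure CohCart (X : Scheme.{u}) (q : ℕ) where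
  /-- the underlying sheaf of modules -/
  mod : X.Modules
  quasicoherent : mod.IsQuasicoherent
  finite : ∀ U : X.Opens, IsAffineOpen U → Module.Finite Γ(X, U) Γ(mod, U)
  /-- the structural map -/
  C : mod.presheaf ⟶ mod.presheaf
  pow_smul : ∀ (U : X.Opens) (r : Γ(X, U)) (m : Γ(mod, U)),
    C.app (op U) (r ^ q • m) = r • C.app (op U) m

variable {X : Scheme.{u}} {q : ℕ}

namespace CohCart

/-- A morphism of Cartier modules: an `𝒪_X`-linear map that commutes with the structural maps. -/
@[ext]
structure Hom (M N : CohCart X q) where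
  /-- the underlying morphism of sheaves of modules -/
  hom : M.mod ⟶ N.mod
  comm : M.C ≫ hom.mapPresheaf = hom.mapPresheaf ≫ N.C

instance : Category (CohCart X q) where
  Hom := Hom
  id M := ⟨𝟙 M.mod, by ext; rfl⟩
  comp f g := ⟨f.hom ≫ g.hom, by
    change _ ≫ f.hom.mapPresheaf ≫ g.hom.mapPresheaf =
      (f.hom.mapPresheaf ≫ g.hom.mapPresheaf) ≫ _
    rw [Category.assoc, ← g.comm, ← Category.assoc, f.comm, Category.assoc]⟩
  id_comp f := Hom.ext (Category.id_comp f.hom)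
  comp_id f := Hom.ext (Category.comp_id f.hom)
  assoc f g h := Hom.ext (Category.assoc f.hom g.hom h.hom)

variable {M N : CohCart X q}

/-- The kernel of `φ` is a nilpotent Cartier module: some power of the structural map of `M`
vanishes on the sections that `φ` kills. -/
def NilpotentKernel (φ : M ⟶ N) : Prop :=
  ∃ e : ℕ, ∀ (U : X.Opens) (m : Γ(M.mod, U)),
    φ.hom.app U m = 0 → (M.C.app (op U))^[e] m = 0

/-- The cokernel of `φ`, i.e. the quotient sheaf `N / φ(M)` with the structural map induced by that
of `N`, is a nilpotent Cartier module: some power of the structural map of `N` followed by the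
projection `N ⟶ N / φ(M)` vanishes. -/
def NilpotentCokernel (φ : M ⟶ N) : Prop :=
  ∃ e : ℕ, ∀ (U : X.Opens) (n : Γ(N.mod, U)),
    (Limits.cokernel.π φ.hom).app U ((N.C.app (op U))^[e] n) = 0

/-- Nil-isomorphisms: kernel and cokernel are nilpotent. -/
def nilIso (X : Scheme.{u}) (q : ℕ) : MorphismProperty (CohCart X q) :=
  fun _ _ φ => NilpotentKernel φ ∧ NilpotentCokernel φ

/-- The stalk `M_x` -/
abbrev stalk (M : CohCart X q) (x : X) : Ab.{u} := TopCat.Presheaf.stalk M.mod.presheaf x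

/-- The module structure on the stalks of a presheaf of modules over a presheaf of rings. -/
@[reducible]
def presheafStalkModule {T : TopCat.{u}} {R : T.Presheaf CommRingCat.{u}}
    (P : PresheafOfModules.{u} (R ⋙ forget₂ CommRingCat.{u} RingCat.{u})) (x : T) :
    Module (R.stalk x) ↑(TopCat.Presheaf.stalk P.presheaf x) :=
  inferInstance

instance (M : CohCart X q) (x : X) : Module (X.presheaf.stalk x) (M.stalk x) :=
  presheafStalkModule (R := X.presheaf) M.mod.val x

/-- The structural map of the Cartier module `M_x` over `𝒪_{X,x}`. -/
def stalkC (M : CohCart X q) (x : X) : M.stalk x ⟶ M.stalk x :=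
  (TopCat.Presheaf.stalkFunctor Ab.{u} x).map M.C

/-- All Cartier quotients `M_x / N` that have finite length over `𝒪_{X,x}` are nilpotent. -/
def FiniteLengthQuotientsNilpotentAt (M : CohCart X q) (x : X) : Prop :=
  ∀ N : Submodule (X.presheaf.stalk x) (M.stalk x), (∀ m ∈ N, M.stalkC x m ∈ N) →
    IsFiniteLength (X.presheaf.stalk x) (M.stalk x ⧸ N) →
    ∃ e : ℕ, ∀ m : M.stalk x, (M.stalkC x)^[e] m ∈ N

end CohCart

/-- Every coherent Cartier module on an integral closed subscheme `Z` of `X` has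
the property that, over a non-empty open subset of `Z`, at all points other than the generic point
of `Z` the finite length Cartier quotients of the stalk are nilpotent. -/
def GabberCondition (X : Scheme.{u}) (q : ℕ) : Prop :=
  ∀ (Z : Scheme.{u}) (i : Z ⟶ X) [IsClosedImmersion i] [IsIntegral Z] (M : CohCart Z q),
    ∃ U : Z.Opens, (U : Set Z).Nonempty ∧
      ∀ x ∈ U, x ≠ genericPoint Z → M.FiniteLengthQuotientsNilpotentAt x

/-- Cartier crystals: the localization of the category of coherent Cartier modules with respect to
nil-isomorphisms. -/
abbrev CartierCrystal (X : Scheme.{u}) (q : ℕ) := (CohCart.nilIso X q).Localization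

/-- An object has finite length if it has a finite filtration
`0 = A₀ ⋖ A₁ ⋖ ⋯ ⋖ Aₙ = A` by subobjects without proper refinement. -/
def HasFiniteLength {𝒞 : Type*} [Category 𝒞] (A : 𝒞) : Prop :=
  ∃ c : RelSeries {p : Subobject A × Subobject A | p.1 ⋖ p.2}, IsBot c.head ∧ c.last = ⊤

end CartierModules

end

/-! Everything rests on the identity a · C^n(x) = C^n(a^(q^n) x): a scalar outside C^n acts inside
through a high power. For a finitely generated Cartier module over a Noetherian ring the images of
C^e stabilize, with no finiteness of Frobenius (`exists_image_eq`). Up to nilpotence a module may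
thus be replaced by its stable image, on which C is surjective; if a power of an ideal multiplies
the stable image into a Cartier submodule, so does the ideal itself.

Part (a) is a Noetherian induction on open sets (`exists_forall_leNear`). Let O be a maximal open
set on which the chain stabilizes locally up to nilpotence, W an affine open set not contained in O,
I the radical ideal of W \ O and p a minimal prime of I. Then I times the stable image of one member
lies in all later members (`smul_image_le_of_forall_prime`). Modulo I the localization at p has
finite length, so the chain stabilizes at p, but on a neighbourhood that may shrink with each
member. What remains is a uniformity statement, `HasGenericBounds`: one h ∉ p such that every
Cartier submodule which is everything at p is everything up to nilpotence where h is invertible.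
With it O can be enlarged (`exists_pow_smul_iterate_mem_chain`), which is a contradiction.

The two hypotheses serve only to prove `HasGenericBounds`. If F is finite, one reduces to a
torsion-free module K over a domain on which C kills no nonzero submodule. Then K → Hom(F_*R, K) is
injective between modules of equal rank, hence generically an isomorphism. This yields g ≠ 0,
depending on K alone, with g · I ⊆ I² for I = (N : K), and Cayley–Hamilton puts a power of g into I
(`exists_pow_smul_mem_of_reduced`). In the other case the module is moved to the integral closed
subscheme Z defined by p. A minimal prime, in the good open set, of the annihilator of the stable
image of a quotient would give a non-nilpotent quotient of finite length at that point
(`notMem_minimalPrimes`).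

For part (b), Cartier modules form an abelian category, the nilpotent ones a Serre class, and the
nil-isomorphisms are the isomorphisms modulo this class. Chains of subobjects of a crystal lift to
chains of Cartier submodules, so the ascending chain condition comes from coherence and the
descending one from (a). -/

noncomputable section

/-! ### Quasi-coherence in terms of sections over affine opens -/

namespace CartierModules
open Scheme.Modules Limits
variable {X : Scheme.{u}}

theorem restrict_fromSpec_smul (M : X.Modules) {U : X.Opens} (hU : IsAffineOpen U)
    (V : (Spec Γ(X, U)).Opens) (h : hU.fromSpec ''ᵁ V ≤ U) (r : Γ(X, U)) (x : Γ(M.restrict hU.fromSpec, V)) :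
    (M.restrictAppIso hU.fromSpec V).hom (r • x) =
      X.presheaf.map (homOfLE h).op r • (M.restrictAppIso hU.fromSpec V).hom x := by
  rw [smul_Spec_def, smul_restrictAppIso_hom_apply]
  congr 1
  have : (Scheme.ΓSpecIso Γ(X, U)).inv ≫ (Spec Γ(X, U)).presheaf.map V.leTop.op ≫
      (hU.fromSpec.appIso V).inv = X.presheaf.map (homOfLE h).op := by
    rw [← Category.assoc, Iso.comp_inv_eq, Scheme.Hom.appIso_hom', Scheme.Hom.map_appLE,
      Scheme.Hom.appLE, hU.fromSpec_app_self, Category.assoc, ← Functor.map_comp]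
    rfl
  exact congr($this r)

/-- Sections of `M` over the basic opens of `U` are fractions of sections over `U`. -/
structure IsLocAt (M : X.Modules) (U : X.Opens) : Prop where
  exists_smul (f : Γ(X, U)) (s : Γ(M, X.basicOpen f)) : ∃ (n : ℕ) (t : Γ(M, U)),
    M.presheaf.map (homOfLE (X.basicOpen_le f)).op t =
      X.presheaf.map (homOfLE (X.basicOpen_le f)).op f ^ n • s
  smul_eq_zero (f : Γ(X, U)) (t : Γ(M, U)) :
    M.presheaf.map (homOfLE (X.basicOpen_le f)).op t = 0 → ∃ n : ℕ, f ^ n • t = 0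

/-- The basic open of `Spec R` defined by `f`. -/
abbrev specD {R : CommRingCat.{u}} (f : R) : (Spec R).Opens := PrimeSpectrum.basicOpen f

/-- This makes quasi-coherence a condition on elements. On an affine scheme, being the sheaf of a
module means that sections over basic opens are localizations of the global sections; the rest is
transport along `hU.fromSpec`. -/
theorem isLocAt_iff (M : X.Modules) {U : X.Opens} (hU : IsAffineOpen U) :
    IsLocAt M U ↔ IsIso (M.restrict hU.fromSpec).fromTildeΓ := by
  rw [isIso_fromTildeΓ_iff_isLocalizing]
  let M' : (Spec Γ(X, U)).Modules := M.restrict hU.fromSpec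
  have htop : hU.fromSpec ''ᵁ ⊤ = U := by simp
  have hf (f : Γ(X, U)) : hU.fromSpec ''ᵁ (specD f) = X.basicOpen f :=
    hU.fromSpec_image_basicOpen f
  let e : Γ(M', ⊤) ≅ Γ(M, U) := M.restrictAppIso _ _ ≪≫ M.presheaf.mapIso (eqToIso htop.symm).op
  let e' (f : Γ(X, U)) : Γ(M', specD f) ≅ Γ(M, X.basicOpen f) :=
    M.restrictAppIso _ _ ≪≫ M.presheaf.mapIso (eqToIso (hf f).symm).op
  have hcomm (f : Γ(X, U)) (x : Γ(M', ⊤)) :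
     (e' f).hom (M'.presheaf.map (specD f).leTop.op x) =
       M.presheaf.map (homOfLE (X.basicOpen_le f)).op (e.hom x) := by
    change (M'.presheaf.map (specD f).leTop.op ≫ (e' f).hom) x = (e.hom ≫ M.presheaf.map (homOfLE (X.basicOpen_le f)).op) x
    congr 2
    simp only [e, e', Iso.trans_hom, Category.assoc, M']
    rw [map_restrictAppIso_hom_assoc]
    simp only [Functor.mapIso_hom, ← Functor.map_comp]
    rfl
  have hsm (r : Γ(X, U)) (x : Γ(M', ⊤)) : e.hom (r • x) = r • e.hom x := by
    change M.presheaf.map (eqToHom htop.symm).op ((M.restrictAppIso _ _).hom (r • x)) =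
      r • M.presheaf.map (eqToHom htop.symm).op ((M.restrictAppIso _ _).hom x)
    rw [restrict_fromSpec_smul M hU ⊤ htop.le, map_smul, ← CommRingCat.comp_apply, ← Functor.map_comp]
    congr 1
    exact congr($(X.presheaf.map_id _) r)
  have hsm' (f r : Γ(X, U)) (x : Γ(M', specD f)) : (e' f).hom (r • x) =
    X.presheaf.map (homOfLE (X.basicOpen_le f)).op r • (e' f).hom x := by
    change M.presheaf.map (eqToHom (hf f).symm).op ((M.restrictAppIso _ _).hom (r • x)) =
      _ • M.presheaf.map (eqToHom (hf f).symm).op ((M.restrictAppIso _ _).hom x)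
    rw [restrict_fromSpec_smul M hU _ ((hf f).le.trans (X.basicOpen_le f)), map_smul, ← CommRingCat.comp_apply, ← Functor.map_comp]
    rfl
  have einj : Function.Injective e.hom := (ConcreteCategory.bijective_of_isIso e.hom).1
  have einj' (f) : Function.Injective (e' f).hom := (ConcreteCategory.bijective_of_isIso (e' f).hom).1
  have esurj : Function.Surjective e.hom := (ConcreteCategory.bijective_of_isIso e.hom).2
  have esurj' (f) : Function.Surjective (e' f).hom := (ConcreteCategory.bijective_of_isIso (e' f).hom).2
  constructor
  · intro h f
    apply IsLocalizedModule.Away.mk_of_addCommGroup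
    · exact Scheme.Modules.isUnit_algebraMap_end_of_le_basicOpen f le_rfl
    · intro (x : Γ(M', specD f))
      obtain ⟨n, t, ht⟩ := h.exists_smul f ((e' f).hom x)
      obtain ⟨t, rfl⟩ := esurj t
      refine ⟨n, t, ?_⟩
      change f ^ n • x = M'.presheaf.map (specD f).leTop.op t
      apply einj' f
      rw [hcomm, ht, hsm', map_pow]
    · intro (x : Γ(M', ⊤)) (hx : M'.presheaf.map (specD f).leTop.op x = 0)
      obtain ⟨n, hn⟩ := h.smul_eq_zero f (e.hom x) (by rw [← hcomm, hx, map_zero])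
      exact ⟨n, einj ((hsm _ _).trans (hn.trans (map_zero e.hom.hom).symm))⟩
  · intro h
    refine ⟨fun f s ↦ ?_, fun f t ht ↦ ?_⟩
    · obtain ⟨s, rfl⟩ := esurj' f s
      have := h f
      obtain ⟨⟨y, ⟨_, n, rfl⟩⟩, hy⟩ := IsLocalizedModule.surj (.powers f)
        ((modulesSpecToSheaf.obj M').obj.map (specD f).leTop.op).hom s
      refine ⟨n, e.hom y, (hcomm f y).symm.trans ?_⟩
      rw [← map_pow, ← hsm']
      exact congr((e' f).hom $hy).symm
    · obtain ⟨t, rfl⟩ := esurj t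
      have : M'.presheaf.map (specD f).leTop.op t = 0 := by
        apply einj' f
        rw [hcomm, ht, map_zero]
      have := h f
      obtain ⟨⟨_, n, rfl⟩, hn⟩ := (IsLocalizedModule.eq_zero_iff (.powers f)
        ((modulesSpecToSheaf.obj M').obj.map (specD f).leTop.op).hom (m := t)).mp ‹_›
      exact ⟨n, (hsm _ _).symm.trans ((congr(e.hom $hn)).trans (map_zero e.hom.hom))⟩

theorem isLocAt_of_isQuasicoherent (M : X.Modules) [M.IsQuasicoherent] {U : X.Opens}
    (hU : IsAffineOpen U) : IsLocAt M U := by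
  rw [isLocAt_iff M hU]
  have := isQuasicoherent_restrictFunctor hU.fromSpec M
  exact isIso_fromTildeΓ_of_isQuasicoherent (M.restrict hU.fromSpec)

/-- If `M` restricted to `U` has a presentation, so has `M` over `U`. -/
def overPresentation (M : X.Modules) (U : X.Opens) (P : (M.restrict U.ι).Presentation) :
    (SheafOfModules.over M U).Presentation :=
  let e : (overEquiv U).inverse.obj (M.restrict U.ι) ≅ SheafOfModules.over M U :=
    (overEquiv U).inverse.mapIso ((overFunctorEquiv U).symm.app M) ≪≫
      ((overEquiv U).unitIso.symm.app (SheafOfModules.over M U))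
  let F : SheafOfModules (U : Scheme.{u}).ringCatSheaf ⥤ SheafOfModules (X.ringCatSheaf.over U) :=
    (overEquiv U).inverse
  have : F.IsLeftAdjoint := (overEquiv U).symm.toAdjunction.isLeftAdjoint
  have : PreservesColimitsOfSize.{u, u} F := inferInstance
  SheafOfModules.Presentation.ofIsIso.{u, u, u} e.hom
    (P.map F ((overEquiv U).unitIso.app (SheafOfModules.unit _)))

/-- Near each point the sheaf is the tilde of its module of sections. That module is presented by
all its elements and all their relations, and the presentation is carried from `Spec` to `U`. -/
theorem isQuasicoherent_of_isLocAt (M : X.Modules)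
    (h : ∀ x : X, ∃ U : X.Opens, IsAffineOpen U ∧ x ∈ U ∧ IsLocAt M U) : M.IsQuasicoherent := by
  choose U hU hx hloc using h
  refine SheafOfModules.QuasicoherentData.isQuasicoherent.{u} (M := M)
    { I := X
      X := U
      coversTop := by
        rw [Opens.coversTop_iff, IsOpenCover]
        exact eq_top_iff.2 fun x _ ↦ Opens.mem_iSup.2 ⟨x, hx x⟩
      presentation x := overPresentation M (U x) ?_ }
  have h1 : IsIso (M.restrict (hU x).fromSpec).fromTildeΓ := (isLocAt_iff M (hU x)).1 (hloc x)
  let p := presentationTilde.{u} ((modulesSpecToSheaf.obj (M.restrict (hU x).fromSpec)).presheaf.obj (op ⊤)) .univ (by simp) _ (Submodule.span_eq _)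
  let p' := @SheafOfModules.Presentation.ofIsIso.{u, u, u} _ _ _ _ _ _ _ _
    (M.restrict (hU x).fromSpec).fromTildeΓ h1 p
  let iso : restrictFunctor (hU x).fromSpec ⋙ restrictFunctor (hU x).isoSpec.hom ≅
        restrictFunctor (U x).ι :=
      (restrictFunctorComp _ _).symm ≪≫
        restrictFunctorCongr (by simp)
  have h2 : IsIso (iso.app M).hom := inferInstance
  exact @SheafOfModules.Presentation.ofIsIso.{u, u, u} _ _ _ _ _ _ _ _ (iso.app M).hom h2 <|
      presentationRestrict (hU x).isoSpec.hom p'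

theorem epi_of_comm_of_isIso {C : Type*} [Category* C] {A B M N : C} {a : A ⟶ B} {j : A ⟶ M}
    {i : B ⟶ N} {g : M ⟶ N} (h : a ≫ i = j ≫ g) (hi : IsIso i) (hj : IsIso j) (hg : Epi g) :
    Epi a := by
  have : a = (j ≫ g) ≫ inv i := by rw [← h]; simp
  rw [this]
  infer_instance

/-- On an affine open the epimorphism is the tilde of the map on global sections, and the tilde
functor reflects epimorphisms. -/
theorem surjective_app_of_epi {M N : X.Modules} [M.IsQuasicoherent] [N.IsQuasicoherent]
    (g : M ⟶ N) [Epi g] {U : X.Opens} (hU : IsAffineOpen U) : Function.Surjective (g.app U) := by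
  let M' := M.restrict hU.fromSpec
  let N' := N.restrict hU.fromSpec
  let g' : M' ⟶ N' := (restrictFunctor hU.fromSpec).map g
  have : Epi g' := inferInstance
  have : IsIso M'.fromTildeΓ := (isLocAt_iff M hU).1 (isLocAt_of_isQuasicoherent M hU)
  have : IsIso N'.fromTildeΓ := (isLocAt_iff N hU).1 (isLocAt_of_isQuasicoherent N hU)
  have hn : (tilde.functor _).map (moduleSpecΓFunctor.map g') ≫ N'.fromTildeΓ = M'.fromTildeΓ ≫ g' :=
    fromTildeΓNatTrans.naturality g'
  have h1 : Epi ((tilde.functor _).map (moduleSpecΓFunctor.map g'))  :=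
    epi_of_comm_of_isIso hn ‹_› ‹_› ‹_›
  have h2 : Epi (moduleSpecΓFunctor.map g') := (tilde.functor _).epi_of_epi_map h1
  rw [ModuleCat.epi_iff_surjective] at h2
  have h3 : Function.Surjective (g.app (hU.fromSpec ''ᵁ ⊤)) := h2
  have htop : hU.fromSpec ''ᵁ ⊤ = U := by simp
  rwa [htop] at h3

/-- Restriction and tilde both preserve cokernels, so on an affine open the cokernel is the tilde of
a cokernel of modules. -/
theorem isQuasicoherent_cokernel {M N : X.Modules} [M.IsQuasicoherent] [N.IsQuasicoherent]
    (g : M ⟶ N) : (cokernel g).IsQuasicoherent := by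
  refine isQuasicoherent_of_isLocAt _ fun x ↦ ?_
  obtain ⟨_, ⟨U, hU, rfl⟩, hxU, -⟩ := X.isBasis_affineOpens.exists_subset_of_mem_open (Set.mem_univ x) isOpen_univ
  refine ⟨U, hU, hxU, ?_⟩
  have hU : IsAffineOpen U := hU
  rw [isLocAt_iff _ hU, isIso_fromTildeΓ_iff]
  let g' := (restrictFunctor hU.fromSpec).map g
  let M' := M.restrict hU.fromSpec
  let N' := N.restrict hU.fromSpec
  have h1 : IsIso M'.fromTildeΓ := (isLocAt_iff M hU).1 (isLocAt_of_isQuasicoherent M hU)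
  have h2 : IsIso N'.fromTildeΓ := (isLocAt_iff N hU).1 (isLocAt_of_isQuasicoherent N hU)
  have hn : (tilde.functor _).map (moduleSpecΓFunctor.map g') ≫ N'.fromTildeΓ = M'.fromTildeΓ ≫ g' :=
    fromTildeΓNatTrans.naturality g'
  refine ⟨cokernel (moduleSpecΓFunctor.map g'), ⟨PreservesCokernel.iso (tilde.functor _) _ ≪≫
    cokernel.mapIso _ g' (@asIso _ _ _ _ M'.fromTildeΓ h1) (@asIso _ _ _ _ N'.fromTildeΓ h2) hn ≪≫
    (PreservesCokernel.iso (restrictFunctor hU.fromSpec) g).symm⟩⟩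
end CartierModules

/-! ### Kernels, finiteness, and the preadditive structure -/

namespace CartierModules
open Scheme.Modules Limits
variable {X : Scheme.{u}} {q : ℕ}

section Sections

variable {M N K : X.Modules}

/-- Sections over `U` as a functor. -/
def sectionsFunctor (U : X.Opens) : X.Modules ⥤ Ab.{u} :=
  toPresheaf X ⋙ (evaluation X.Opensᵒᵖ Ab.{u}).obj (op U)

instance (U : X.Opens) : PreservesLimits (sectionsFunctor U) := by
  have : PreservesLimits (toPresheaf X : X.Modules ⥤ X.Opensᵒᵖ ⥤ Ab.{u}) :=
    inferInstanceAs (PreservesLimits (toPresheaf X))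
  have : PreservesLimits ((evaluation X.Opensᵒᵖ Ab.{u}).obj (op U)) := ⟨fun {J} _ ↦ inferInstance⟩
  exact comp_preservesLimits (toPresheaf X : X.Modules ⥤ X.Opensᵒᵖ ⥤ Ab.{u}) _

theorem injective_app (f : M ⟶ N) [Mono f] (U : X.Opens) : Function.Injective (f.app U) := by
  have : Mono ((sectionsFunctor U).map f) := inferInstance
  exact (AddCommGrpCat.mono_iff_injective _).1 this

theorem exists_app_eq (S : ShortComplex X.Modules) (hS : S.Exact) [Mono S.f] (U : X.Opens)
    (m : Γ(S.X₂, U)) (hm : S.g.app U m = 0) : ∃ k, S.f.app U k = m := by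
  have : ((sectionsFunctor U).PreservesZeroMorphisms) := ⟨fun _ _ ↦ rfl⟩
  have := hS.map_of_mono_of_preservesKernel (sectionsFunctor U) ‹_› inferInstance
  exact (ShortComplex.ab_exact_iff _).1 this m hm

theorem exists_kernel_ι_app_eq (g : M ⟶ N) (U : X.Opens) (m : Γ(M, U)) (hm : g.app U m = 0) :
    ∃ k, (kernel.ι g).app U k = m :=
  exists_app_eq (ShortComplex.mk (kernel.ι g) g (kernel.condition g))
    (ShortComplex.exact_kernel g) U m hm

theorem app_naturality (f : M ⟶ N) {U V : X.Opens} (h : V ≤ U) (m : Γ(M, U)) :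
    f.app V (M.presheaf.map (homOfLE h).op m) = N.presheaf.map (homOfLE h).op (f.app U m) :=
  congr($(f.mapPresheaf.naturality (homOfLE h).op) m)

theorem kernel_ι_app_eq_zero (g : M ⟶ N) (U : X.Opens) (k) : g.app U ((kernel.ι g).app U k) = 0 :=
  congr(($(kernel.condition g)).app U k)

theorem IsLocAt.kernel {U : X.Opens} (hM : IsLocAt M U) (hN : IsLocAt N U) (g : M ⟶ N) :
    IsLocAt (kernel g) U where
  exists_smul f s := by
    obtain ⟨n, t, ht⟩ := hM.exists_smul f ((kernel.ι g).app _ s)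
    -- The extension `t` of the section lies in the kernel only after a further power of `f`: its
    -- image under `g` is known to vanish only on the basic open.
    obtain ⟨m, hm⟩ := hN.smul_eq_zero f (g.app U t) (by
      rw [← app_naturality, ht, Hom.app_smul, kernel_ι_app_eq_zero, smul_zero])
    obtain ⟨k, hk⟩ := exists_kernel_ι_app_eq g U (f ^ m • t) (by rw [Hom.app_smul, hm])
    refine ⟨m + n, k, injective_app (Limits.kernel.ι g) _ ?_⟩
    rw [app_naturality, hk, Hom.app_smul, map_smul, ht, smul_smul, map_pow, pow_add]
  smul_eq_zero f t ht := by
    obtain ⟨n, hn⟩ := hM.smul_eq_zero f ((kernel.ι g).app _ t) (by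
      rw [← app_naturality, ht, map_zero])
    exact ⟨n, injective_app (Limits.kernel.ι g) _ (by rw [Hom.app_smul, hn, map_zero])⟩

theorem isQuasicoherent_of_forall_isLocAt (M : X.Modules)
    (h : ∀ U : X.Opens, IsAffineOpen U → IsLocAt M U) : M.IsQuasicoherent := by
  refine isQuasicoherent_of_isLocAt _ fun x ↦ ?_
  obtain ⟨_, ⟨U, hU, rfl⟩, hxU, -⟩ :=
    X.isBasis_affineOpens.exists_subset_of_mem_open (Set.mem_univ x) isOpen_univ
  exact ⟨U, hU, hxU, h U hU⟩

theorem isQuasicoherent_kernel [M.IsQuasicoherent] [N.IsQuasicoherent] (g : M ⟶ N) :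
    (kernel g).IsQuasicoherent :=
  isQuasicoherent_of_forall_isLocAt _ fun _ hU ↦
    (isLocAt_of_isQuasicoherent M hU).kernel (isLocAt_of_isQuasicoherent N hU) g

theorem finite_of_mono [IsLocallyNoetherian X] (f : M ⟶ N) [Mono f] {U : X.Opens}
    (hU : IsAffineOpen U) [Module.Finite Γ(X, U) Γ(N, U)] : Module.Finite Γ(X, U) Γ(M, U) := by
  have := IsLocallyNoetherian.component_noetherian ⟨U, hU⟩
  let l : Γ(M, U) →ₗ[Γ(X, U)] Γ(N, U) := { (f.app U).hom with map_smul' := f.app_smul }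
  exact Module.Finite.of_injective l (injective_app f U)

theorem finite_of_epi [M.IsQuasicoherent] [N.IsQuasicoherent] (f : M ⟶ N) [Epi f] {U : X.Opens}
    (hU : IsAffineOpen U) [Module.Finite Γ(X, U) Γ(M, U)] : Module.Finite Γ(X, U) Γ(N, U) := by
  let l : Γ(M, U) →ₗ[Γ(X, U)] Γ(N, U) := { (f.app U).hom with map_smul' := f.app_smul }
  exact Module.Finite.of_surjective l (surjective_app_of_epi f hU)

theorem section_ext_affine (M : X.Modules) {U : X.Opens} {s t : Γ(M, U)}
    (h : ∀ (V : X.Opens) (hV : V ≤ U), IsAffineOpen V →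
      M.presheaf.map (homOfLE hV).op s = M.presheaf.map (homOfLE hV).op t) : s = t := by
  refine TopCat.Presheaf.section_ext ⟨M.presheaf, M.isSheaf⟩ U s t fun x hx ↦ ?_
  obtain ⟨_, ⟨V, hV, rfl⟩, hxV, hVU⟩ := X.isBasis_affineOpens.exists_subset_of_mem_open hx U.2
  have := congr(M.presheaf.germ V x hxV $(h V hVU hV))
  rwa [TopCat.Presheaf.germ_res_apply, TopCat.Presheaf.germ_res_apply] at this

end Sections

namespace CohCart

variable {M N K : CohCart X q}

@[ext] theorem hom_ext {f g : M ⟶ N} (h : f.hom = g.hom) : f = g := Hom.ext h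

theorem hom_C (f : M ⟶ N) (U : X.Opens) (m : Γ(M.mod, U)) :
    f.hom.app U (M.C.app (op U) m) = N.C.app (op U) (f.hom.app U m) :=
  congr(($f.comm).app (op U) m)

theorem C_naturality (M : CohCart X q) {U V : X.Opens} (h : V ≤ U) (m : Γ(M.mod, U)) :
    M.C.app (op V) (M.mod.presheaf.map (homOfLE h).op m) =
      M.mod.presheaf.map (homOfLE h).op (M.C.app (op U) m) :=
  congr($(M.C.naturality (homOfLE h).op) m)

/-- Constructor for morphisms from the compatibility on affine sections. -/
def mkHom (f : M.mod ⟶ N.mod) (h : ∀ (U : X.Opens), IsAffineOpen U → ∀ m : Γ(M.mod, U),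
    f.app U (M.C.app (op U) m) = N.C.app (op U) (f.app U m)) : M ⟶ N where
  hom := f
  comm := by
    ext U m
    refine section_ext_affine _ fun V hV hV' ↦ ?_
    change _ = N.mod.presheaf.map (homOfLE hV).op (N.C.app (op U) (f.app U m))
    rw [← C_naturality, ← app_naturality, ← h V hV', C_naturality, app_naturality]
    rfl

section Preadditive

variable (M N)

theorem injective_hom : Function.Injective (Hom.hom : Hom M N → (M.mod ⟶ N.mod)) :=
  fun _ _ h ↦ Hom.ext h

instance : Zero (Hom M N) := ⟨mkHom 0 fun U _ _ ↦ (map_zero (N.C.app (op U)).hom).symm⟩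
instance : Add (Hom M N) := ⟨fun f g ↦ mkHom (f.hom + g.hom) fun U _ m ↦ by
  change f.hom.app U _ + g.hom.app U _ = N.C.app (op U) (f.hom.app U _ + g.hom.app U _)
  rw [map_add, hom_C, hom_C]⟩
instance : Neg (Hom M N) := ⟨fun f ↦ mkHom (-f.hom) fun U _ m ↦ by
  change -f.hom.app U _ = N.C.app (op U) (-f.hom.app U _)
  rw [map_neg, hom_C]⟩
instance : Sub (Hom M N) := ⟨fun f g ↦ mkHom (f.hom - g.hom) fun U _ m ↦ by
  change f.hom.app U _ - g.hom.app U _ = N.C.app (op U) (f.hom.app U _ - g.hom.app U _)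
  rw [map_sub, hom_C, hom_C]⟩
instance : SMul ℕ (Hom M N) := ⟨fun n f ↦ nsmulRec n f⟩
instance : SMul ℤ (Hom M N) := ⟨fun n f ↦ zsmulRec (nsmulRec) n f⟩

theorem nsmul_hom (n : ℕ) (f : Hom M N) : (n • f).hom = n • f.hom := by
  induction n with
  | zero => rw [zero_smul]; rfl
  | succ n ih => rw [succ_nsmul, ← ih]; rfl

theorem zsmul_hom (n : ℤ) (f : Hom M N) : (n • f).hom = n • f.hom := by
  cases n with
  | ofNat n => rw [Int.ofNat_eq_natCast, natCast_zsmul, ← nsmul_hom]; rfl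
  | negSucc n => rw [negSucc_zsmul, ← nsmul_hom]; rfl

instance : AddCommGroup (Hom M N) :=
  (injective_hom M N).addCommGroup _ rfl (fun _ _ ↦ rfl) (fun _ ↦ rfl) (fun _ _ ↦ rfl)
    (fun _ _ ↦ nsmul_hom M N _ _) (fun _ _ ↦ zsmul_hom M N _ _)

instance : Preadditive (CohCart X q) where
  homGroup M N := inferInstanceAs (AddCommGroup (Hom M N))
  add_comp _ _ _ _ _ _ := hom_ext (Preadditive.add_comp _ _ _ _ _ _)
  comp_add _ _ _ _ _ _ := hom_ext (Preadditive.comp_add _ _ _ _ _ _)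

end Preadditive

end CohCart
end CartierModules

/-! ### The abelian category of coherent Cartier modules -/

namespace CartierModules
open Scheme.Modules Limits
variable {X : Scheme.{u}} {q : ℕ}

namespace CohCart

instance (M : CohCart X q) : M.mod.IsQuasicoherent := M.quasicoherent

section Sub

variable {M : CohCart X q} {K : X.Modules} (ι : K ⟶ M.mod) [Mono ι]
  (hK : K.IsQuasicoherent)
  (hC : ∀ (U : X.Opens) (k : Γ(K, U)), ∃ k', ι.app U k' = M.C.app (op U) (ι.app U k))

/-- The structural map on the sections of a subsheaf stable under the structural map. -/
def subCApp (hC : ∀ (U : X.Opens) (k : Γ(K, U)), ∃ k', ι.app U k' = M.C.app (op U) (ι.app U k))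
    (U : X.Opens) : Γ(K, U) →+ Γ(K, U) where
  toFun k := (hC U k).choose
  map_zero' := injective_app ι U (by rw [(hC _ _).choose_spec, map_zero, map_zero])
  map_add' x y := injective_app ι U (by
    refine (hC U _).choose_spec.trans ?_
    rw [map_add, map_add]
    exact (congrArg₂ (· + ·) (hC U x).choose_spec (hC U y).choose_spec).symm.trans
      (map_add _ _ _).symm)

theorem app_subCApp (U : X.Opens) (k : Γ(K, U)) :
    ι.app U (subCApp ι hC U k) = M.C.app (op U) (ι.app U k) :=
  (hC U k).choose_spec

/-- The structural map on a subsheaf stable under the structural map. -/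
def subC (hC : ∀ (U : X.Opens) (k : Γ(K, U)), ∃ k', ι.app U k' = M.C.app (op U) (ι.app U k)) :
    K.presheaf ⟶ K.presheaf where
  app U := AddCommGrpCat.ofHom (subCApp ι hC U.unop)
  naturality U V i := by
    ext k
    obtain ⟨U⟩ := U
    obtain ⟨V⟩ := V
    have h : V ≤ U := i.unop.le
    change subCApp ι hC V (K.presheaf.map (homOfLE h).op k) =
      K.presheaf.map (homOfLE h).op (subCApp ι hC U k)
    apply injective_app ι V
    rw [app_naturality, app_subCApp, app_subCApp, ← C_naturality, app_naturality]

theorem app_subC (U : X.Opens) (k : Γ(K, U)) :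
    ι.app U ((subC ι hC).app (op U) k) = M.C.app (op U) (ι.app U k) :=
  (hC U k).choose_spec

variable [IsLocallyNoetherian X]

/-- A quasi-coherent subsheaf stable under the structural map is a Cartier module. -/
def sub : CohCart X q where
  mod := K
  quasicoherent := hK
  finite U hU := have := M.finite U hU; finite_of_mono ι hU
  C := subC ι hC
  pow_smul U r m := injective_app ι _ (by
    rw [Hom.app_smul, app_subC, app_subC, Hom.app_smul, M.pow_smul])

/-- The inclusion of a Cartier submodule. -/
def subι : sub ι hK hC ⟶ M :=
  mkHom ι fun U _ m ↦ app_subC ι hC U m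

end Sub

section Quot

variable {M : CohCart X q} {Q : X.Modules} (π : M.mod ⟶ Q) [Epi π] (hQ : Q.IsQuasicoherent)
  (hC : ∀ (U : X.Opens), IsAffineOpen U → ∀ m : Γ(M.mod, U), π.app U m = 0 →
    π.app U (M.C.app (op U) m) = 0)

/-- The structural map on the sections of a quotient over an affine open. -/
def quotCApp (U : X.affineOpens) : Γ(Q, U.1) →+ Γ(Q, U.1) :=
  have hs := surjective_app_of_epi π U.2
  AddMonoidHom.liftOfSurjective (π.app U.1).hom hs
    ⟨(π.app U.1).hom.comp (M.C.app (op U.1)).hom, fun m hm ↦ hC U.1 U.2 m hm⟩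

theorem quotCApp_apply (U : X.affineOpens) (m : Γ(M.mod, U.1)) :
    quotCApp π hQ hC U (π.app U.1 m) = π.app U.1 (M.C.app (op U.1) m) :=
  AddMonoidHom.liftOfRightInverse_comp_apply _ _ _ _ _

theorem isBasis_range_affineOpens :
    Opens.IsBasis (Set.range (Subtype.val : X.affineOpens → X.Opens)) := by
  rw [Subtype.range_val]
  exact X.isBasis_affineOpens

/-- The structural map of a quotient on the affine opens. -/
def quotCAffine : (inducedFunctor (Subtype.val : X.affineOpens → X.Opens)).op ⋙ Q.presheaf ⟶
    (inducedFunctor (Subtype.val : X.affineOpens → X.Opens)).op ⋙ Q.presheaf where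
  app U := AddCommGrpCat.ofHom (quotCApp π hQ hC U.unop)
  naturality U V i := by
    ext k
    obtain ⟨U⟩ := U
    obtain ⟨V⟩ := V
    have h : V.1 ≤ U.1 := i.unop.hom.le
    obtain ⟨m, rfl⟩ := surjective_app_of_epi π U.2 k
    change quotCApp π hQ hC V (Q.presheaf.map (homOfLE h).op _) =
      Q.presheaf.map (homOfLE h).op (quotCApp π hQ hC U _)
    rw [← app_naturality, quotCApp_apply, quotCApp_apply, C_naturality, app_naturality]

/-- The structural map of a quotient. -/
def quotC : Q.presheaf ⟶ Q.presheaf :=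
  -- The structural map descends directly only over affine opens, where the projection is surjective
  -- on sections. These form a basis, so a map of sheaves is determined.
  TopCat.Sheaf.restrictHomEquivHom Q.presheaf ⟨Q.presheaf, Q.isSheaf⟩ isBasis_range_affineOpens
    (quotCAffine π hQ hC)

theorem quotC_app {U : X.Opens} (hU : IsAffineOpen U) (m : Γ(M.mod, U)) :
    (quotC π hQ hC).app (op U) (π.app U m) = π.app U (M.C.app (op U) m) := by
  have := TopCat.Sheaf.extend_hom_app Q.presheaf ⟨Q.presheaf, Q.isSheaf⟩
    isBasis_range_affineOpens (quotCAffine π hQ hC) ⟨U, hU⟩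
  refine congr($this (π.app U m)).trans ?_
  exact quotCApp_apply π hQ hC ⟨U, hU⟩ m

/-- A quasi-coherent quotient to which the structural map descends is a Cartier module. -/
def quot : CohCart X q where
  mod := Q
  quasicoherent := hQ
  finite U hU := have := M.finite U hU; finite_of_epi π hU
  C := quotC π hQ hC
  pow_smul U r m := by
    refine section_ext_affine _ fun V hV hV' ↦ ?_
    have key (x : Γ(Q, U)) : Q.presheaf.map (homOfLE hV).op ((quotC π hQ hC).app (op U) x) =
      (quotC π hQ hC).app (op V) (Q.presheaf.map (homOfLE hV).op x) :=
      congr($((quotC π hQ hC).naturality (homOfLE hV).op) x).symm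
    obtain ⟨n, hn⟩ := surjective_app_of_epi π hV' (Q.presheaf.map (homOfLE hV).op m)
    rw [map_smul, key, key, map_smul, ← hn, map_pow, ← Hom.app_smul, quotC_app _ _ _ hV',
      M.pow_smul, quotC_app _ _ _ hV', Hom.app_smul]

/-- The projection to a quotient Cartier module. -/
def quotπ : M ⟶ quot π hQ hC :=
  mkHom π fun _ hU m ↦ (quotC_app π hQ hC hU m).symm

end Quot

section Abelian

variable {M N : CohCart X q} (f : M ⟶ N)

theorem hom_comp_eq_zero {K : CohCart X q} {f : M ⟶ N} {g : N ⟶ K} (h : f ≫ g = 0) :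
    f.hom ≫ g.hom = 0 := congr(($h).hom)

theorem ker_stable (U : X.Opens) (k : Γ(kernel f.hom, U)) :
    ∃ k', (kernel.ι f.hom).app U k' = M.C.app (op U) ((kernel.ι f.hom).app U k) :=
  exists_kernel_ι_app_eq _ _ _ (by rw [hom_C, kernel_ι_app_eq_zero, map_zero])

theorem exists_of_cokernel_π_eq_zero {M N : X.Modules} [M.IsQuasicoherent] [N.IsQuasicoherent]
    (f : M ⟶ N) {U : X.Opens} (hU : IsAffineOpen U) (n : Γ(N, U))
    (hn : (cokernel.π f).app U n = 0) : ∃ m, f.app U m = n := by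
  obtain ⟨k, rfl⟩ := exists_kernel_ι_app_eq _ _ _ hn
  have := isQuasicoherent_cokernel f
  have := isQuasicoherent_kernel (cokernel.π f)
  obtain ⟨m, rfl⟩ := surjective_app_of_epi (Abelian.factorThruImage f) hU k
  exact ⟨m, congr(($(Abelian.image.fac f)).app U m).symm⟩

theorem cokernel_π_app {M N : X.Modules} (f : M ⟶ N) {U : X.Opens} (m : Γ(M, U)) :
    (cokernel.π f).app U (f.app U m) = 0 :=
  congr(($(cokernel.condition f)).app U m)

theorem coker_stable (U : X.Opens) (hU : IsAffineOpen U) (n : Γ(N.mod, U))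
    (hn : (cokernel.π f.hom).app U n = 0) : (cokernel.π f.hom).app U (N.C.app (op U) n) = 0 := by
  obtain ⟨m, rfl⟩ := exists_of_cokernel_π_eq_zero f.hom hU n hn
  rw [← hom_C, cokernel_π_app]

theorem mkHom_comm_of_epi {M N K : CohCart X q} (π : M ⟶ N) [Epi π.hom] (g : M ⟶ K)
    (h : N.mod ⟶ K.mod) (w : π.hom ≫ h = g.hom) (U : X.Opens) (hU : IsAffineOpen U)
    (n : Γ(N.mod, U)) : h.app U (N.C.app (op U) n) = K.C.app (op U) (h.app U n) := by
  obtain ⟨m, rfl⟩ := surjective_app_of_epi π.hom hU n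
  have h' (x : Γ(M.mod, U)) : h.app U (π.hom.app U x) = g.hom.app U x := congr(($w).app U x)
  rw [← hom_C, h', h', hom_C]

variable [IsLocallyNoetherian X]

/-- The kernel of a morphism of Cartier modules. -/
def ker : CohCart X q := sub (kernel.ι f.hom) (isQuasicoherent_kernel f.hom) (ker_stable f)

/-- The inclusion of the kernel. -/
def kerι : ker f ⟶ M := subι _ _ _

/-- The kernel is a kernel. -/
def kerIsLimit : IsLimit (KernelFork.ofι (kerι f) (hom_ext (kernel.condition f.hom))) :=
  KernelFork.IsLimit.ofι _ _
    (fun {T} g hg ↦ mkHom (kernel.lift f.hom g.hom (hom_comp_eq_zero hg)) fun U _ m ↦ by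
      refine injective_app (kernel.ι f.hom) U ?_
      have h (x : Γ(T.mod, U)) : (kernel.ι f.hom).app U
          ((kernel.lift f.hom g.hom (hom_comp_eq_zero hg)).app U x) = g.hom.app U x :=
        congr(($(kernel.lift_ι f.hom g.hom (hom_comp_eq_zero hg))).app U x)
      exact (h _).trans ((hom_C g U m).trans ((congrArg (M.C.app (op U)) (h m).symm).trans
        (app_subC (kernel.ι f.hom) (ker_stable f) U _).symm)))
    (fun _ _ ↦ hom_ext (kernel.lift_ι _ _ _))
    (fun _ _ _ hm ↦ hom_ext ((cancel_mono (kernel.ι f.hom)).1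
      (congr(($hm).hom).trans (kernel.lift_ι _ _ _).symm)))

/-- The cokernel of a morphism of Cartier modules. -/
def coker : CohCart X q := quot (cokernel.π f.hom) (isQuasicoherent_cokernel f.hom) (coker_stable f)

/-- The projection to the cokernel. -/
def cokerπ : N ⟶ coker f := quotπ _ _ _

instance : Epi (cokerπ f).hom := inferInstanceAs (Epi (cokernel.π f.hom))
instance : Mono (kerι f).hom := inferInstanceAs (Mono (kernel.ι f.hom))

/-- The cokernel is a cokernel. -/
def cokerIsColimit : IsColimit (CokernelCofork.ofπ (cokerπ f) (hom_ext (cokernel.condition f.hom))) :=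
  CokernelCofork.IsColimit.ofπ _ _
    (fun g hg ↦ mkHom (cokernel.desc f.hom g.hom (hom_comp_eq_zero hg))
      (mkHom_comm_of_epi (cokerπ f) g _ (cokernel.π_desc _ _ _)))
    (fun _ _ ↦ hom_ext (cokernel.π_desc _ _ _))
    (fun _ _ _ hm ↦ hom_ext ((cancel_epi (cokernel.π f.hom)).1
      (congr(($hm).hom).trans (cokernel.π_desc _ _ _).symm)))

instance : HasKernels (CohCart X q) := ⟨fun f ↦ ⟨_, kerIsLimit f⟩⟩
instance : HasCokernels (CohCart X q) := ⟨fun f ↦ ⟨_, cokerIsColimit f⟩⟩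

/-- Kernels of Cartier modules are carried by kernels of sheaves, so a vanishing kernel can be read
off the underlying morphism. -/
theorem mono_hom_of_mono [Mono f] : Mono f.hom := by
  have h : kerι f = 0 := by
    rw [← cancel_mono f, zero_comp]
    exact hom_ext (kernel.condition f.hom)
  exact Preadditive.mono_of_kernel_zero congr(($h).hom)

theorem epi_hom_of_epi [Epi f] : Epi f.hom := by
  have h : cokerπ f = 0 := by
    rw [← cancel_epi f, comp_zero]
    exact hom_ext (cokernel.condition f.hom)
  exact Preadditive.epi_of_cokernel_zero congr(($h).hom)

instance : IsNormalMonoCategory (CohCart X q) where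
  normalMonoOfMono f _ := ⟨by
    have := mono_hom_of_mono f
    exact
    { Z := coker f
      g := cokerπ f
      w := hom_ext (cokernel.condition f.hom)
      isLimit := KernelFork.IsLimit.ofι _ _
        (fun {T} g hg ↦ mkHom (Abelian.monoLift f.hom g.hom (hom_comp_eq_zero hg)) fun U _ m ↦ by
          refine injective_app f.hom U ?_
          have h (x : Γ(T.mod, U)) : f.hom.app U
              ((Abelian.monoLift f.hom g.hom (hom_comp_eq_zero hg)).app U x) = g.hom.app U x :=
            congr(($(Abelian.monoLift_comp f.hom g.hom (hom_comp_eq_zero hg))).app U x)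
          rw [h, hom_C, hom_C, ← h])
        (fun _ _ ↦ hom_ext (Abelian.monoLift_comp _ _ _))
        (fun _ _ _ hm ↦ hom_ext ((cancel_mono f.hom).1
          (congr(($hm).hom).trans (Abelian.monoLift_comp _ _ _).symm))) }⟩

instance : IsNormalEpiCategory (CohCart X q) where
  normalEpiOfEpi f _ := ⟨by
    have := epi_hom_of_epi f
    exact
    { W := ker f
      g := kerι f
      w := hom_ext (kernel.condition f.hom)
      isColimit := CokernelCofork.IsColimit.ofπ _ _
        (fun g hg ↦ mkHom (Abelian.epiDesc f.hom g.hom (hom_comp_eq_zero hg))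
          (mkHom_comm_of_epi f g _ (Abelian.comp_epiDesc _ _ _)))
        (fun _ _ ↦ hom_ext (Abelian.comp_epiDesc _ _ _))
        (fun _ _ _ hm ↦ hom_ext ((cancel_epi f.hom).1
          (congr(($hm).hom).trans (Abelian.comp_epiDesc _ _ _).symm))) }⟩

end Abelian

open ZeroObject in
theorem subsingleton_zero (U : X.Opens) : Subsingleton Γ((0 : X.Modules), U) :=
  ⟨fun a b ↦ by
    have (x : Γ((0 : X.Modules), U)) : x = 0 :=
      congr(($((isZero_zero X.Modules).eq_of_src (𝟙 _) 0)).app U x)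
    rw [this a, this b]⟩

open ZeroObject in
/-- The zero Cartier module. -/
def zero (X : Scheme.{u}) (q : ℕ) : CohCart X q where
  mod := 0
  quasicoherent := isQuasicoherent_of_forall_isLocAt _ fun _ _ ↦
    ⟨fun _ _ ↦ ⟨0, 0, (subsingleton_zero _).elim _ _⟩,
      fun _ _ _ ↦ ⟨0, (subsingleton_zero _).elim _ _⟩⟩
  finite U _ := have := subsingleton_zero U; inferInstance
  C := 0
  pow_smul U _ _ := (subsingleton_zero U).elim _ _

instance : HasZeroObject (CohCart X q) :=
  ⟨zero X q, (IsZero.iff_id_eq_zero _).2 (hom_ext (f := 𝟙 (zero X q)) (g := 0)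
    ((isZero_zero X.Modules).eq_of_src _ _))⟩

section Biprod

variable (M N : X.Modules)

theorem biprod_total_app {U : X.Opens} (s : Γ(M ⊞ N, U)) :
    (biprod.inl : M ⟶ M ⊞ N).app U ((biprod.fst : M ⊞ N ⟶ M).app U s) +
      (biprod.inr : N ⟶ M ⊞ N).app U ((biprod.snd : M ⊞ N ⟶ N).app U s) = s :=
  congr(($(biprod.total (X := M) (Y := N))).app U s)

variable {M N}

theorem biprod_ext_app {U : X.Opens} {s t : Γ(M ⊞ N, U)}
    (h₁ : (biprod.fst : M ⊞ N ⟶ M).app U s = (biprod.fst : M ⊞ N ⟶ M).app U t)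
    (h₂ : (biprod.snd : M ⊞ N ⟶ N).app U s = (biprod.snd : M ⊞ N ⟶ N).app U t) : s = t := by
  rw [← biprod_total_app M N s, ← biprod_total_app M N t, h₁, h₂]

variable (M N) in
theorem isQuasicoherent_biprod [M.IsQuasicoherent] [N.IsQuasicoherent] :
    (M ⊞ N).IsQuasicoherent := by
  refine isQuasicoherent_of_forall_isLocAt _ fun U hU ↦ ⟨fun f s ↦ ?_, fun f t ht ↦ ?_⟩
  · obtain ⟨a, m, hm⟩ := (isLocAt_of_isQuasicoherent M hU).exists_smul f
      ((biprod.fst : M ⊞ N ⟶ M).app _ s)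
    obtain ⟨b, n, hn⟩ := (isLocAt_of_isQuasicoherent N hU).exists_smul f
      ((biprod.snd : M ⊞ N ⟶ N).app _ s)
    refine ⟨a + b, (biprod.inl : M ⟶ M ⊞ N).app U (f ^ b • m) +
      (biprod.inr : N ⟶ M ⊞ N).app U (f ^ a • n), ?_⟩
    rw [map_add, ← app_naturality, ← app_naturality, map_smul, map_smul, hm, hn, smul_smul,
      smul_smul, map_pow, map_pow, ← pow_add, ← pow_add, add_comm b a, Hom.app_smul, Hom.app_smul,
      ← smul_add, biprod_total_app]
  · obtain ⟨a, ha⟩ := (isLocAt_of_isQuasicoherent M hU).smul_eq_zero f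
      ((biprod.fst : M ⊞ N ⟶ M).app _ t) (by rw [← app_naturality, ht, map_zero])
    obtain ⟨b, hb⟩ := (isLocAt_of_isQuasicoherent N hU).smul_eq_zero f
      ((biprod.snd : M ⊞ N ⟶ N).app _ t) (by rw [← app_naturality, ht, map_zero])
    refine ⟨a + b, biprod_ext_app ?_ ?_⟩
    · rw [Hom.app_smul, add_comm, pow_add, mul_smul, ha, smul_zero, map_zero]
    · rw [Hom.app_smul, pow_add, mul_smul, hb, smul_zero, map_zero]

/-- The direct sum of two Cartier modules. -/
def prod (M N : CohCart X q) : CohCart X q where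
  mod := M.mod ⊞ N.mod
  quasicoherent := isQuasicoherent_biprod _ _
  finite U hU := by
    have := M.finite U hU
    have := N.finite U hU
    let l₁ : Γ(M.mod, U) →ₗ[Γ(X, U)] Γ(M.mod ⊞ N.mod, U) :=
      { ((biprod.inl : M.mod ⟶ M.mod ⊞ N.mod).app U).hom with map_smul' := Hom.app_smul _ }
    let l₂ : Γ(N.mod, U) →ₗ[Γ(X, U)] Γ(M.mod ⊞ N.mod, U) :=
      { ((biprod.inr : N.mod ⟶ M.mod ⊞ N.mod).app U).hom with map_smul' := Hom.app_smul _ }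
    exact Module.Finite.of_surjective (l₁.coprod l₂) fun s ↦ ⟨(_, _), biprod_total_app _ _ s⟩
  C := Hom.mapPresheaf biprod.fst ≫ M.C ≫ Hom.mapPresheaf biprod.inl +
    Hom.mapPresheaf biprod.snd ≫ N.C ≫ Hom.mapPresheaf biprod.inr
  pow_smul U r s := by
    change (biprod.inl : M.mod ⟶ M.mod ⊞ N.mod).app U (M.C.app (op U)
        ((biprod.fst : M.mod ⊞ N.mod ⟶ M.mod).app U _)) +
      (biprod.inr : N.mod ⟶ M.mod ⊞ N.mod).app U (N.C.app (op U)
        ((biprod.snd : M.mod ⊞ N.mod ⟶ N.mod).app U _)) = r • (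
      (biprod.inl : M.mod ⟶ M.mod ⊞ N.mod).app U (M.C.app (op U)
        ((biprod.fst : M.mod ⊞ N.mod ⟶ M.mod).app U _)) +
      (biprod.inr : N.mod ⟶ M.mod ⊞ N.mod).app U (N.C.app (op U)
        ((biprod.snd : M.mod ⊞ N.mod ⟶ N.mod).app U _)))
    rw [Hom.app_smul, Hom.app_smul, M.pow_smul, N.pow_smul, Hom.app_smul, Hom.app_smul, smul_add]

theorem biprod_simps {M N : X.Modules} {U : X.Opens} (m : Γ(M, U)) (n : Γ(N, U)) :
    (biprod.fst : M ⊞ N ⟶ M).app U ((biprod.inl : M ⟶ M ⊞ N).app U m) = m ∧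
    (biprod.snd : M ⊞ N ⟶ N).app U ((biprod.inl : M ⟶ M ⊞ N).app U m) = 0 ∧
    (biprod.fst : M ⊞ N ⟶ M).app U ((biprod.inr : N ⟶ M ⊞ N).app U n) = 0 ∧
    (biprod.snd : M ⊞ N ⟶ N).app U ((biprod.inr : N ⟶ M ⊞ N).app U n) = n :=
  ⟨congr(($(biprod.inl_fst (X := M) (Y := N))).app U m),
    congr(($(biprod.inl_snd (X := M) (Y := N))).app U m),
    congr(($(biprod.inr_fst (X := M) (Y := N))).app U n),
    congr(($(biprod.inr_snd (X := M) (Y := N))).app U n)⟩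

theorem fst_app_add {M N : X.Modules} {U : X.Opens} (m : Γ(M, U)) (n : Γ(N, U)) :
    (biprod.fst : M ⊞ N ⟶ M).app U ((biprod.inl : M ⟶ M ⊞ N).app U m +
      (biprod.inr : N ⟶ M ⊞ N).app U n) = m := by
  rw [map_add, (biprod_simps m n).1, (biprod_simps m n).2.2.1, add_zero]

theorem snd_app_add {M N : X.Modules} {U : X.Opens} (m : Γ(M, U)) (n : Γ(N, U)) :
    (biprod.snd : M ⊞ N ⟶ N).app U ((biprod.inl : M ⟶ M ⊞ N).app U m +
      (biprod.inr : N ⟶ M ⊞ N).app U n) = n := by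
  rw [map_add, (biprod_simps m n).2.1, (biprod_simps m n).2.2.2, zero_add]

theorem inl_app_C {M N : X.Modules} {U : X.Opens} (c : Γ(M, U) →+ Γ(M, U)) (d : Γ(N, U) →+ Γ(N, U))
    (m : Γ(M, U)) :
    (biprod.inl : M ⟶ M ⊞ N).app U (c ((biprod.fst : M ⊞ N ⟶ M).app U
        ((biprod.inl : M ⟶ M ⊞ N).app U m))) +
      (biprod.inr : N ⟶ M ⊞ N).app U (d ((biprod.snd : M ⊞ N ⟶ N).app U
        ((biprod.inl : M ⟶ M ⊞ N).app U m))) = (biprod.inl : M ⟶ M ⊞ N).app U (c m) := by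
  rw [(biprod_simps m 0).1, (biprod_simps m 0).2.1, map_zero, map_zero, add_zero]

theorem inr_app_C {M N : X.Modules} {U : X.Opens} (c : Γ(M, U) →+ Γ(M, U)) (d : Γ(N, U) →+ Γ(N, U))
    (n : Γ(N, U)) :
    (biprod.inl : M ⟶ M ⊞ N).app U (c ((biprod.fst : M ⊞ N ⟶ M).app U
        ((biprod.inr : N ⟶ M ⊞ N).app U n))) +
      (biprod.inr : N ⟶ M ⊞ N).app U (d ((biprod.snd : M ⊞ N ⟶ N).app U
        ((biprod.inr : N ⟶ M ⊞ N).app U n))) = (biprod.inr : N ⟶ M ⊞ N).app U (d n) := by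
  rw [(biprod_simps 0 n).2.2.1, (biprod_simps 0 n).2.2.2, map_zero, map_zero, zero_add]

/-- The direct sum as a bicone. -/
def bicone (M N : CohCart X q) : BinaryBicone M N where
  pt := M.prod N
  fst := mkHom (M := M.prod N) biprod.fst fun _ _ _ ↦ fst_app_add _ _
  snd := mkHom (M := M.prod N) biprod.snd fun _ _ _ ↦ snd_app_add _ _
  inl := mkHom (N := M.prod N) biprod.inl fun U _ s ↦
    (inl_app_C (M.C.app (op U)).hom (N.C.app (op U)).hom s).symm
  inr := mkHom (N := M.prod N) biprod.inr fun U _ s ↦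
    (inr_app_C (M.C.app (op U)).hom (N.C.app (op U)).hom s).symm
  inl_fst := hom_ext biprod.inl_fst
  inl_snd := hom_ext biprod.inl_snd
  inr_fst := hom_ext biprod.inr_fst
  inr_snd := hom_ext biprod.inr_snd

instance : HasBinaryBiproducts (CohCart X q) :=
  ⟨fun M N ↦ hasBinaryBiproduct_of_total (bicone M N) (hom_ext biprod.total)⟩

instance : HasFiniteProducts (CohCart X q) :=
  have : HasBinaryProducts (CohCart X q) := inferInstance
  have : HasTerminal (CohCart X q) := HasZeroObject.hasTerminal
  hasFiniteProducts_of_has_binary_and_terminal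

instance [IsLocallyNoetherian X] : Abelian (CohCart X q) where

end Biprod

end CohCart
end CartierModules

/-! ### Subobjects in a localization at a Serre class -/

namespace CartierModules
open Limits
section SerreQuotient

open ObjectProperty ObjectProperty.SerreClassLocalization

universe v₁ u₁ v₂ u₂

variable {A : Type u₁} [Category.{v₁} A] {D : Type u₂} [Category.{v₂} D]
  (L : A ⥤ D)

/-- The subobject of `L M` given by a subobject of `M`. -/
def mapSub [L.PreservesMonomorphisms] {M : A} (x : Subobject M) : Subobject (L.obj M) :=
  Subobject.mk (L.map x.arrow)

variable [L.PreservesMonomorphisms]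

theorem mapSub_mono {M : A} {x y : Subobject M} (h : x ≤ y) : mapSub L x ≤ mapSub L y :=
  Subobject.mk_le_mk_of_comm (L.map (Subobject.ofLE x y h)) (by simp [← L.map_comp])

variable [Abelian A]

theorem mapSub_le_of_prop_cokernel (P : ObjectProperty A) [P.IsSerreClass] [L.IsLocalization P.isoModSerre]
    {M : A} {x y : Subobject M} (h : x ≤ y)
    (hP : P (cokernel (Subobject.ofLE x y h))) : mapSub L y ≤ mapSub L x := by
  have : IsIso (L.map (Subobject.ofLE x y h)) := Localization.inverts L P.isoModSerre _
    ((isoModSerre_iff_of_mono P _).2 hP)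
  exact Subobject.mk_le_mk_of_comm (inv (L.map (Subobject.ofLE x y h)))
    (by rw [IsIso.inv_comp_eq, ← L.map_comp, Subobject.ofLE_arrow])

variable [Preadditive D] [L.Additive]

/-- The inclusion of `b` is represented by a right fraction with numerator `φ.f`. The denominator
becomes invertible, so `L.map φ.f` is a monomorphism and the image of `φ.f`, taken before
localization, maps to `b`. -/
theorem mapSub_surjective (P : ObjectProperty A) [P.IsSerreClass] [L.IsLocalization P.isoModSerre]
    {M : A} (b : Subobject (L.obj M)) : ∃ x : Subobject M, mapSub L x = b := by
  have := Localization.essSurj L P.isoModSerre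
  have := preservesEpimorphisms L P
  let := abelian L P
  obtain ⟨φ, hφ⟩ := Localization.exists_rightFraction L P.isoModSerre
    ((L.objObjPreimageIso (b : D)).hom ≫ b.arrow)
  have hs := Localization.inverts L P.isoModSerre φ.s φ.hs
  rw [← cancel_epi (L.map φ.s), MorphismProperty.RightFraction.map_s_comp_map] at hφ
  have hm : Mono (L.map φ.f) := by rw [← hφ]; infer_instance
  let e := factorThruImageSubobject φ.f
  have he : L.map e ≫ L.map (imageSubobject φ.f).arrow = L.map φ.f := by
    rw [← L.map_comp, imageSubobject_arrow_comp]
  have : Mono (L.map e) := by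
    have : Mono (L.map e ≫ L.map (imageSubobject φ.f).arrow) := by rwa [he]
    exact mono_of_mono _ (L.map (imageSubobject φ.f).arrow)
  have : IsIso (L.map e) := isIso_of_mono_of_epi _
  refine ⟨imageSubobject φ.f, ?_⟩
  conv_rhs => rw [← Subobject.mk_arrow b]
  refine Subobject.mk_eq_mk_of_comm _ _
    ((asIso (L.map e)).symm ≪≫ asIso (L.map φ.s) ≪≫ L.objObjPreimageIso (b : D)) ?_
  simp only [Iso.trans_hom, Iso.symm_hom, asIso_inv, asIso_hom, Category.assoc, hφ, ← he,
    IsIso.inv_hom_id_assoc]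

/-- Descending chains can be lifted one step at a time because the lift can be chosen inside the
lift already made. -/
theorem exists_le_of_le_mapSub (P : ObjectProperty A) [P.IsSerreClass] [L.IsLocalization P.isoModSerre]
    {M : A} (z : Subobject M) (b : Subobject (L.obj M))
    (h : b ≤ mapSub L z) : ∃ w ≤ z, mapSub L w = b := by
  replace h : b ≤ Subobject.mk (L.map z.arrow) := h
  have : Mono (Subobject.ofLEMk b (L.map z.arrow) h) := by
    have : Mono (Subobject.ofLEMk b (L.map z.arrow) h ≫ L.map z.arrow) := by
      rw [Subobject.ofLEMk_comp]
      infer_instance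
    exact mono_of_mono _ (L.map z.arrow)
  obtain ⟨v, hv⟩ := mapSub_surjective L P
    (Subobject.mk (Subobject.ofLEMk b (L.map z.arrow) h))
  refine ⟨Subobject.mk (v.arrow ≫ z.arrow), Subobject.mk_le_of_comm v.arrow rfl, ?_⟩
  have h₁ : mapSub L (Subobject.mk (v.arrow ≫ z.arrow)) =
      Subobject.mk (L.map v.arrow ≫ L.map z.arrow) :=
    Subobject.mk_eq_mk_of_comm _ _ (L.mapIso (Subobject.underlyingIso _)) (by
      rw [Functor.mapIso_hom, ← L.map_comp, ← L.map_comp,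
        Subobject.underlyingIso_hom_comp_eq_mk])
  rw [h₁]
  have h₂ := congrArg (Subobject.map (L.map z.arrow)).obj hv
  rw [mapSub, Subobject.map_mk, Subobject.map_mk] at h₂
  exact h₂.trans (Subobject.mk_eq_of_comm _ (Iso.refl _) (by simp))

/-- `L` preserves kernels, and `y` is the kernel of the projection to its cokernel. -/
theorem mapSub_le_of_map_eq_zero (P : ObjectProperty A) [P.IsSerreClass] [L.IsLocalization P.isoModSerre]
    {M : A} {x y : Subobject M}
    (h : L.map (x.arrow ≫ cokernel.π y.arrow) = 0) : mapSub L x ≤ mapSub L y := by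
  let := abelian L P
  have := preservesKernel L P (cokernel.π y.arrow)
  have hk : IsLimit (KernelFork.ofι y.arrow (cokernel.condition y.arrow)) :=
    Abelian.monoIsKernelOfCokernel _ (colimit.isColimit _)
  have hl := (KernelFork.isLimitMapConeEquiv _ L).1 (isLimitOfPreserves L hk)
  rw [L.map_comp] at h
  obtain ⟨l, hl⟩ := KernelFork.IsLimit.lift' hl _ h
  exact Subobject.mk_le_mk_of_comm l hl

theorem map_eq_zero_of_mapSub_le {M : A} {x y : Subobject M} (h : mapSub L x ≤ mapSub L y) :
    L.map (x.arrow ≫ cokernel.π y.arrow) = 0 := by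
  rw [L.map_comp, ← Subobject.ofMkLEMk_comp h, Category.assoc, ← L.map_comp, cokernel.condition,
    L.map_zero, comp_zero]

/-- An arbitrary lift `x` of `b` need not contain `z`. The image of `z ⊞ x` in `M` does, and it has
the same localization as `x` because `z` dies modulo `x` there. -/
theorem exists_ge_of_mapSub_le (P : ObjectProperty A) [P.IsSerreClass] [L.IsLocalization P.isoModSerre]
    {M : A} (z : Subobject M) (b : Subobject (L.obj M))
    (h : mapSub L z ≤ b) : ∃ w ≥ z, mapSub L w = b := by
  have := preservesEpimorphisms L P
  obtain ⟨x, rfl⟩ := mapSub_surjective L P b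
  let f := biprod.desc z.arrow x.arrow
  have hle {t : Subobject M} (k : (t : A) ⟶ (z : A) ⊞ (x : A)) (hk : k ≫ f = t.arrow) :
      t ≤ imageSubobject f :=
    Subobject.le_of_comm (k ≫ factorThruImageSubobject f)
      (by rw [Category.assoc, imageSubobject_arrow_comp, hk])
  refine ⟨imageSubobject f, hle biprod.inl (biprod.inl_desc _ _),
    le_antisymm (mapSub_le_of_map_eq_zero L P ?_) (mapSub_mono L (hle biprod.inr (biprod.inr_desc _ _)))⟩
  rw [← cancel_epi (L.map (factorThruImageSubobject f)), comp_zero, ← L.map_comp, ← Category.assoc,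
    imageSubobject_arrow_comp, show f = biprod.fst ≫ z.arrow + biprod.snd ≫ x.arrow from
    biprod.desc_eq, Preadditive.add_comp, Category.assoc, Category.assoc, cokernel.condition,
    comp_zero, add_zero, L.map_comp, map_eq_zero_of_mapSub_le L h, comp_zero]

theorem wellFoundedGT_subobject_obj (P : ObjectProperty A) [P.IsSerreClass] [L.IsLocalization P.isoModSerre]
    {M : A} [WellFoundedGT (Subobject M)] :
    WellFoundedGT (Subobject (L.obj M)) := by
  rw [wellFoundedGT_iff_monotone_chain_condition]
  intro b
  choose g hg₁ hg₂ using exists_ge_of_mapSub_le L P (M := M)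
  let y : (n : ℕ) → {w : Subobject M // mapSub L w = b n} := fun n ↦ Nat.rec
    ⟨_, (mapSub_surjective L P (b 0)).choose_spec⟩
    (fun n w ↦ ⟨g w.1 (b (n + 1)) (w.2.le.trans (b.monotone n.le_succ)), hg₂ _ _ _⟩) n
  have hy : Monotone fun n ↦ (y n).1 := monotone_nat_of_le_succ fun n ↦ hg₁ _ _ _
  obtain ⟨n, hn⟩ := wellFoundedGT_iff_monotone_chain_condition.1 ‹_› ⟨_, hy⟩
  exact ⟨n, fun m hm ↦ by rw [← (y n).2, ← (y m).2]; exact congrArg _ (hn m hm)⟩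

/-- A descending chain is lifted recursively to a descending chain in `M`. Steps of the lift with
cokernel in `P` become equalities after localization. -/
theorem wellFoundedLT_subobject_obj (P : ObjectProperty A) [P.IsSerreClass] [L.IsLocalization P.isoModSerre]
    {M : A} (hM : ∀ (N : ℕ → Subobject M) (hN : Antitone N),
    ∃ i₀ : ℕ, ∀ i ≥ i₀, P (cokernel (Subobject.ofLE (N (i + 1)) (N i) (hN i.le_succ)))) :
    WellFoundedLT (Subobject (L.obj M)) := by
  rw [← wellFoundedGT_dual_iff, wellFoundedGT_iff_monotone_chain_condition]
  intro b
  choose g hg₁ hg₂ using exists_le_of_le_mapSub L P (M := M)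
  let b' : ℕ → Subobject (L.obj M) := fun n ↦ OrderDual.ofDual (b n)
  have hb' : Antitone b' := fun i j h ↦ b.monotone h
  let y : (n : ℕ) → {w : Subobject M // mapSub L w = b' n} := fun n ↦ Nat.rec
    ⟨_, (mapSub_surjective L P (b' 0)).choose_spec⟩
    (fun n w ↦ ⟨g w.1 (b' (n + 1)) ((hb' n.le_succ).trans w.2.ge), hg₂ _ _ _⟩) n
  have hy : Antitone fun n ↦ (y n).1 := antitone_nat_of_succ_le fun n ↦ hg₁ _ _ _
  obtain ⟨n, hn⟩ := hM _ hy
  refine ⟨n, fun m hm ↦ ?_⟩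
  change b' n = b' m
  rw [← (y n).2, ← (y m).2]
  induction m, hm using Nat.le_induction with
  | base => rfl
  | succ k hk ih =>
    rw [ih]
    exact le_antisymm (mapSub_le_of_prop_cokernel L P (hy k.le_succ) (hn k hk))
      (mapSub_mono L (hy k.le_succ))

end SerreQuotient

theorem hasFiniteLength_of_wellFounded {𝒞 : Type*} [Category 𝒞] (A : 𝒞) [OrderBot (Subobject A)]
    [WellFoundedLT (Subobject A)] [WellFoundedGT (Subobject A)] : HasFiniteLength A := by
  obtain ⟨a, h₀, n, h₁, h⟩ :=
    exists_covBy_seq_of_wellFoundedLT_wellFoundedGT_of_le (bot_le : (⊥ : Subobject A) ≤ ⊤)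
  refine ⟨⟨n, fun i ↦ a i, fun i ↦ h i i.2⟩, fun b ↦ ?_, h₁⟩
  change a 0 ≤ b
  rw [h₀]
  exact bot_le
end CartierModules

/-! ### Nilpotent Cartier modules as a Serre class, and finiteness of crystals -/

namespace CartierModules
open Scheme.Modules Limits ZeroObject
variable {X : Scheme.{u}} {q : ℕ}
namespace CohCart

variable {M N : CohCart X q}

theorem hom_iterate_C (f : M ⟶ N) (U : X.Opens) (e : ℕ) (m : Γ(M.mod, U)) :
    f.hom.app U ((M.C.app (op U))^[e] m) = (N.C.app (op U))^[e] (f.hom.app U m) :=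
  (Function.Semiconj.iterate_right (fun m ↦ hom_C f U m) e) m

theorem iterate_C_naturality (M : CohCart X q) {U V : X.Opens} (h : V ≤ U) (e : ℕ)
    (m : Γ(M.mod, U)) :
    (M.C.app (op V))^[e] (M.mod.presheaf.map (homOfLE h).op m) =
      M.mod.presheaf.map (homOfLE h).op ((M.C.app (op U))^[e] m) :=
  ((Function.Semiconj.iterate_right (f := M.mod.presheaf.map (homOfLE h).op)
    (fun m ↦ (C_naturality M h m).symm) e) m).symm

theorem iterate_C_pow_smul (M : CohCart X q) (U : X.Opens) (e : ℕ) (r : Γ(X, U))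
    (m : Γ(M.mod, U)) :
    (M.C.app (op U))^[e] (r ^ q ^ e • m) = r • (M.C.app (op U))^[e] m := by
  induction e generalizing m with
  | zero => simp
  | succ e ih =>
    rw [Function.iterate_succ_apply, Function.iterate_succ_apply, pow_succ, pow_mul, M.pow_smul, ih]

theorem iterate_C_eq_zero_of_affine (M : CohCart X q) (e : ℕ)
    (h : ∀ U : X.Opens, IsAffineOpen U → ∀ m : Γ(M.mod, U), (M.C.app (op U))^[e] m = 0)
    (U : X.Opens) (m : Γ(M.mod, U)) : (M.C.app (op U))^[e] m = 0 := by
  refine section_ext_affine _ fun V hV hV' ↦ ?_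
  rw [← iterate_C_naturality, h V hV', map_zero]

/-- Vanishing of a power of the structural map can be checked on an affine cover. -/
theorem iterate_C_eq_zero_of_cover (hq : 0 < q) (M : CohCart X q) (e : ℕ)
    (h : ∀ x : X, ∃ U : X.Opens, x ∈ U ∧ IsAffineOpen U ∧
      ∀ m : Γ(M.mod, U), (M.C.app (op U))^[e] m = 0)
    (V : X.Opens) (m : Γ(M.mod, V)) : (M.C.app (op V))^[e] m = 0 := by
  refine TopCat.Presheaf.section_ext ⟨M.mod.presheaf, M.mod.isSheaf⟩ V _ _ fun x hx ↦ ?_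
  obtain ⟨U, hxU, hU, hM⟩ := h x
  obtain ⟨f, hf, hxf⟩ := hU.exists_basicOpen_le ⟨x, hx⟩ hxU
  suffices hs : ∀ s : Γ(M.mod, X.basicOpen f), (M.C.app (op (X.basicOpen f)))^[e] s = 0 by
    have := congr(M.mod.presheaf.germ _ x hxf $(hs (M.mod.presheaf.map (homOfLE hf).op m)))
    rw [iterate_C_naturality, map_zero, TopCat.Presheaf.germ_res_apply] at this
    exact this.trans (map_zero _).symm
  intro s
  obtain ⟨n, t, ht⟩ := (isLocAt_of_isQuasicoherent M.mod hU).exists_smul f s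
  set g := X.presheaf.map (homOfLE (X.basicOpen_le f)).op f with hg
  have hu : IsUnit g := RingedSpace.isUnit_res_basicOpen _ f
  rw [← (hu.pow n).smul_eq_zero, ← iterate_C_pow_smul]
  have hle : n ≤ n * q ^ e := Nat.le_mul_of_pos_right n (pow_pos hq e)
  -- Moving `g ^ n` inside the iterate turns it into `g ^ (n * q ^ e)`; a factor `g ^ n` of this
  -- already makes `s` the restriction of a section over `U`.
  rw [← pow_mul, ← Nat.sub_add_cancel hle, pow_add, mul_smul]
  have ht' : g ^ n • s = M.mod.presheaf.map (homOfLE (X.basicOpen_le f)).op t := by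
    exact ht.symm
  rw [ht', hg, ← map_pow, ← Scheme.Modules.map_smul, iterate_C_naturality, hM, map_zero]

/-- Nilpotent Cartier modules. -/
def isNilp (X : Scheme.{u}) (q : ℕ) : ObjectProperty (CohCart X q) := fun M ↦
  ∃ e : ℕ, ∀ (U : X.Opens) (m : Γ(M.mod, U)), (M.C.app (op U))^[e] m = 0

theorem eq_zero_of_isZero (hM : IsZero M) (U : X.Opens) (m : Γ(M.mod, U)) : m = 0 :=
  congr((($(hM.eq_of_src (𝟙 M) 0)).hom).app U m)

/-- Nilpotence of the cokernel can be checked on an affine cover. -/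
theorem iterate_C_coker_eq_zero (hq : 0 < q) (φ : M ⟶ N) (e : ℕ)
    (h : ∀ x : X, ∃ U : X.Opens, x ∈ U ∧ IsAffineOpen U ∧
      ∀ n : Γ(N.mod, U), ∃ m, φ.hom.app U m = (N.C.app (op U))^[e] n)
    (U : X.Opens) (c : Γ((coker φ).mod, U)) : ((coker φ).C.app (op U))^[e] c = 0 := by
  refine iterate_C_eq_zero_of_cover hq _ e (fun x ↦ ?_) U c
  obtain ⟨U, hx, hU, h⟩ := h x
  refine ⟨U, hx, hU, fun c ↦ ?_⟩
  obtain ⟨n, rfl⟩ := surjective_app_of_epi (cokerπ φ).hom hU c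
  obtain ⟨m, hm⟩ := h n
  refine (hom_iterate_C (cokerπ φ) U e n).symm.trans ?_
  rw [← hm]
  exact cokernel_π_app φ.hom m

/-- The inclusion of a Cartier submodule on sections. -/
def sectionsMap (S : Subobject M) (U : X.Opens) :
    Γ((S : CohCart X q).mod, U) →ₗ[Γ(X, U)] Γ(M.mod, U) :=
  { (S.arrow.hom.app U).hom with map_smul' := Hom.app_smul S.arrow.hom }

/-- The sections of a Cartier submodule, as a submodule of the sections of the Cartier module. -/
def sections (S : Subobject M) (U : X.Opens) : Submodule Γ(X, U) Γ(M.mod, U) :=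
  LinearMap.range (sectionsMap S U)

theorem sections_mono {S T : Subobject M} (h : S ≤ T) (U : X.Opens) :
    sections S U ≤ sections T U := by
  rintro _ ⟨s, rfl⟩
  exact ⟨(S.ofLE T h).hom.app U s, congr((($(Subobject.ofLE_arrow h)).hom).app U s)⟩

theorem C_mem_sections {S : Subobject M} {U : X.Opens} {m : Γ(M.mod, U)} (hm : m ∈ sections S U) :
    M.C.app (op U) m ∈ sections S U := by
  obtain ⟨s, rfl⟩ := hm
  exact ⟨_, hom_C S.arrow U s⟩

theorem nilpotentCokernel_of_cover (hq : 0 < q) (φ : M ⟶ N) (e : ℕ)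
    (h : ∀ x : X, ∃ U : X.Opens, x ∈ U ∧ IsAffineOpen U ∧
      ∀ n : Γ(N.mod, U), ∃ m, φ.hom.app U m = (N.C.app (op U))^[e] n) : NilpotentCokernel φ :=
  ⟨e, fun U n ↦ (hom_iterate_C (cokerπ φ) U e n).trans (iterate_C_coker_eq_zero hq φ e h U _)⟩

theorem epi_of_cover (hq : 0 < q) (φ : M ⟶ N)
    (h : ∀ x : X, ∃ U : X.Opens, x ∈ U ∧ IsAffineOpen U ∧
      Function.Surjective (φ.hom.app U)) : Epi φ := by
  have hz : cokerπ φ = 0 := by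
    refine hom_ext ?_
    ext U n
    -- With exponent 0 the nilpotence criterion says that the cokernel itself vanishes.
    exact iterate_C_coker_eq_zero hq φ 0 h U _
  have : Epi (cokerπ φ) := Cofork.IsColimit.epi (cokerIsColimit φ)
  exact Preadditive.epi_of_isZero_cokernel' _ (cokerIsColimit φ)
    ((IsZero.iff_id_eq_zero _).2 ((cancel_epi (cokerπ φ)).1
      ((Category.comp_id _).trans (hz.trans comp_zero.symm))))

variable [IsLocallyNoetherian X]

instance : (isNilp X q).IsSerreClass where
  exists_zero := ⟨0, isZero_zero _, 0, fun U m ↦ eq_zero_of_isZero (isZero_zero _) U m⟩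
  prop_of_mono f _ := by
    rintro ⟨e, he⟩
    have := mono_hom_of_mono f
    exact ⟨e, fun U m ↦ injective_app f.hom U (by rw [hom_iterate_C, he, map_zero])⟩
  prop_of_epi f _ := by
    rintro ⟨e, he⟩
    have := epi_hom_of_epi f
    refine ⟨e, iterate_C_eq_zero_of_affine _ e fun U hU n ↦ ?_⟩
    obtain ⟨m, rfl⟩ := surjective_app_of_epi f.hom hU n
    rw [← hom_iterate_C, he, map_zero]
  prop_X₂_of_shortExact {S} hS := by
    rintro ⟨e₁, h₁⟩ ⟨e₃, h₃⟩
    -- After `e₃` iterations a section dies in the quotient, so it comes from the subobject, and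
    -- `e₁` more iterations kill it.
    refine ⟨e₁ + e₃, fun U m ↦ ?_⟩
    let y : Γ(kernel S.g.hom, U) :=
      (exists_kernel_ι_app_eq S.g.hom U ((S.X₂.C.app (op U))^[e₃] m)
        (by rw [hom_iterate_C, h₃])).choose
    have hy : (kerι S.g).hom.app U y = (S.X₂.C.app (op U))^[e₃] m :=
      (exists_kernel_ι_app_eq S.g.hom U ((S.X₂.C.app (op U))^[e₃] m)
        (by rw [hom_iterate_C, h₃])).choose_spec
    have := hS.mono_f
    obtain ⟨l, hl⟩ := KernelFork.IsLimit.lift' hS.fIsKernel (kerι S.g)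
      (hom_ext (kernel.condition S.g.hom))
    have hl' : S.f.hom.app U (l.hom.app U y) = (kerι S.g).hom.app U y :=
      congr((($hl).hom).app U y)
    rw [Function.iterate_add_apply, ← hy, ← hl', ← hom_iterate_C, h₁, map_zero]

theorem isNilp_kernel_iff (φ : M ⟶ N) : isNilp X q (kernel φ) ↔ NilpotentKernel φ := by
  refine ((isNilp X q).prop_iff_of_iso
    ((kernelIsKernel φ).conePointUniqueUpToIso (kerIsLimit φ))).trans ?_
  refine ⟨fun ⟨e, h⟩ ↦ ⟨e, fun U m hm ↦ ?_⟩, fun ⟨e, h⟩ ↦ ⟨e, fun U m ↦ ?_⟩⟩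
  · obtain ⟨k, rfl⟩ := exists_kernel_ι_app_eq _ _ _ hm
    exact (hom_iterate_C (kerι φ) U e k).symm.trans
      ((congrArg ((kerι φ).hom.app U) (h U k)).trans (map_zero _))
  · refine injective_app (kerι φ).hom U ?_
    refine (hom_iterate_C (kerι φ) U e m).trans ?_
    rw [map_zero]
    exact h U _ (kernel_ι_app_eq_zero _ _ _)

theorem isNilp_cokernel_iff (φ : M ⟶ N) : isNilp X q (cokernel φ) ↔ NilpotentCokernel φ := by
  refine ((isNilp X q).prop_iff_of_iso
    ((cokernelIsCokernel φ).coconePointUniqueUpToIso (cokerIsColimit φ))).trans ?_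
  refine ⟨fun ⟨e, h⟩ ↦ ⟨e, fun U m ↦ ?_⟩, fun ⟨e, h⟩ ↦
    ⟨e, iterate_C_eq_zero_of_affine _ e fun U hU m ↦ ?_⟩⟩
  · exact (hom_iterate_C (cokerπ φ) U e m).trans (h U _)
  · obtain ⟨n, rfl⟩ := surjective_app_of_epi (cokerπ φ).hom hU m
    exact (hom_iterate_C (cokerπ φ) U e n).symm.trans (h U n)

theorem nilIso_eq_isoModSerre : nilIso X q = (isNilp X q).isoModSerre := by
  ext M N φ
  exact and_congr (isNilp_kernel_iff φ).symm (isNilp_cokernel_iff φ).symm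

theorem exists_ofLE_app_eq {S T : Subobject M} (h : S ≤ T) {U : X.Opens} (t : Γ((T : CohCart X q).mod, U))
    (ht : T.arrow.hom.app U t ∈ sections S U) : ∃ s, (S.ofLE T h).hom.app U s = t := by
  obtain ⟨s, hs⟩ := ht
  have := mono_hom_of_mono T.arrow
  exact ⟨s, injective_app T.arrow.hom U
    ((congr((($(Subobject.ofLE_arrow h)).hom).app U s) : _ = _).trans hs)⟩

/-- Over an affine open the sections form a Noetherian module. A finite affine cover gives a common
index, past which the inclusions are epimorphisms. -/
theorem wellFoundedGT_subobject (hq : 0 < q) [CompactSpace X] (M : CohCart X q) :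
    WellFoundedGT (Subobject M) := by
  rw [wellFoundedGT_iff_monotone_chain_condition]
  intro S
  have key : ∀ U : X.affineOpens, ∃ n, ∀ m ≥ n, sections (S n) U = sections (S m) U := fun U ↦ by
    have := IsLocallyNoetherian.component_noetherian U
    have := M.finite U U.2
    have : IsNoetherian Γ(X, U) Γ(M.mod, U) := inferInstance
    exact monotone_stabilizes_iff_noetherian.2 this
      ⟨fun n ↦ sections (S n) U, fun _ _ h ↦ sections_mono (S.monotone h) U⟩
  choose n hn using key
  obtain ⟨T, hT, hT'⟩ := (isCompact_and_isOpen_iff_finite_and_eq_biUnion_affineOpens).1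
    ⟨isCompact_univ (X := X), isOpen_univ⟩
  refine ⟨hT.toFinset.sup n, fun m hm ↦ le_antisymm (S.monotone hm) ?_⟩
  have : Epi ((S (hT.toFinset.sup n)).ofLE (S m) (S.monotone hm)) := by
    refine epi_of_cover hq _ fun x ↦ ?_
    obtain ⟨U, hU, hx⟩ := Set.mem_iUnion₂.1 (hT' ▸ Set.mem_univ x)
    refine ⟨U, hx, U.2, fun t ↦ exists_ofLE_app_eq _ t ?_⟩
    have hle : n U ≤ hT.toFinset.sup n := Finset.le_sup (hT.mem_toFinset.2 hU)
    rw [← hn U _ hle, hn U m (hle.trans hm)]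
    exact ⟨t, rfl⟩
  have := isIso_of_mono_of_epi ((S (hT.toFinset.sup n)).ofLE (S m) (S.monotone hm))
  exact Subobject.le_of_comm (inv ((S (hT.toFinset.sup n)).ofLE (S m) (S.monotone hm)))
    (by rw [IsIso.inv_comp_eq, Subobject.ofLE_arrow])

end CohCart

/-- Cartier crystals have finite length once descending chains of Cartier modules stabilize up to
nilpotence. -/
theorem crystal_finiteness (hq : 0 < q) [IsLocallyNoetherian X] [CompactSpace X]
    (h : ∀ (M : CohCart X q) (N : ℕ → Subobject M) (hN : Antitone N),
      ∃ i₀ : ℕ, ∀ i ≥ i₀, CohCart.NilpotentCokernel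
        (Subobject.ofLE (N (i + 1)) (N i) (hN i.le_succ))) (A : CartierCrystal X q) :
    IsNoetherianObject A ∧ IsArtinianObject A ∧ HasFiniteLength A := by
  -- The two classes of morphisms are equal only propositionally, and the localized category depends
  -- on the class; hence the detour through a variable `W`.
  suffices H : ∀ (W : MorphismProperty (CohCart X q)), W = (CohCart.isNilp X q).isoModSerre →
      ∀ A : W.Localization, IsNoetherianObject A ∧ IsArtinianObject A ∧ HasFiniteLength A from
    H _ CohCart.nilIso_eq_isoModSerre A
  rintro _ rfl A
  let P := CohCart.isNilp X q
  let L := P.isoModSerre.Q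
  have := ObjectProperty.SerreClassLocalization.preservesMonomorphisms L P
  let := ObjectProperty.SerreClassLocalization.abelian L P
  have := Localization.essSurj L P.isoModSerre
  let M := L.objPreimage A
  let e := L.objObjPreimageIso A
  have := CohCart.wellFoundedGT_subobject hq M
  have h₁ : IsNoetherianObject A :=
    ⟨ObjectProperty.prop_of_iso _ e (wellFoundedGT_subobject_obj L P (M := M))⟩
  have h₂ : IsArtinianObject A :=
    ⟨ObjectProperty.prop_of_iso _ e (wellFoundedLT_subobject_obj L P (M := M) fun N hN ↦
      (h M N hN).imp fun i₀ hi i hi' ↦ (CohCart.isNilp_cokernel_iff _).2 (hi i hi'))⟩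
  exact ⟨h₁, h₂, hasFiniteLength_of_wellFounded A⟩

end CartierModules

/-! ### Commutative algebra: descending chains at a minimal prime, and stable images -/

namespace CartierModules

section LocalArtinian

theorem isArtinian_of_smul_eq_zero {A M : Type*} [CommRing A] [IsLocalRing A] [IsNoetherianRing A]
    [AddCommGroup M] [Module A M] [Module.Finite A M] (I : Ideal A)
    (hI : IsLocalRing.maximalIdeal A ∈ I.minimalPrimes) (h : ∀ a ∈ I, ∀ m : M, a • m = 0) :
    IsArtinian A M := by
  have := IsLocalRing.quotient_artinian_of_mem_minimalPrimes_of_isLocalRing I hI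
  have ht : Module.IsTorsionBySet A M I := fun m a ↦ h a a.2 m
  let : Module (A ⧸ I) M := ht.module
  have : IsScalarTower A (A ⧸ I) M := ht.isScalarTower
  have : Module.Finite (A ⧸ I) M := Module.Finite.of_restrictScalars_finite A (A ⧸ I) M
  have : IsArtinian (A ⧸ I) M := inferInstance
  exact isArtinian_of_surjective_algebraMap (R := A ⧸ I) (Ideal.Quotient.mk_surjective)

/-- `A ⧸ I` is an Artinian local ring and the chain is pulled back from `M ⧸ I M`, a finite module
over it. -/
theorem antitone_stabilizes_of_smul_le {A M : Type*} [CommRing A] [IsLocalRing A]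
    [IsNoetherianRing A] [AddCommGroup M] [Module A M] [Module.Finite A M] (I : Ideal A)
    (hI : IsLocalRing.maximalIdeal A ∈ I.minimalPrimes) (N : ℕ → Submodule A M) (hN : Antitone N)
    (h : ∀ e, I • ⊤ ≤ N e) : ∃ e, ∀ e' ≥ e, N e ≤ N e' := by
  have := isArtinian_of_smul_eq_zero (M := M ⧸ (I • ⊤ : Submodule A M)) I hI (by
    rintro a ha m
    obtain ⟨m, rfl⟩ := Submodule.mkQ_surjective _ m
    rw [← map_smul]
    exact (Submodule.Quotient.mk_eq_zero _).2 (Submodule.smul_mem_smul ha trivial))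
  obtain ⟨e, he⟩ := IsArtinian.monotone_stabilizes
    ⟨fun e ↦ OrderDual.toDual ((N e).map (I • ⊤ : Submodule A M).mkQ),
      fun i j hij ↦ Submodule.map_mono (hN hij)⟩
  refine ⟨e, fun e' he' ↦ ?_⟩
  have key (k : ℕ) : ((N k).map (I • ⊤ : Submodule A M).mkQ).comap (I • ⊤ : Submodule A M).mkQ =
      N k := by rw [Submodule.comap_map_mkQ, sup_eq_right.2 (h k)]
  rw [← key e, ← key e']
  exact Submodule.comap_mono (congrArg OrderDual.ofDual (he e' he')).le

/-- Common denominators: this turns a containment known after localization into multiplication by a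
single element. -/
theorem exists_smul_mem_of_fg {R M : Type*} [CommRing R] [AddCommGroup M] [Module R M]
    (S : Submonoid R) (N L : Submodule R M) (hN : N.FG) (h : ∀ m ∈ N, ∃ s ∈ S, s • m ∈ L) :
    ∃ s ∈ S, ∀ m ∈ N, s • m ∈ L := by
  induction N, hN using Submodule.fg_induction with
  | singleton x =>
    obtain ⟨s, hs, hx⟩ := h x (Submodule.mem_span_singleton_self x)
    refine ⟨s, hs, fun m hm ↦ ?_⟩
    obtain ⟨r, rfl⟩ := Submodule.mem_span_singleton.1 hm
    rw [smul_comm]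
    exact L.smul_mem r hx
  | sup N₁ N₂ _ _ h₁ h₂ =>
    obtain ⟨s, hs, hs'⟩ := h₁ fun m hm ↦ h m (Submodule.mem_sup_left hm)
    obtain ⟨t, ht, ht'⟩ := h₂ fun m hm ↦ h m (Submodule.mem_sup_right hm)
    refine ⟨s * t, S.mul_mem hs ht, fun m hm ↦ ?_⟩
    obtain ⟨a, ha, b, hb, rfl⟩ := Submodule.mem_sup.1 hm
    rw [smul_add, mul_comm, mul_smul, mul_comm, mul_smul]
    exact L.add_mem (L.smul_mem _ (hs' a ha)) (L.smul_mem _ (ht' b hb))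

variable {R M : Type*} [CommRing R] [IsNoetherianRing R] [AddCommGroup M] [Module R M]
  [Module.Finite R M]

/-- A descending chain of submodules containing `J M` stabilizes at a minimal prime of `J`. -/
theorem antitone_stabilizes_at_minimalPrime {J p : Ideal R} (hp : p ∈ J.minimalPrimes)
    (N : ℕ → Submodule R M) (hN : Antitone N) (h : ∀ e, J • ⊤ ≤ N e) :
    ∃ e, ∀ e' ≥ e, ∃ s ∉ p, ∀ m ∈ N e, s • m ∈ N e' := by
  have hp' : p.IsPrime := hp.1.1
  let A := Localization.AtPrime p
  have : IsNoetherianRing A := IsLocalization.isNoetherianRing p.primeCompl A inferInstance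
  have hmin : IsLocalRing.maximalIdeal A ∈ (J.map (algebraMap R A)).minimalPrimes := by
    rw [IsLocalization.minimalPrimes_map p.primeCompl A]
    change (IsLocalRing.maximalIdeal A).under R ∈ J.minimalPrimes
    rwa [IsLocalization.AtPrime.under_maximalIdeal A p]
  obtain ⟨e, he⟩ := antitone_stabilizes_of_smul_le (J.map (algebraMap R A)) hmin
    (fun e ↦ (N e).localized p.primeCompl)
    (fun i j hij ↦ (Submodule.localized'gi A p.primeCompl
      (LocalizedModule.mkLinearMap p.primeCompl M)).gc.monotone_l (hN hij)) fun e ↦ by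
        refine le_trans ?_ ((Submodule.localized'gi A p.primeCompl
          (LocalizedModule.mkLinearMap p.primeCompl M)).gc.monotone_l (h e))
        rw [Submodule.localized'_smul, Submodule.localized'_top]
        refine Submodule.smul_mono_left ?_
        rw [Ideal.map_le_iff_le_comap]
        intro x hx
        exact ⟨x, hx, 1, by simp⟩
  refine ⟨e, fun e' he' ↦ ?_⟩
  -- The index `e` serves every `e'`, but the denominator obtained here depends on `e'`. Removing
  -- this dependence is the task of the generic bounds below.
  refine exists_smul_mem_of_fg p.primeCompl _ _ (IsNoetherian.noetherian _) fun m hm ↦ ?_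
  obtain ⟨n, hn, s, hs⟩ := he e' he' ⟨m, hm, 1, rfl⟩
  rw [IsLocalizedModule.mk'_eq_mk'_iff] at hs
  obtain ⟨t, ht⟩ := hs
  refine ⟨t * s, p.primeCompl.mul_mem t.2 s.2, ?_⟩
  rw [one_smul] at ht
  rw [mul_smul]
  exact (congrArg (· ∈ N e') ht).mpr ((N e').smul_mem t hn)

theorem antitone_stabilizes_at_minimalPrime' {J p : Ideal R} (hp : p ∈ J.minimalPrimes)
    (L : Submodule R M) (N : ℕ → Submodule R M) (hN : Antitone N) (h : ∀ e, J • L ≤ N e) :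
    ∃ e, ∀ e' ≥ e, ∃ s ∉ p, ∀ m ∈ N e ⊓ L, s • m ∈ N e' := by
  obtain ⟨e, he⟩ := antitone_stabilizes_at_minimalPrime (M := L) hp
    (fun e ↦ (N e).comap L.subtype) (fun i j hij ↦ Submodule.comap_mono (hN hij)) fun e ↦ by
      rw [← Submodule.map_le_iff_le_comap, Submodule.map_smul'', Submodule.map_top,
        Submodule.range_subtype]
      exact h e
  refine ⟨e, fun e' he' ↦ ?_⟩
  obtain ⟨s, hs, h⟩ := he e' he'
  exact ⟨s, hs, fun m hm ↦ h ⟨m, hm.2⟩ hm.1⟩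

end LocalArtinian

/-- An additive endomorphism of a module with `C (r ^ q • m) = r • C m`. -/
structure IsCartier (R : Type*) {K : Type*} [CommRing R] [AddCommGroup K] [Module R K] (q : ℕ)
    (C : K →+ K) : Prop where
  pow_smul : ∀ (r : R) (m : K), C (r ^ q • m) = r • C m

namespace IsCartier

variable {R K : Type*} [CommRing R] [AddCommGroup K] [Module R K] {q : ℕ} {C : K →+ K}
  (hC : IsCartier R q C)

theorem iterate_pow_smul (hC : IsCartier R q C) (e : ℕ) (r : R) (m : K) :
    C^[e] (r ^ q ^ e • m) = r • C^[e] m := by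
  induction e generalizing m with
  | zero => simp
  | succ e ih =>
    rw [Function.iterate_succ_apply, Function.iterate_succ_apply, pow_succ, pow_mul, hC.pow_smul, ih]

/-- The image of a submodule under `C ^ e`. -/
def image (e : ℕ) (N : Submodule R K) : Submodule R K where
  carrier := C^[e] '' N
  add_mem' := by
    rintro _ _ ⟨a, ha, rfl⟩ ⟨b, hb, rfl⟩
    exact ⟨a + b, N.add_mem ha hb, iterate_map_add C e a b⟩
  zero_mem' := ⟨0, N.zero_mem, iterate_map_zero C e⟩
  smul_mem' := by
    rintro r _ ⟨a, ha, rfl⟩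
    exact ⟨r ^ q ^ e • a, N.smul_mem _ ha, hC.iterate_pow_smul e r a⟩

theorem iterate_mem_image (e : ℕ) {N : Submodule R K} {m : K} (hm : m ∈ N) :
    C^[e] m ∈ hC.image e N := ⟨m, hm, rfl⟩

theorem image_zero (N : Submodule R K) : hC.image 0 N = N := by
  ext m
  exact ⟨fun ⟨_, h, h'⟩ ↦ h' ▸ h, fun h ↦ ⟨m, h, rfl⟩⟩

theorem image_image (e e' : ℕ) (N : Submodule R K) :
    hC.image e (hC.image e' N) = hC.image (e + e') N := by
  ext m
  constructor
  · rintro ⟨_, ⟨n, hn, rfl⟩, rfl⟩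
    exact ⟨n, hn, Function.iterate_add_apply _ _ _ _⟩
  · rintro ⟨n, hn, rfl⟩
    exact ⟨_, ⟨n, hn, rfl⟩, (Function.iterate_add_apply _ _ _ _).symm⟩

theorem image_mono (e : ℕ) {N N' : Submodule R K} (h : N ≤ N') : hC.image e N ≤ hC.image e N' :=
  Set.image_mono h

theorem image_le_iff {e : ℕ} {N N' : Submodule R K} :
    hC.image e N ≤ N' ↔ ∀ n ∈ N, C^[e] n ∈ N' := Set.image_subset_iff

theorem image_le_self {N : Submodule R K} (hN : ∀ m ∈ N, C m ∈ N) (e : ℕ) :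
    hC.image e N ≤ N := by
  induction e with
  | zero => exact (hC.image_zero N).le
  | succ e ih =>
    rw [add_comm, ← hC.image_image]
    exact (hC.image_mono 1 ih).trans (hC.image_le_iff.2 hN)

theorem image_antitone {N : Submodule R K} (hN : ∀ m ∈ N, C m ∈ N) :
    Antitone fun e ↦ hC.image e N := antitone_nat_of_succ_le fun e ↦ by
  rw [← hC.image_image]
  exact hC.image_mono e (hC.image_le_self hN 1)

/-- The images of the powers of the structural map stabilize. -/
theorem exists_image_eq [IsNoetherianRing R] [Module.Finite R K] (hC : IsCartier R q C)
    (hq : 2 ≤ q) {N : Submodule R K} (hN : ∀ m ∈ N, C m ∈ N) :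
    ∃ e, ∀ e' ≥ e, hC.image e' N = hC.image e N := by
  have hanti := hC.image_antitone hN
  -- `I e` annihilates the successive quotient of the images; the chain has stabilized at `e`
  -- exactly when `I e` is the unit ideal.
  let I : ℕ → Ideal R := fun e ↦ (hC.image (e + 1) N).colon (hC.image e N)
  have hI {e : ℕ} {a : R} : a ∈ I e ↔ ∀ m ∈ hC.image e N, a • m ∈ hC.image (e + 1) N :=
    Submodule.mem_colon
  -- If a multiplies C^e N into C^(e+1) N, then a · C(n) = C(a^q n) with a^q n in C^(e+1) N for n in
  -- C^e N.
  have hmono : Monotone I := monotone_nat_of_le_succ fun e a ha ↦ by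
    rw [hI] at ha ⊢
    intro m hm
    rw [add_comm, ← hC.image_image] at hm
    obtain ⟨n, hn, rfl⟩ := hm
    rw [← hC.iterate_pow_smul, add_comm (e + 1), ← hC.image_image]
    refine hC.iterate_mem_image 1 ?_
    obtain ⟨k, rfl⟩ := Nat.exists_eq_add_of_le' hq
    rw [pow_one, pow_succ, mul_smul]
    exact Submodule.smul_mem _ _ (ha n hn)
  obtain ⟨e₀, he₀⟩ := monotone_stabilizes_iff_noetherian.2 (inferInstance : IsNoetherian R R) ⟨I, hmono⟩
  replace he₀ : ∀ e ≥ e₀, I e₀ = I e := he₀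
  -- Write b m = C(n) with n in the image of C^e₀. Then ab m = C(a^q n), and q ≥ 2 supplies the
  -- factor a² to which the induction hypothesis applies. So the fixed ideal I² works for every
  -- later image.
  have hmul : ∀ e, ∀ a ∈ I e₀, ∀ b ∈ I e₀, ∀ m ∈ hC.image e₀ N,
      (a * b) • m ∈ hC.image (e₀ + e) N := by
    intro e
    induction e with
    | zero => exact fun a _ b _ m hm ↦ Submodule.smul_mem _ _ hm
    | succ e ih =>
      intro a ha b hb m hm
      have := hI.1 hb m hm
      rw [add_comm, ← hC.image_image] at this
      obtain ⟨n, hn, hn'⟩ := this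
      rw [mul_smul, ← hn', ← hC.iterate_pow_smul, ← add_assoc, add_comm _ 1, ← hC.image_image]
      refine hC.iterate_mem_image 1 ?_
      obtain ⟨k, rfl⟩ := Nat.exists_eq_add_of_le' hq
      rw [pow_one, pow_add, mul_smul, pow_two]
      exact Submodule.smul_mem _ _ (ih a ha a ha n hn)
  by_cases htop : I e₀ = ⊤
  · refine ⟨e₀, fun e he ↦ ?_⟩
    induction e, he using Nat.le_induction with
    | base => rfl
    | succ e he ih =>
      rw [← ih]
      refine le_antisymm (hanti e.le_succ) fun m hm ↦ ?_
      have := hI.1 ((he₀ e he ▸ htop : I e = ⊤) ▸ Submodule.mem_top (x := (1 : R))) m hm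
      rwa [one_smul] at this
  -- The images all contain I² times the first one, and I² has the same minimal primes as I.
  -- Stabilization at such a prime p puts an element outside p into I ⊆ p.
  · obtain ⟨p, hp⟩ := Ideal.nonempty_minimalPrimes htop
    have hp2 : p ∈ (I e₀ ^ 2).minimalPrimes := by
      rwa [← Ideal.radical_minimalPrimes, Ideal.radical_pow _ two_ne_zero,
        Ideal.radical_minimalPrimes]
    obtain ⟨e, he⟩ := antitone_stabilizes_at_minimalPrime' hp2 (hC.image e₀ N)
      (fun e ↦ hC.image (e₀ + e) N) (fun i j h ↦ hanti (Nat.add_le_add_left h e₀)) fun e ↦ by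
        rw [pow_two, Submodule.smul_le]
        intro r hr m hm
        induction hr using Submodule.mul_induction_on' with
        | mem_mul_mem a ha b hb => exact hmul e a ha b hb m hm
        | add x _ y _ hx hy => rw [add_smul]; exact Submodule.add_mem _ hx hy
    obtain ⟨s, hs, h⟩ := he (e + 1) e.le_succ
    have hle : I e₀ ≤ p := hp.1.2
    refine (hs (hle ?_)).elim
    rw [he₀ (e₀ + e) (Nat.le_add_right _ _), hI]
    exact fun m hm ↦ h m ⟨hm, hanti (Nat.le_add_right _ _) hm⟩

end IsCartier

end CartierModules

/-! ### Uniform bounds over an F-finite domain -/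

namespace CartierModules

section Torsion

variable {R K : Type*} [CommRing R] [IsDomain R] [AddCommGroup K] [Module R K] [Module.Finite R K]

/-- The quotient by the span of a maximal independent family has rank zero, hence is torsion, and
finite generation gives one annihilator `f`. -/
theorem exists_smul_mem_span_of_card_eq [IsNoetherianRing R] {ι : Type*} [Fintype ι] {w : ι → K}
    (hw : LinearIndependent R w) (h : Module.finrank R K ≤ Fintype.card ι) :
    ∃ f : R, f ≠ 0 ∧ ∀ m, f • m ∈ Submodule.span R (Set.range w) := by
  have h₁ := (Submodule.span R (Set.range w)).finrank_quotient_add_finrank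
  rw [finrank_span_eq_card hw] at h₁
  have h₂ : Module.IsTorsion R (K ⧸ Submodule.span R (Set.range w)) :=
    Module.finrank_eq_zero_iff_isTorsion.1 (by omega)
  obtain ⟨f, hf, hf'⟩ := exists_smul_mem_of_fg (nonZeroDivisors R) ⊤
    (Submodule.span R (Set.range w)) Module.Finite.fg_top fun m _ ↦ by
      obtain ⟨a, ha⟩ := @h₂ (Submodule.Quotient.mk m)
      exact ⟨a, a.2, (Submodule.Quotient.mk_eq_zero _).1 ha⟩
  exact ⟨f, nonZeroDivisors.ne_zero hf, fun m ↦ hf' m trivial⟩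

/-- Multiplication by a suitable `f ≠ 0` embeds the torsion-free `K` into a free module of the same
rank. -/
theorem finrank_pi_le [IsNoetherianRing R] (htf : ∀ (r : R) (m : K), r • m = 0 → r = 0 ∨ m = 0)
    (d : ℕ) : Module.finrank R (Fin d → K) ≤ d * Module.finrank R K := by
  obtain ⟨v, hv⟩ := exists_linearIndependent_of_le_finrank (R := R) (M := K) le_rfl
  obtain ⟨f, hf, hf'⟩ := exists_smul_mem_span_of_card_eq hv (Fintype.card_fin _).ge
  let l : K →ₗ[R] (Fin (Module.finrank R K) →₀ R) :=
    hv.repr ∘ₗ (LinearMap.lsmul R K f).codRestrict _ hf'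
  have hl : Function.Injective l := by
    rw [injective_iff_map_eq_zero]
    intro m hm
    have h₁ : (LinearMap.lsmul R K f).codRestrict _ hf' m = 0 :=
      LinearMap.ker_eq_bot'.1 hv.repr_ker _ hm
    exact (htf f m (congrArg Subtype.val h₁)).resolve_left hf
  have hl' : Function.Injective (l.compLeft (Fin d)) := fun x y h ↦
    funext fun i ↦ hl (congrFun h i)
  refine (LinearMap.finrank_le_finrank_of_injective hl').trans ?_
  rw [Module.finrank_pi_fintype]
  simp

/-- Cayley–Hamilton for multiplication by `g` on `I`, which maps `I` into `I · I`, gives a monic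
polynomial whose lower coefficients lie in `I`. It vanishes at `g` because `I` contains a nonzero
`s` in a domain. -/
theorem exists_pow_mem_of_mul_mem_sq {I : Ideal R} (hI : I.FG) {s g : R} (hs : s ∈ I) (hs₀ : s ≠ 0)
    (h : ∀ a ∈ I, g * a ∈ I * I) : ∃ n, g ^ n ∈ I := by
  have : Module.Finite R I := Module.Finite.of_fg hI
  obtain ⟨p, hp, -, hc, h0⟩ :=
    LinearMap.exists_monic_and_natDegree_eq_and_coeff_mem_pow_and_aeval_eq_zero R
      (algebraMap R (Module.End R I) g) I (by
        rintro _ ⟨a, rfl⟩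
        have := h a a.2
        have h' : (I • (⊤ : Submodule R I)).map I.subtype = I * I := by
          rw [Submodule.map_smul'', Submodule.map_top, Submodule.range_subtype, smul_eq_mul]
        rw [← h'] at this
        obtain ⟨b, hb, hb'⟩ := this
        rwa [show algebraMap R (Module.End R I) g a = b from Subtype.ext hb'.symm])
  rw [Polynomial.aeval_algebraMap_apply] at h0
  have hev : p.eval g = 0 := by
    have := congr((($h0) ⟨s, hs⟩ : I).1)
    have h2 : p.eval g * s = 0 := by simpa [Polynomial.aeval_def] using this
    exact (mul_eq_zero.1 h2).resolve_right hs₀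
  refine ⟨p.natDegree, ?_⟩
  rw [Polynomial.eval_eq_sum_range, Finset.sum_range_succ, hp.coeff_natDegree, one_mul] at hev
  rw [eq_neg_of_add_eq_zero_right hev]
  refine I.neg_mem (I.sum_mem fun k hk ↦ I.mul_mem_right _ ?_)
  have hk' := Finset.mem_range.1 hk
  exact Ideal.pow_le_self (by omega) (hc k)

end Torsion

/-- A basis of `S` over `R` up to the denominator `f`. With `φ` the Frobenius it replaces a basis of
F_*R, which need not be free. -/
theorem exists_frobenius_basis {R S : Type*} [CommRing R] [IsDomain R] [IsNoetherianRing R]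
    [CommRing S] (φ : R →+* S) (hφ : φ.Finite) :
    ∃ (d : ℕ) (e : Fin d → S), (∀ c : Fin d → R, ∑ j, φ (c j) * e j = 0 → c = 0) ∧
      ∃ f : R, f ≠ 0 ∧ ∀ a, ∃ c : Fin d → R, φ f * a = ∑ j, φ (c j) * e j := by
  let := φ.toAlgebra
  have : Module.Finite R S := hφ
  obtain ⟨v, hv⟩ := exists_linearIndependent_of_le_finrank (R := R) (M := S) le_rfl
  obtain ⟨f, hf, hf'⟩ := exists_smul_mem_span_of_card_eq hv (Fintype.card_fin _).ge
  refine ⟨_, v, fun c hc ↦ funext fun j ↦ Fintype.linearIndependent_iff.1 hv c ?_ j, f, hf,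
    fun a ↦ ?_⟩
  · simpa [Algebra.smul_def, RingHom.algebraMap_toAlgebra] using hc
  · obtain ⟨c, hc⟩ := (Submodule.mem_span_range_iff_exists_fun R).1 (hf' a)
    refine ⟨c, ?_⟩
    simpa [Algebra.smul_def, RingHom.algebraMap_toAlgebra] using hc.symm

namespace IsCartier

variable {R K : Type*} [CommRing R] [AddCommGroup K] [Module R K] {q : ℕ} {C : K →+ K}

/-- The element g is found before N is chosen, from the generic bijectivity of m ↦ (C(e_j m))_j. It
satisfies g I ⊆ I² for every I = (N : K); the element s only guarantees that I is nonzero. -/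
theorem exists_pow_smul_mem_of_reduced [IsDomain R] [IsNoetherianRing R] [Module.Finite R K]
    (hC : IsCartier R q C) (hq : 2 ≤ q) (φ : R →+* R) (hφ : φ.Finite) (hφq : ∀ r, φ r = r ^ q)
    (htf : ∀ (r : R) (m : K), r • m = 0 → r = 0 ∨ m = 0)
    (hred : ∀ m : K, (∀ r : R, C (r • m) = 0) → m = 0) :
    ∃ g : R, g ≠ 0 ∧ ∀ N : Submodule R K, (∀ m ∈ N, C m ∈ N) → ∀ s : R, s ≠ 0 →
      (∀ m, s • m ∈ N) → ∃ n, ∀ m, g ^ n • m ∈ N := by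
  obtain ⟨d, e, he, f, hf, hfe⟩ := exists_frobenius_basis φ hφ
  have hCφ (r : R) (m : K) : C (φ r • m) = r • C m := by rw [hφq, hC.pow_smul]
  have hCsum (c : Fin d → R) (m : K) : C ((∑ j, φ (c j) * e j) • m) = ∑ j, c j • C (e j • m) := by
    rw [Finset.sum_smul, map_sum]
    exact Finset.sum_congr rfl fun j _ ↦ by rw [mul_smul, hCφ]
  -- In coordinates, the map F_*K → Hom(F_*R, K) adjoint to C. By `hred` and torsion-freeness it is
  -- injective.
  let κ (m : K) : Fin d → K := fun j ↦ C (e j • m)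
  have hκ {m : K} (hm : κ m = 0) : m = 0 := by
    refine hred m fun a ↦ ?_
    obtain ⟨c, hc⟩ := hfe a
    refine (htf f _ ?_).resolve_left hf
    rw [← hCφ, smul_smul, hc, hCsum]
    exact Finset.sum_eq_zero fun j _ ↦ by rw [show C (e j • m) = 0 from congrFun hm j, smul_zero]
  obtain ⟨v, hv⟩ := exists_linearIndependent_of_le_finrank (R := R) (M := K) le_rfl
  let w : Fin d × Fin (Module.finrank R K) → Fin d → K := fun x ↦ κ (e x.1 • v x.2)
  have hsum (c : Fin d × Fin (Module.finrank R K) → R) :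
      ∑ x, c x • w x = κ (∑ i, (∑ j, φ (c (j, i)) * e j) • v i) := by
    ext k
    simp only [w, κ, Finset.sum_apply, Pi.smul_apply, Finset.smul_sum, map_sum, Finset.sum_smul,
      Fintype.sum_prod_type, mul_smul]
    rw [Finset.sum_comm]
    refine Finset.sum_congr rfl fun i _ ↦ Finset.sum_congr rfl fun j _ ↦ ?_
    rw [smul_comm (e k) (φ _), hCφ]
  have hw : LinearIndependent R w := by
    rw [Fintype.linearIndependent_iff]
    intro c hc
    rw [hsum] at hc
    have := Fintype.linearIndependent_iff.1 hv _ (hκ hc)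
    exact fun ⟨j, i⟩ ↦ congrFun (he _ (this i)) j
  -- The independent vectors `w` number d · rank K, at least the rank of K^d, so the image of `κ`
  -- contains δ · K^d.
  obtain ⟨δ, hδ, hδ'⟩ := exists_smul_mem_span_of_card_eq hw
    ((finrank_pi_le htf d).trans (by simp))
  have hκδ (y : Fin d → K) : ∃ m, κ m = δ • y := by
    obtain ⟨c, hc⟩ := (Submodule.mem_span_range_iff_exists_fun R).1 (hδ' y)
    exact ⟨_, (hsum c).symm.trans hc⟩
  refine ⟨φ (f * δ), ?_, fun N hN s hs hsN ↦ ?_⟩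
  · rw [hφq]
    exact pow_ne_zero _ (mul_ne_zero hf hδ)
  let I : Ideal R := N.colon (⊤ : Submodule R K)
  have hI {a : R} : a ∈ I ↔ ∀ m, a • m ∈ N := by simp [I, Submodule.mem_colon]
  -- Expand φ(f) a = Σ φ(c_j) e_j. Choosing m' with κ(m') = δ m in the slot j, the element C(φ(f) a
  -- m') = δ c_j m lies in N, so δ c_j ∈ I. Hence φ(fδ) a = Σ (δ c_j)^q e_j lies in I^q ⊆ I².
  have hmul (a : R) (ha : a ∈ I) : φ (f * δ) * a ∈ I * I := by
    obtain ⟨c, hc⟩ := hfe a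
    have hcI (j : Fin d) : δ * c j ∈ I := by
      refine hI.2 fun m ↦ ?_
      obtain ⟨m', hm'⟩ := hκδ (Pi.single j m)
      have h₁ := hN _ (hI.1 (I.mul_mem_left (φ f) ha) m')
      rw [hc, hCsum] at h₁
      have h₂ (k : Fin d) : C (e k • m') = δ • (Pi.single j m : Fin d → K) k := congrFun hm' k
      simp only [h₂] at h₁
      rw [Finset.sum_eq_single j (fun k _ hk ↦ by simp [Pi.single_eq_of_ne hk]) (by simp),
        Pi.single_eq_same, smul_smul] at h₁
      rwa [mul_comm]
    rw [mul_comm f, map_mul, mul_assoc, hc, Finset.mul_sum]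
    refine (I * I).sum_mem fun j _ ↦ ?_
    rw [← mul_assoc, ← map_mul, hφq, ← pow_two]
    exact Ideal.mul_mem_right _ _ (Ideal.pow_le_pow_right hq (Ideal.pow_mem_pow (hcI j) q))
  obtain ⟨n, hn⟩ := exists_pow_mem_of_mul_mem_sq (IsNoetherian.noetherian I) (hI.2 hsN) hs hmul
  exact ⟨n, hI.1 hn⟩

/-- The structural map induced on a quotient. -/
def quotientMap (C : K →+ K) (T : Submodule R K) (hT : ∀ m ∈ T, C m ∈ T) : K ⧸ T →+ K ⧸ T :=
  QuotientAddGroup.map T.toAddSubgroup T.toAddSubgroup C hT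

theorem quotientMap_mkQ (T : Submodule R K) (hT : ∀ m ∈ T, C m ∈ T) (m : K) :
    quotientMap C T hT (T.mkQ m) = T.mkQ (C m) := rfl

theorem quotient (hC : IsCartier R q C) (T : Submodule R K) (hT : ∀ m ∈ T, C m ∈ T) :
    IsCartier R q (quotientMap C T hT) where
  pow_smul r m := by
    obtain ⟨m, rfl⟩ := T.mkQ_surjective m
    rw [← map_smul, quotientMap_mkQ, quotientMap_mkQ, hC.pow_smul, map_smul]

/-- Generic bound for generically full Cartier submodules over an `F`-finite domain. -/
theorem exists_pow_smul_iterate_mem [IsDomain R] [IsNoetherianRing R] [Module.Finite R K]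
    (hC : IsCartier R q C) (hq : 2 ≤ q) (φ : R →+* R) (hφ : φ.Finite) (hφq : ∀ r, φ r = r ^ q) :
    ∃ h : R, h ≠ 0 ∧ ∃ e, ∀ N : Submodule R K, (∀ m ∈ N, C m ∈ N) → ∀ s : R, s ≠ 0 →
      (∀ m, s • m ∈ N) → ∃ n, ∀ m, h ^ n • C^[e] m ∈ N := by
  let t := Submodule.torsion R K
  have ht {m : K} : m ∈ t ↔ ∃ a : R, a ≠ 0 ∧ a • m = 0 :=
    ⟨fun ⟨a, ha⟩ ↦ ⟨a, nonZeroDivisors.ne_zero a.2, ha⟩,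
      fun ⟨a, ha, h⟩ ↦ ⟨⟨a, mem_nonZeroDivisors_of_ne_zero ha⟩, h⟩⟩
  have htC (m : K) (hm : m ∈ t) : C m ∈ t := by
    obtain ⟨a, ha, h⟩ := ht.1 hm
    refine ht.2 ⟨a, ha, ?_⟩
    obtain ⟨k, rfl⟩ := Nat.exists_eq_add_of_le' hq
    rw [← hC.pow_smul, ← add_assoc k 1 1, pow_succ, mul_smul, h, smul_zero, map_zero]
  have htd {r : R} (hr : r ≠ 0) {m : K} (hm : r • m ∈ t) : m ∈ t := by
    obtain ⟨a, ha, h⟩ := ht.1 hm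
    exact ht.2 ⟨a * r, mul_ne_zero ha hr, by rw [mul_smul, h]⟩
  -- `T e` consists of the m for which C^e maps R m into torsion. Dividing by the stable value makes
  -- the module torsion-free and leaves no nonzero submodule killed by C, as the reduced case
  -- demands.
  let T : ℕ → Submodule R K := fun e ↦
    { carrier := {m | ∀ r : R, C^[e] (r • m) ∈ t}
      add_mem' := fun ha hb r ↦ by
        rw [smul_add, iterate_map_add]
        exact t.add_mem (ha r) (hb r)
      zero_mem' := fun r ↦ by rw [smul_zero, iterate_map_zero]; exact t.zero_mem
      smul_mem' := fun c m hm r ↦ by rw [smul_smul]; exact hm _ }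
  have hT {e : ℕ} {m : K} : m ∈ T e ↔ ∀ r : R, C^[e] (r • m) ∈ t := Iff.rfl
  have hTC {e : ℕ} {m : K} : C m ∈ T e ↔ ∀ r : R, C^[e + 1] (r ^ q • m) ∈ t := by
    simp only [hT, ← hC.pow_smul, ← Function.iterate_succ_apply]
  have hmono : Monotone T := monotone_nat_of_le_succ fun e m hm r ↦ by
    rw [Function.iterate_succ_apply']
    exact htC _ (hm r)
  obtain ⟨e₀, he₀⟩ := monotone_stabilizes_iff_noetherian.2 (inferInstance : IsNoetherian R K)
    ⟨T, hmono⟩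
  replace he₀ : T e₀ = T (e₀ + 1) := he₀ _ e₀.le_succ
  have hTs : ∀ m ∈ T e₀, C m ∈ T e₀ := fun m hm ↦ hTC.2 fun r ↦ hmono e₀.le_succ hm (r ^ q)
  obtain ⟨g, hg, hgN⟩ := (hC.quotient (T e₀) hTs).exists_pow_smul_mem_of_reduced hq φ hφ hφq
    (fun r m hm ↦ by
      obtain ⟨m, rfl⟩ := (T e₀).mkQ_surjective m
      rw [or_iff_not_imp_left]
      intro hr
      rw [← map_smul] at hm
      refine (Submodule.Quotient.mk_eq_zero _).2 fun s ↦ htd hr ?_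
      have hpos : q ^ e₀ ≠ 0 := (pow_pos (by omega) _).ne'
      have := hT.1 ((Submodule.Quotient.mk_eq_zero _).1 hm) (r ^ (q ^ e₀ - 1) * s)
      rwa [smul_smul, mul_right_comm, ← pow_succ, Nat.sub_add_cancel (Nat.pos_of_ne_zero hpos),
        mul_smul, hC.iterate_pow_smul] at this)
    (fun m hm ↦ by
      obtain ⟨m, rfl⟩ := (T e₀).mkQ_surjective m
      refine (Submodule.Quotient.mk_eq_zero _).2 ?_
      rw [he₀]
      intro r
      have := hm r
      rw [← map_smul, quotientMap_mkQ] at this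
      have := hT.1 ((Submodule.Quotient.mk_eq_zero _).1 this) 1
      rwa [one_smul] at this)
  obtain ⟨h₀, hh₀, hh₀'⟩ := exists_smul_mem_of_fg (nonZeroDivisors R) t ⊥
    (IsNoetherian.noetherian t) fun m ⟨a, ha⟩ ↦ ⟨a, a.2, ha⟩
  refine ⟨h₀ * g, mul_ne_zero (nonZeroDivisors.ne_zero hh₀) hg, e₀, fun N hN s hs hsN ↦ ?_⟩
  obtain ⟨n, hn⟩ := hgN (N.map (T e₀).mkQ) (by
    rintro _ ⟨m, hm, rfl⟩
    exact ⟨C m, hN m hm, rfl⟩) s hs fun m ↦ by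
      obtain ⟨m, rfl⟩ := (T e₀).mkQ_surjective m
      exact ⟨s • m, hsN m, map_smul _ _ _⟩
  refine ⟨n + 1, fun m ↦ ?_⟩
  -- Only `h₀ * g ^ n` is needed: `h₀` kills the torsion and `g ^ n` comes from the reduced
  -- quotient.
  rw [show (h₀ * g) ^ (n + 1) = (h₀ ^ n * g) * (h₀ * g ^ n) by ring, mul_smul]
  refine N.smul_mem _ ?_
  obtain ⟨x, hx, hxm⟩ := hn ((T e₀).mkQ m)
  rw [← map_smul, ← sub_eq_zero, ← map_sub] at hxm
  have hxT : x - g ^ n • m ∈ T e₀ := (Submodule.Quotient.mk_eq_zero _).1 hxm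
  -- Modulo the stable `T e₀`, g^n m agrees with some x ∈ N. The error becomes torsion under C^e₀
  -- and is killed by h₀. The exponent k = q^e₀, used at the end, is the one that lets g^n come out
  -- of C^e₀.
  have key : ∀ k, k ≥ 1 → h₀ • C^[e₀] ((g ^ n) ^ k • m) ∈ N := by
    intro k hk
    obtain ⟨l, rfl⟩ := Nat.exists_eq_add_of_le' hk
    have h₁ : (g ^ n) ^ (l + 1) • m = (g ^ n) ^ l • x - (g ^ n) ^ l • (x - g ^ n • m) := by
      rw [smul_sub, sub_sub_cancel, pow_succ, mul_smul]
    rw [h₁, iterate_map_sub, smul_sub,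
      show h₀ • C^[e₀] ((g ^ n) ^ l • (x - g ^ n • m)) = 0 from hh₀' _ (hxT _), sub_zero]
    exact N.smul_mem _ (hC.image_le_self hN e₀ (hC.iterate_mem_image e₀ (N.smul_mem _ hx)))
  rw [mul_smul, ← hC.iterate_pow_smul]
  exact key _ (Nat.pos_of_ne_zero (pow_pos (by omega) _).ne')

end IsCartier
end CartierModules

/-! ### Generic bounds: passage to quotients, and the localized argument -/

namespace CartierModules
namespace IsCartier

section Generic

variable {R K : Type*} [CommRing R] [AddCommGroup K] [Module R K] {q : ℕ} {C : K →+ K}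

/-- There is one `h ∉ p` such that all Cartier submodules which are everything at `p` are
everything up to nilpotence where `h` is invertible. -/
def GenericallyBounded (p : Ideal R) (C : K →+ K) : Prop :=
  ∃ h ∉ p, ∀ N : Submodule R K, (∀ m ∈ N, C m ∈ N) → (∃ s ∉ p, ∀ m, s • m ∈ N) →
    ∃ n e : ℕ, ∀ m, h ^ n • C^[e] m ∈ N

/-- `θ` presents `L` as a quotient of `B`. Submodules of `B` containing its kernel are determined by
their images, which are `S`-submodules because `ψ` is surjective. -/
theorem exists_of_genericallyBounded {S L : Type*} [CommRing S] [AddCommGroup L] [Module S L]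
    {C' : L →+ L} {ψ : R →+* S} (hψ : Function.Surjective ψ) {B : Submodule R K}
    (hB : ∀ m ∈ B, C m ∈ B) (θ : B →+ L) (hθ : Function.Surjective θ)
    (hθr : ∀ (r : R) (b : B), θ (r • b) = ψ r • θ b)
    (hθC : ∀ b : B, θ ⟨C b, hB b b.2⟩ = C' (θ b)) {p : Ideal S} (h : GenericallyBounded p C') :
    ∃ h ∉ p.comap ψ, ∀ N : Submodule R K, N ≤ B → (∀ b : B, θ b = 0 → (b : K) ∈ N) →
      (∀ m ∈ N, C m ∈ N) → (∃ s ∉ p.comap ψ, ∀ b ∈ B, s • b ∈ N) →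
      ∃ n e : ℕ, ∀ b ∈ B, h ^ n • C^[e] b ∈ N := by
  obtain ⟨h, hh, H⟩ := h
  obtain ⟨h, rfl⟩ := hψ h
  refine ⟨h, hh, fun N hNB hθN hN ⟨s, hs, hsN⟩ ↦ ?_⟩
  let N' : Submodule S L :=
    { carrier := {l | ∃ b : B, (b : K) ∈ N ∧ θ b = l}
      add_mem' := by
        rintro _ _ ⟨a, ha, rfl⟩ ⟨b, hb, rfl⟩
        exact ⟨a + b, N.add_mem ha hb, map_add _ _ _⟩
      zero_mem' := ⟨0, N.zero_mem, map_zero _⟩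
      smul_mem' := by
        rintro r _ ⟨b, hb, rfl⟩
        obtain ⟨r, rfl⟩ := hψ r
        exact ⟨r • b, N.smul_mem r hb, hθr r b⟩ }
  have hN' {b : B} (hb : θ b ∈ N') : (b : K) ∈ N := by
    obtain ⟨b', hb', h⟩ := hb
    have := N.sub_mem hb' (hθN (b' - b) (by rw [map_sub, h, sub_self]))
    simpa using this
  obtain ⟨n, e, hne⟩ := H N' (by
    rintro _ ⟨b, hb, rfl⟩
    exact ⟨⟨C b, hB b b.2⟩, hN b hb, hθC b⟩) ⟨ψ s, hs, fun l ↦ by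
      obtain ⟨b, rfl⟩ := hθ l
      exact ⟨s • b, hsN b b.2, hθr s b⟩⟩
  have hiter (b : B) (e : ℕ) : ∃ b' : B, (b' : K) = C^[e] b ∧ θ b' = C'^[e] (θ b) := by
    induction e with
    | zero => exact ⟨b, rfl, rfl⟩
    | succ e ih =>
      obtain ⟨b', h₁, h₂⟩ := ih
      refine ⟨⟨C b', hB b' b'.2⟩, ?_, ?_⟩
      · rw [Function.iterate_succ_apply', ← h₁]
      · rw [hθC, h₂, Function.iterate_succ_apply']
  refine ⟨n, e, fun b hb ↦ ?_⟩
  obtain ⟨b', h₁, h₂⟩ := hiter ⟨b, hb⟩ e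
  have := hne (θ ⟨b, hb⟩)
  rw [← h₂, ← map_pow, ← hθr] at this
  have := hN' this
  rwa [Submodule.coe_smul, h₁] at this

theorem restrictScalars_quotient {p : Ideal R} [Module (R ⧸ p) K] [IsScalarTower R (R ⧸ p) K]
    (hC : IsCartier R q C) : IsCartier (R ⧸ p) q C where
  pow_smul r m := by
    obtain ⟨r, rfl⟩ := Ideal.Quotient.mk_surjective r
    have (r : R) (m : K) : Ideal.Quotient.mk p r • m = r • m := algebraMap_smul _ _ _
    rw [← map_pow, this, this, hC.pow_smul]

/-- Generic bound for Cartier submodules over `R ⧸ p` when `R` is `F`-finite. -/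
theorem generically_bounded_of_finite [IsNoetherianRing R] [Module.Finite R K]
    (hC : IsCartier R q C) (hq : 2 ≤ q) (φ : R →+* R) (hφ : φ.Finite) (hφq : ∀ r, φ r = r ^ q)
    (p : Ideal R) [p.IsPrime] {B D : Submodule R K} (hB : ∀ m ∈ B, C m ∈ B)
    (hD : ∀ m ∈ D, C m ∈ D) (hBD : p • B ≤ D) :
    ∃ h ∉ p, ∀ N : Submodule R K, N ≤ B → D ≤ N → (∀ m ∈ N, C m ∈ N) →
      (∃ s ∉ p, ∀ b ∈ B, s • b ∈ N) → ∃ n e : ℕ, ∀ b ∈ B, h ^ n • C^[e] b ∈ N := by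
  let CB : B →+ B := (C.comp B.subtype.toAddMonoidHom).codRestrict B fun b ↦ hB b b.2
  have hCB : IsCartier R q CB := ⟨fun r m ↦ Subtype.ext (hC.pow_smul r m)⟩
  let T : Submodule R B := D.comap B.subtype
  have hT : ∀ m ∈ T, CB m ∈ T := fun m hm ↦ hD m hm
  -- As p B ⊆ D, the quotient B/D is a Cartier module over the domain R/p, whose Frobenius is again
  -- finite.
  have ht : Module.IsTorsionBySet R (B ⧸ T) p := by
    rintro m ⟨a, ha⟩
    obtain ⟨m, rfl⟩ := T.mkQ_surjective m
    exact (Submodule.Quotient.mk_eq_zero _).2 (hBD (Submodule.smul_mem_smul ha m.2))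
  let : Module (R ⧸ p) (B ⧸ T) := ht.module
  have : IsScalarTower R (R ⧸ p) (B ⧸ T) := ht.isScalarTower
  have : Module.Finite (R ⧸ p) (B ⧸ T) := Module.Finite.of_restrictScalars_finite R (R ⧸ p) _
  have hle : p ≤ p.comap φ := fun a ha ↦ by
    rw [Ideal.mem_comap, hφq]
    exact Ideal.pow_mem_of_mem p ha q (by omega)
  have hfin : (Ideal.quotientMap p φ hle).Finite := by
    refine RingHom.Finite.of_comp_finite (f := Ideal.Quotient.mk p) ?_
    rw [Ideal.quotientMap_comp_mk]
    exact (RingHom.Finite.of_surjective _ Ideal.Quotient.mk_surjective).comp hφ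
  obtain ⟨h, hh, e, H⟩ := (hCB.quotient T hT).restrictScalars_quotient.exists_pow_smul_iterate_mem
    (R := R ⧸ p) hq (Ideal.quotientMap p φ hle) hfin fun r ↦ by
      obtain ⟨r, rfl⟩ := Ideal.Quotient.mk_surjective r
      rw [Ideal.quotientMap_mk, hφq, map_pow]
  have hgb : GenericallyBounded (⊥ : Ideal (R ⧸ p)) (quotientMap CB T hT) :=
    ⟨h, hh, fun N hN ⟨s, hs, hsN⟩ ↦ (H N hN s hs hsN).imp fun n hn ↦ ⟨e, hn⟩⟩
  obtain ⟨h, hh, H⟩ := exists_of_genericallyBounded (C := C) (B := B)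
    Ideal.Quotient.mk_surjective hB (T.mkQ : B →ₗ[R] B ⧸ T).toAddMonoidHom T.mkQ_surjective
    (fun r b ↦ (T.mkQ.map_smul r b).trans (algebraMap_smul (R ⧸ p) r (T.mkQ b)).symm)
    (fun b ↦ rfl) hgb
  have hcomap : (⊥ : Ideal (R ⧸ p)).comap (Ideal.Quotient.mk p) = p := by
    rw [← RingHom.ker_eq_comap_bot, Ideal.mk_ker]
  rw [hcomap] at hh H
  exact ⟨h, hh, fun N hNB hDN ↦ H N hNB fun b hb ↦ hDN ((Submodule.Quotient.mk_eq_zero T).1 hb)⟩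

end Generic

section Localized

variable {R K R' K' : Type*} [CommRing R] [AddCommGroup K] [Module R K] [CommRing R']
  [Algebra R R'] [AddCommGroup K'] [Module R' K'] {q : ℕ} {C : K →+ K} {C' : K' →+ K'}

/-- If the Cartier quotients of finite length of `K_𝔭` are nilpotent, then the stable image of no
Cartier quotient of `K` has a minimal prime `𝔭` in its support. -/
theorem notMem_minimalPrimes [IsNoetherianRing R] [Module.Finite R K] (hq : 0 < q)
    (hC : IsCartier R q C) (hC' : IsCartier R' q C') (P : Ideal R) [P.IsPrime]
    [IsLocalization.AtPrime R' P] (l : K →+ K')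
    (hlr : ∀ (r : R) (k : K), l (r • k) = algebraMap R R' r • l k)
    (hlC : ∀ k, l (C k) = C' (l k))
    (hl_surj : ∀ k', ∃ s ∉ P, ∃ k, algebraMap R R' s • k' = l k)
    (hl_inj : ∀ k, l k = 0 → ∃ s ∉ P, s • k = 0)
    (H : ∀ N' : Submodule R' K', (∀ m ∈ N', C' m ∈ N') → IsFiniteLength R' (K' ⧸ N') →
      ∃ e : ℕ, ∀ m, C'^[e] m ∈ N')
    {N : Submodule R K} (hN : ∀ m ∈ N, C m ∈ N) {e : ℕ}
    (he : ∀ k, hC.image e ⊤ ≤ hC.image (e + k) ⊤ ⊔ N) :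
    P ∉ (N.colon (hC.image e ⊤ : Set K)).minimalPrimes := by
  intro hP
  set J := N.colon (hC.image e ⊤ : Set K) with hJ
  have hJ' {a : R} : a ∈ J ↔ ∀ k, a • C^[e] k ∈ N := by
    rw [hJ, Submodule.mem_colon]
    exact ⟨fun h k ↦ h _ (hC.iterate_mem_image e trivial), fun h _ ⟨k, _, hk⟩ ↦ hk ▸ h k⟩
  have hliter (n : ℕ) (k : K) : l (C^[n] k) = C'^[n] (l k) :=
    Function.Semiconj.iterate_right hlC n k
  -- The localization of `N` at `P`, realized inside `K'`.
  let Nx : Submodule R' K' :=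
    { carrier := {k' | ∃ s ∉ P, ∃ n ∈ N, algebraMap R R' s • k' = l n}
      add_mem' := by
        rintro a b ⟨s, hs, n, hn, h⟩ ⟨t, ht, n', hn', h'⟩
        refine ⟨s * t, P.primeCompl.mul_mem hs ht, t • n + s • n',
          N.add_mem (N.smul_mem _ hn) (N.smul_mem _ hn'), ?_⟩
        rw [map_add, hlr, hlr, ← h, ← h', smul_add, smul_smul, smul_smul, map_mul, mul_comm]
      zero_mem' := ⟨1, P.primeCompl.one_mem, 0, N.zero_mem, by rw [smul_zero, map_zero]⟩
      smul_mem' := by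
        rintro r k' ⟨s, hs, n, hn, h⟩
        obtain ⟨⟨a, t⟩, hr⟩ := IsLocalization.surj P.primeCompl r
        refine ⟨t * s, P.primeCompl.mul_mem t.2 hs, a • n, N.smul_mem _ hn, ?_⟩
        rw [hlr, ← h, ← hr, smul_smul, smul_smul, map_mul]
        congr 1
        ring }
  have hNxl {k : K} (hk : k ∈ N) : l k ∈ Nx :=
    ⟨1, P.primeCompl.one_mem, k, hk, by rw [map_one, one_smul]⟩
  have hunit {s : R} (hs : s ∉ P) {k' : K'} (h : algebraMap R R' s • k' ∈ Nx) : k' ∈ Nx := by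
    have hu : IsUnit (algebraMap R R' s) := IsLocalization.map_units R' (⟨s, hs⟩ : P.primeCompl)
    obtain ⟨u, hu⟩ := hu
    rw [← hu] at h
    simpa [smul_smul] using Nx.smul_mem (↑u⁻¹ : R') h
  have hNxC (m : K') (hm : m ∈ Nx) : C' m ∈ Nx := by
    obtain ⟨s, hs, n, hn, h⟩ := hm
    refine ⟨s, hs, C (s ^ (q - 1) • n), hN _ (N.smul_mem _ hn), ?_⟩
    rw [← hC'.pow_smul, hlC, hlr, ← h, smul_smul, map_pow, ← pow_succ, Nat.sub_add_cancel hq]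
  -- The largest submodule that C'^e sends into the localization of `N`. The quotient by it is
  -- killed by the q^e-th powers of elements of `J`, so minimality of `P` gives it finite length.
  let N' : Submodule R' K' :=
    { carrier := {m | ∀ a : R', C'^[e] (a • m) ∈ Nx}
      add_mem' := fun ha hb r ↦ by
        rw [smul_add, iterate_map_add]
        exact Nx.add_mem (ha r) (hb r)
      zero_mem' := fun r ↦ by rw [smul_zero, iterate_map_zero]; exact Nx.zero_mem
      smul_mem' := fun c m hm r ↦ by rw [smul_smul]; exact hm _ }
  have hN'C (m : K') (hm : m ∈ N') : C' m ∈ N' := fun a ↦ by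
    rw [← hC'.pow_smul, ← Function.iterate_succ_apply, Function.iterate_succ_apply']
    exact hNxC _ (hm _)
  have hkill (a : R) (ha : a ∈ J) (m : K') : algebraMap R R' (a ^ q ^ e) • m ∈ N' := fun b ↦ by
    rw [smul_comm, map_pow, hC'.iterate_pow_smul]
    obtain ⟨s, hs, k, hk⟩ := hl_surj (b • m)
    refine hunit hs ?_
    rw [smul_comm, ← hC'.iterate_pow_smul]
    have hqe : q ^ e ≠ 0 := (pow_pos hq e).ne'
    rw [← Nat.sub_add_cancel (Nat.pos_of_ne_zero hqe), pow_succ, mul_smul, hk, ← map_pow, ← hlr,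
      ← hliter, ← hlr]
    exact hNxl (hJ'.1 ha _)
  have : IsLocalRing R' := IsLocalization.AtPrime.isLocalRing R' P
  have : IsNoetherianRing R' := IsLocalization.isNoetherianRing P.primeCompl R' inferInstance
  have : Module.Finite R' K' := by
    obtain ⟨S, hS⟩ := (Module.Finite.fg_top : (⊤ : Submodule R K).FG)
    have hlS (k : K) : l k ∈ Submodule.span R' (l '' S) := by
      have hk : k ∈ Submodule.span R (S : Set K) := hS ▸ trivial
      induction hk using Submodule.span_induction with
      | mem x hx => exact Submodule.subset_span ⟨x, hx, rfl⟩
      | zero => rw [map_zero]; exact Submodule.zero_mem _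
      | add x y _ _ hx hy => rw [map_add]; exact Submodule.add_mem _ hx hy
      | smul r x _ hx => rw [hlr]; exact Submodule.smul_mem _ _ hx
    have htop : (⊤ : Submodule R' K') = Submodule.span R' (l '' S) := by
      refine (eq_top_iff.2 fun k' _ ↦ ?_).symm
      obtain ⟨s, hs, k, hk⟩ := hl_surj k'
      obtain ⟨u, hu⟩ : IsUnit (algebraMap R R' s) :=
        IsLocalization.map_units R' (⟨s, hs⟩ : P.primeCompl)
      have := Submodule.smul_mem _ (↑u⁻¹ : R') (hlS k)
      rw [← hk, ← hu, smul_smul, Units.inv_mul, one_smul] at this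
      exact this
    exact ⟨htop ▸ Submodule.fg_span (S.finite_toSet.image l)⟩
  have hart : IsArtinian R' (K' ⧸ N') := by
    let J' : Ideal R := Ideal.span ((fun a ↦ a ^ q ^ e) '' J)
    have hrad : J'.radical = J.radical := by
      refine le_antisymm (Ideal.radical_mono (Ideal.span_le.2 ?_))
        ((Ideal.radical_isRadical _).radical_le_iff.2 fun a ha ↦
          ⟨q ^ e, Ideal.subset_span ⟨a, ha, rfl⟩⟩)
      rintro _ ⟨a, ha, rfl⟩
      exact Ideal.pow_mem_of_mem J ha _ (pow_pos hq e)
    refine isArtinian_of_smul_eq_zero (J'.map (algebraMap R R')) ?_ ?_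
    · rw [IsLocalization.minimalPrimes_map P.primeCompl R']
      change (IsLocalRing.maximalIdeal R').under R ∈ J'.minimalPrimes
      rw [IsLocalization.AtPrime.under_maximalIdeal R' P, ← Ideal.radical_minimalPrimes, hrad,
        Ideal.radical_minimalPrimes]
      exact hP
    · have hle : J'.map (algebraMap R R') ≤ Module.annihilator R' (K' ⧸ N') := by
        rw [Ideal.map_le_iff_le_comap, Ideal.span_le]
        rintro _ ⟨a, ha, rfl⟩
        refine Module.mem_annihilator.2 fun m ↦ ?_
        obtain ⟨m, rfl⟩ := N'.mkQ_surjective m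
        exact (Submodule.Quotient.mk_eq_zero _).2 (hkill a ha m)
      exact fun a ha ↦ Module.mem_annihilator.1 (hle ha)
  obtain ⟨e', he'⟩ := H N' hN'C (isFiniteLength_iff_isNoetherian_isArtinian.2 ⟨inferInstance, hart⟩)
  obtain ⟨s, hs, hs'⟩ := exists_smul_mem_of_fg P.primeCompl (hC.image (e + e') ⊤) N
    (IsNoetherian.noetherian _) fun m ⟨k, _, hk⟩ ↦ by
      have := he' (l k) 1
      rw [one_smul, ← Function.iterate_add_apply, ← hliter, hk] at this
      obtain ⟨s, hs, n, hn, h⟩ := this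
      rw [← hlr, ← sub_eq_zero, ← map_sub] at h
      obtain ⟨t, ht, h⟩ := hl_inj _ h
      refine ⟨t * s, P.primeCompl.mul_mem ht hs, ?_⟩
      rw [smul_sub, sub_eq_zero] at h
      rw [mul_smul, h]
      exact N.smul_mem _ hn
  -- `s` multiplies C^(e+e') K into N. By `he` the image of C^e is no larger modulo N, so s ∈ J ⊆ P
  -- although s ∉ P.
  refine hs (hP.1.2 (hJ'.2 fun k ↦ ?_))
  obtain ⟨a, ha, b, hb, h⟩ := Submodule.mem_sup.1 (he e' (hC.iterate_mem_image e (m := k) trivial))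
  rw [← h, smul_add]
  exact N.add_mem (hs' a ha) (N.smul_mem _ hb)

end Localized
end IsCartier
end CartierModules

/-! ### The inductive step for descending chains -/

namespace CartierModules
namespace IsCartier

variable {R K : Type*} [CommRing R] [AddCommGroup K] [Module R K] {q : ℕ} {C : K →+ K}

theorem image_stable (hC : IsCartier R q C) {N : Submodule R K} (hN : ∀ m ∈ N, C m ∈ N) (e : ℕ) :
    ∀ m ∈ hC.image e N, C m ∈ hC.image e N := by
  rintro _ ⟨n, hn, rfl⟩
  exact ⟨C n, hN n hn, (Function.iterate_succ_apply C e n).symm.trans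
    (Function.iterate_succ_apply' C e n)⟩

theorem iterate_mem {N : Submodule R K} (hN : ∀ m ∈ N, C m ∈ N) (e : ℕ) {m : K} (hm : m ∈ N) :
    C^[e] m ∈ N := by
  induction e with
  | zero => exact hm
  | succ e ih => rw [Function.iterate_succ_apply']; exact hN _ ih

/-- The Cartier submodule generated by a submodule. -/
def generated (hC : IsCartier R q C) (N : Submodule R K) : Submodule R K := ⨆ k, hC.image k N

theorem generated_le (hC : IsCartier R q C) {N L : Submodule R K} (hL : ∀ m ∈ L, C m ∈ L)
    (h : N ≤ L) : hC.generated N ≤ L :=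
  iSup_le fun k ↦ hC.image_le_iff.2 fun _ hm ↦ iterate_mem hL k (h hm)

theorem le_generated (hC : IsCartier R q C) (N : Submodule R K) : N ≤ hC.generated N :=
  (hC.image_zero N).ge.trans (le_iSup (fun k ↦ hC.image k N) 0)

theorem generated_stable (hC : IsCartier R q C) (N : Submodule R K) :
    ∀ m ∈ hC.generated N, C m ∈ hC.generated N := by
  intro m hm
  induction hm using Submodule.iSup_induction' with
  | mem k x hx =>
    refine Submodule.mem_iSup_of_mem (k + 1) ?_
    obtain ⟨n, hn, rfl⟩ := hx
    exact ⟨n, hn, Function.iterate_succ_apply' C k n⟩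
  | zero => rw [map_zero]; exact Submodule.zero_mem _
  | add x y _ _ hx hy => rw [map_add]; exact Submodule.add_mem _ hx hy

variable [IsNoetherianRing R]

/-- Off V(I) the stable image of A lies in A', so some power I^n lies in (A' : stable image).
Surjectivity of C on the stable image then improves I^n to I, so the bound does not depend on A'. -/
theorem smul_image_le_of_forall_prime (hC : IsCartier R q C) (hq : 2 ≤ q) {A A' : Submodule R K}
    (hA : ∀ m ∈ A, C m ∈ A) (hA' : ∀ m ∈ A', C m ∈ A') {I : Ideal R} {e₀ : ℕ}
    (he₀ : ∀ k, hC.image (e₀ + k) A = hC.image e₀ A)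
    (H : ∀ P : Ideal R, P.IsPrime → ¬ I ≤ P → ∃ e : ℕ, ∃ f ∉ P, ∀ m ∈ A, f • C^[e] m ∈ A') :
    I • hC.image e₀ A ≤ A' := by
  set J := A'.colon (hC.image e₀ A : Set K) with hJ
  have hmem {a : R} : a ∈ J ↔ ∀ m ∈ hC.image e₀ A, a • m ∈ A' := Submodule.mem_colon
  have hrad : I ≤ J.radical := by
    rw [Ideal.radical_eq_sInf]
    refine le_sInf fun P ⟨hJP, hP⟩ ↦ ?_
    by_contra hIP
    obtain ⟨e, f, hf, hfe⟩ := H P hP hIP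
    refine hf (hJP (hmem.2 fun m hm ↦ ?_))
    rw [← he₀ e] at hm
    obtain ⟨x, hx, rfl⟩ := hC.image_antitone hA (Nat.le_add_left e e₀) hm
    exact hfe x hx
  obtain ⟨n, hn⟩ := Ideal.exists_pow_le_of_le_radical_of_fg hrad (IsNoetherian.noetherian I)
  rw [Submodule.smul_le]
  intro a ha m hm
  rw [← he₀ n, add_comm, ← hC.image_image] at hm
  obtain ⟨x, hx, rfl⟩ := hm
  rw [← hC.iterate_pow_smul]
  -- Here a · C^n(x) = C^n(a^(q^n) x), and n < q^n puts a^(q^n) into I^n ⊆ J.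
  exact iterate_mem hA' n (hmem.1 (hn (Ideal.pow_le_pow_right (Nat.lt_pow_self (by omega)).le
    (Ideal.pow_mem_pow ha _))) x hx)

variable [Module.Finite R K]

/-- The inductive step: a descending chain which stabilizes up to nilpotence off `V(I)` does so near
the generic point of a component of `V(I)`. -/
theorem exists_pow_smul_iterate_mem_chain (hC : IsCartier R q C) (hq : 2 ≤ q)
    (A : ℕ → Submodule R K) (hA : Antitone A) (hAC : ∀ i, ∀ m ∈ A i, C m ∈ A i) {i₀ : ℕ}
    {I p : Ideal R} (hp : p ∈ I.minimalPrimes) (hpI : ∃ s ∉ p, ∀ a ∈ p, s * a ∈ I)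
    (H : ∀ j ≥ i₀, ∀ P : Ideal R, P.IsPrime → ¬ I ≤ P →
      ∃ e : ℕ, ∃ f ∉ P, ∀ m ∈ A i₀, f • C^[e] m ∈ A j)
    (good : ∀ i e, ∃ h ∉ p, ∀ N ≤ hC.image e (A i), hC.generated (p • hC.image e (A i)) ≤ N →
      (∀ m ∈ N, C m ∈ N) → (∃ s ∉ p, ∀ b ∈ hC.image e (A i), s • b ∈ N) →
      ∃ n k : ℕ, ∀ b ∈ hC.image e (A i), h ^ n • C^[k] b ∈ N) :
    ∃ i₁ ≥ i₀, ∃ e : ℕ, ∃ h ∉ p, ∀ j ≥ i₁, ∃ n : ℕ, ∀ m ∈ A i₁, h ^ n • C^[e] m ∈ A j := by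
  have hp' : p.IsPrime := hp.1.1
  obtain ⟨e₀, he₀⟩ := hC.exists_image_eq hq (hAC i₀)
  replace he₀ (k : ℕ) : hC.image (e₀ + k) (A i₀) = hC.image e₀ (A i₀) := he₀ _ (Nat.le_add_right _ _)
  have hI (j : ℕ) (hj : j ≥ i₀) : I • hC.image e₀ (A i₀) ≤ A j :=
    hC.smul_image_le_of_forall_prime hq (hAC i₀) (hAC j) he₀ (H j hj)
  -- Localized at p, all members contain I times one stable image, so they agree at p from `i` on.
  -- The element witnessing this still depends on the member.
  obtain ⟨i, hi⟩ := antitone_stabilizes_at_minimalPrime' hp (hC.image e₀ (A i₀))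
    (fun j ↦ A (i₀ + j)) (fun _ _ h ↦ hA (Nat.add_le_add_left h i₀))
    fun j ↦ hI _ (Nat.le_add_right _ _)
  obtain ⟨e₁, he₁⟩ := hC.exists_image_eq hq (hAC (i₀ + i))
  replace he₁ (k : ℕ) : hC.image (e₁ + k) (A (i₀ + i)) = hC.image e₁ (A (i₀ + i)) :=
    he₁ _ (Nat.le_add_right _ _)
  obtain ⟨h, hh, Hh⟩ := good (i₀ + i) e₁
  set B := hC.image e₁ (A (i₀ + i)) with hB
  have hBC : ∀ m ∈ B, C m ∈ B := hC.image_stable (hAC _) e₁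
  have hBB (k : ℕ) : hC.image k B = B := by rw [hB, hC.image_image, add_comm, he₁]
  have hBA : B ≤ A (i₀ + i) := hC.image_le_self (hAC _) e₁
  have hBM : B ≤ hC.image e₀ (A i₀) := by
    rw [← hBB e₀]
    exact hC.image_mono e₀ (hBA.trans (hA (Nat.le_add_right _ _)))
  obtain ⟨s₀, hs₀, hs₀I⟩ := hpI
  -- The Cartier submodule generated by p B is harmless: s₀ p ⊆ I and I B lies in every later
  -- member, so one factor s₀ brings all of it into A j.
  have hgen (j : ℕ) (hj : j ≥ i₀) : ∀ m ∈ hC.generated (p • B), s₀ • m ∈ A j := by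
    intro m hm
    induction hm using Submodule.iSup_induction' with
    | mem k x hx =>
      obtain ⟨y, hy, rfl⟩ := hx
      rw [← hC.iterate_pow_smul]
      refine iterate_mem (hAC j) k ?_
      rw [← Nat.sub_add_cancel (Nat.one_le_pow k q (by omega)), pow_succ, mul_smul]
      refine Submodule.smul_mem _ _ ?_
      induction hy using Submodule.smul_induction_on' with
      | smul a ha b hb =>
        rw [smul_smul]
        exact hI j hj (Submodule.smul_mem_smul (hs₀I a ha) (hBM hb))
      | add x _ y _ hx hy => rw [smul_add]; exact Submodule.add_mem _ hx hy
    | zero => rw [smul_zero]; exact Submodule.zero_mem _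
    | add x y _ _ hx hy => rw [smul_add]; exact Submodule.add_mem _ hx hy
  refine ⟨i₀ + i, Nat.le_add_right _ _, e₁, s₀ * h, p.primeCompl.mul_mem hs₀ hh, fun j hj ↦ ?_⟩
  obtain ⟨j, rfl⟩ := Nat.exists_eq_add_of_le ((Nat.le_add_right i₀ i).trans hj)
  obtain ⟨s, hs, hsB⟩ := hi j (by omega)
  -- The generic bound requires a submodule containing the one generated by p B, hence the supremum.
  -- It is everything at p thanks to `s`, and its bound h is the same for all j.
  obtain ⟨n, k, hnk⟩ := Hh ((A (i₀ + j) ⊓ B) ⊔ hC.generated (p • B))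
    (sup_le inf_le_right (hC.generated_le hBC Submodule.smul_le_right)) le_sup_right (by
      intro m hm
      obtain ⟨x, hx, y, hy, rfl⟩ := Submodule.mem_sup.1 hm
      rw [map_add]
      exact Submodule.add_mem_sup ⟨hAC _ _ hx.1, hBC _ hx.2⟩ (hC.generated_stable _ _ hy))
    ⟨s, hs, fun b hb ↦ Submodule.mem_sup_left ⟨hsB b ⟨hBA hb, hBM hb⟩, B.smul_mem _ hb⟩⟩
  refine ⟨n + 1, fun m hm ↦ ?_⟩
  have hmB : C^[e₁] m ∈ hC.image k B := by
    rw [hBB]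
    exact ⟨m, hm, rfl⟩
  obtain ⟨b, hb, hbm⟩ := hmB
  obtain ⟨x, hx, y, hy, hxy⟩ := Submodule.mem_sup.1 (hnk b hb)
  rw [show (s₀ * h) ^ (n + 1) = (s₀ ^ n * h) * (s₀ * h ^ n) by ring, mul_smul, mul_smul s₀, ← hbm,
    ← hxy, smul_add]
  exact Submodule.smul_mem _ _ (Submodule.add_mem _ (Submodule.smul_mem _ _ hx.1)
    (hgen _ (Nat.le_add_right _ _) _ hy))

end IsCartier
end CartierModules

/-! ### Noetherian induction on open sets -/

namespace CartierModules
open Scheme.Modules Limits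
variable {X : Scheme.{u}} {q : ℕ}

/-- In the localization at p the only prime over I is the maximal ideal, so x is nilpotent modulo I
there. Since I is radical, the power of x can be dropped after clearing denominators. -/
theorem exists_notMem_mul_mem {R : Type*} [CommRing R] {I p : Ideal R} (hI : I.IsRadical)
    (hp : p ∈ I.minimalPrimes) {x : R} (hx : x ∈ p) : ∃ s ∉ p, s * x ∈ I := by
  have hp' : p.IsPrime := hp.1.1
  have : p.map (algebraMap R (Localization.AtPrime p)) ≤ (I.map (algebraMap _ _)).radical := by
    rw [Ideal.radical_eq_sInf, le_sInf_iff]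
    rintro q ⟨hq', hq⟩
    obtain ⟨h₁, h₂⟩ := ((IsLocalization.AtPrime.orderIsoOfPrime _ p) ⟨q, hq⟩).2
    rw [Ideal.map_le_iff_le_comap] at hq' ⊢
    exact hp.2 ⟨h₁, hq'⟩ h₂
  obtain ⟨n, hn⟩ := this (Ideal.mem_map_of_mem _ hx)
  rw [IsLocalization.mem_map_algebraMap_iff (M := p.primeCompl)] at hn
  obtain ⟨⟨a, b⟩, hn⟩ := hn
  rw [← map_pow, ← map_mul, IsLocalization.eq_iff_exists p.primeCompl] at hn
  obtain ⟨t, ht⟩ := hn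
  refine ⟨t * b, (t * b).2, hI ⟨n + 1, ?_⟩⟩
  simp only at ht
  rw [show (t.1 * b.1 * x) ^ (n + 1) = (t.1 ^ n * b.1 ^ n * x * b.1) * (t.1 * x ^ n) by ring]
  rw [show (t.1 ^ n * b.1 ^ n * x * b.1) * (t.1 * x ^ n) =
    (t.1 ^ n * b.1 ^ n * x) * (t.1 * (x ^ n * b.1)) by ring, ht, ← mul_assoc]
  exact I.mul_mem_left _ a.2

namespace CohCart

variable {M : CohCart X q}

theorem isCartier (M : CohCart X q) (U : X.Opens) :
    IsCartier Γ(X, U) q (M.C.app (op U)).hom := ⟨M.pow_smul U⟩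

theorem map_mem_sections {S : Subobject M} {U V : X.Opens} (h : V ≤ U) {m : Γ(M.mod, U)}
    (hm : m ∈ sections S U) : M.mod.presheaf.map (homOfLE h).op m ∈ sections S V := by
  obtain ⟨s, rfl⟩ := hm
  exact ⟨_, app_naturality S.arrow.hom h s⟩

theorem exists_pow_smul_mem_sections [IsLocallyNoetherian X] {S : Subobject M} {U : X.Opens}
    (hU : IsAffineOpen U) (f : Γ(X, U)) {m : Γ(M.mod, U)}
    (hm : M.mod.presheaf.map (homOfLE (X.basicOpen_le f)).op m ∈ sections S (X.basicOpen f)) :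
    ∃ n : ℕ, f ^ n • m ∈ sections S U := by
  obtain ⟨s, hs⟩ := hm
  obtain ⟨n, t, ht⟩ := (isLocAt_of_isQuasicoherent (S : CohCart X q).mod hU).exists_smul f s
  have h₁ : M.mod.presheaf.map (homOfLE (X.basicOpen_le f)).op
      (sectionsMap S U t - f ^ n • m) = 0 := by
    rw [map_sub, sub_eq_zero]
    refine (app_naturality S.arrow.hom (X.basicOpen_le f) t).symm.trans ?_
    rw [ht, Hom.app_smul, Scheme.Modules.map_smul, map_pow]
    exact congrArg _ hs
  obtain ⟨k, hk⟩ := (isLocAt_of_isQuasicoherent M.mod hU).smul_eq_zero f _ h₁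
  refine ⟨k + n, f ^ k • t, ?_⟩
  rw [smul_sub, sub_eq_zero] at hk
  rw [_root_.map_smul, hk, pow_add, mul_smul]

/-- Inclusions up to nilpotence and powers of `f` pass to the basic open of `f`. -/
theorem iterate_mem_sections_basicOpen [IsLocallyNoetherian X] (hq : 0 < q) {S T : Subobject M}
    {U : X.Opens} (hU : IsAffineOpen U) (f : Γ(X, U)) {n e : ℕ}
    (h : ∀ m ∈ sections S U, f ^ n • (M.C.app (op U))^[e] m ∈ sections T U) :
    ∀ m ∈ sections S (X.basicOpen f),
      (M.C.app (op (X.basicOpen f)))^[e] m ∈ sections T (X.basicOpen f) := by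
  rintro _ ⟨s, rfl⟩
  obtain ⟨k, t, ht⟩ := (isLocAt_of_isQuasicoherent (S : CohCart X q).mod hU).exists_smul f s
  set g := X.presheaf.map (homOfLE (X.basicOpen_le f)).op f with hg
  have hu : IsUnit g := RingedSpace.isUnit_res_basicOpen _ f
  have hmem {N : Subobject M} {j : ℕ} {m : Γ(M.mod, X.basicOpen f)}
      (h : g ^ j • m ∈ sections N (X.basicOpen f)) : m ∈ sections N (X.basicOpen f) := by
    obtain ⟨u, hu⟩ := hu.pow j
    rw [← hu] at h
    simpa [smul_smul] using Submodule.smul_mem _ (↑u⁻¹ : Γ(X, X.basicOpen f)) h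
  -- `g ^ k` makes `s` the restriction of a section over `U`, and survives as a factor inside C^e;
  -- `g ^ n` is the factor in the hypothesis.
  refine hmem (j := n + k) ?_
  have hle : 1 ≤ q ^ e := Nat.one_le_pow e q hq
  rw [pow_add, mul_smul, ← iterate_C_pow_smul, ← Nat.sub_add_cancel hle, pow_succ, mul_smul,
    ← _root_.map_smul, ← ht]
  have h₂ : sectionsMap S (X.basicOpen f)
      ((S : CohCart X q).mod.presheaf.map (homOfLE (X.basicOpen_le f)).op t) =
      M.mod.presheaf.map (homOfLE (X.basicOpen_le f)).op (sectionsMap S U t) :=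
    app_naturality S.arrow.hom _ t
  have h₃ : (g ^ k) ^ (q ^ e - 1) • sectionsMap S (X.basicOpen f)
      ((S : CohCart X q).mod.presheaf.map (homOfLE (X.basicOpen_le f)).op t) =
      M.mod.presheaf.map (homOfLE (X.basicOpen_le f)).op
        ((f ^ k) ^ (q ^ e - 1) • sectionsMap S U t) := by
    rw [h₂, Scheme.Modules.map_smul, map_pow, map_pow]
  rw [h₃, iterate_C_naturality]
  have h₄ : g ^ n • M.mod.presheaf.map (homOfLE (X.basicOpen_le f)).op
      ((M.C.app (op U))^[e] ((f ^ k) ^ (q ^ e - 1) • sectionsMap S U t)) =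
      M.mod.presheaf.map (homOfLE (X.basicOpen_le f)).op
        (f ^ n • (M.C.app (op U))^[e] ((f ^ k) ^ (q ^ e - 1) • sectionsMap S U t)) := by
    rw [Scheme.Modules.map_smul, map_pow]
  rw [h₄]
  exact map_mem_sections _ (h _ (Submodule.smul_mem _ _ ⟨t, rfl⟩))

/-- Near `x`, the Cartier submodule `S` is contained in `T` up to nilpotence. -/
def LENearUpToNilpotence (S T : Subobject M) (x : X) : Prop :=
  ∃ U : X.Opens, x ∈ U ∧ IsAffineOpen U ∧ ∃ e : ℕ, ∀ m ∈ sections S U,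
    (M.C.app (op U))^[e] m ∈ sections T U

/-- Containment on some neighbourhood is moved to the fixed `W` through a common basic open set.
Finite generation of the image of C^e provides a single denominator. -/
theorem exists_smul_iterate_mem [IsLocallyNoetherian X] (hq : 0 < q) {S T : Subobject M}
    {W : X.Opens} (hW : IsAffineOpen W) (z : Spec Γ(X, W))
    (h : LENearUpToNilpotence S T (hW.fromSpec z)) :
    ∃ e : ℕ, ∃ f ∉ z.asIdeal, ∀ m ∈ sections S W, f • (M.C.app (op W))^[e] m ∈ sections T W := by
  obtain ⟨U, hxU, hU, e, he⟩ := h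
  have hxW : hW.fromSpec z ∈ W := hW.range_fromSpec.le (Set.mem_range_self z)
  obtain ⟨f, g, hfg, hxf⟩ := exists_basicOpen_le_affine_inter hW hU _ ⟨hxW, hxU⟩
  have hf : f ∉ z.asIdeal := by
    have : z ∈ hW.fromSpec ⁻¹ᵁ X.basicOpen f := hxf
    rw [hW.fromSpec_preimage_basicOpen] at this
    exact this
  have hloc := iterate_mem_sections_basicOpen hq (S := S) (T := T) (n := 0) hU g (by simpa using he)
  rw [← hfg] at hloc
  have := IsLocallyNoetherian.component_noetherian ⟨W, hW⟩
  have := M.finite W hW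
  have : z.asIdeal.IsPrime := z.2
  obtain ⟨s, hs, hs'⟩ := exists_smul_mem_of_fg z.asIdeal.primeCompl
    ((M.isCartier W).image e (sections S W)) (sections T W) (IsNoetherian.noetherian _) (by
      rintro _ ⟨m, hm, rfl⟩
      have h₁ := hloc _ (map_mem_sections (X.basicOpen_le f) hm)
      rw [iterate_C_naturality] at h₁
      obtain ⟨n, hn⟩ := exists_pow_smul_mem_sections hW f h₁
      exact ⟨f ^ n, fun h ↦ hf (z.2.mem_of_pow_mem n h), hn⟩)
  exact ⟨e, s, hs, fun m hm ↦ hs' _ ⟨m, hm, rfl⟩⟩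

/-- The condition on the generic points of integral closed subschemes which implies that descending
chains stabilize up to nilpotence. -/
def HasGenericBounds (M : CohCart X q) : Prop :=
  ∀ (S : Subobject M) (W : X.Opens) (_ : IsAffineOpen W) (p : Ideal Γ(X, W)) (_ : p.IsPrime) (e : ℕ),
    let B := (M.isCartier W).image e (sections S W)
    ∃ h ∉ p, ∀ N ≤ B, (M.isCartier W).generated (p • B) ≤ N →
      (∀ m ∈ N, M.C.app (op W) m ∈ N) → (∃ s ∉ p, ∀ b ∈ B, s • b ∈ N) →
      ∃ n k : ℕ, ∀ b ∈ B, h ^ n • (M.C.app (op W))^[k] b ∈ N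

theorem exists_forall_leNear [IsNoetherian X] (hq : 2 ≤ q) (hM : M.HasGenericBounds)
    (N : ℕ → Subobject M) (hN : Antitone N) :
    ∃ i₀, ∀ i ≥ i₀, ∀ j ≥ i, ∀ x, LENearUpToNilpotence (N i) (N j) x := by
  let 𝒪 : Set X.Opens :=
    {O | ∃ i₀, ∀ i ≥ i₀, ∀ j ≥ i, ∀ x ∈ O, LENearUpToNilpotence (N i) (N j) x}
  have hne : 𝒪.Nonempty := ⟨⊥, 0, fun i _ j _ x hx ↦ hx.elim⟩
  obtain ⟨O, ⟨i₀, hO⟩, hmax⟩ := WellFounded.has_min (wellFounded_gt (α := X.Opens)) 𝒪 hne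
  suffices hall : ∀ x, x ∈ O from ⟨i₀, fun i hi j hj x ↦ hO i hi j hj x (hall x)⟩
  by_contra! hx
  obtain ⟨x, hx⟩ := hx
  obtain ⟨_, ⟨W, hW, rfl⟩, hxW, -⟩ :=
    X.isBasis_affineOpens.exists_subset_of_mem_open (Set.mem_univ x) isOpen_univ
  have := IsLocallyNoetherian.component_noetherian ⟨W, hW⟩
  have := M.finite W hW
  -- The radical ideal of the closed subset of `W` outside `O`; `p` below is the generic point of
  -- one of its components.
  let I : Ideal Γ(X, W) := ⨅ z : {z : Spec Γ(X, W) // hW.fromSpec z ∉ O}, z.1.asIdeal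
  have hI {z : Spec Γ(X, W)} (hz : hW.fromSpec z ∉ O) : I ≤ z.asIdeal :=
    iInf_le (fun z : {z : Spec Γ(X, W) // hW.fromSpec z ∉ O} ↦ z.1.asIdeal) ⟨z, hz⟩
  have hIrad : I.IsRadical := Ideal.isRadical_iInf _ fun z ↦ z.1.2.isRadical
  have htop : I ≠ ⊤ := by
    obtain ⟨z, rfl⟩ : x ∈ Set.range hW.fromSpec := hW.range_fromSpec ▸ hxW
    exact fun h ↦ z.2.ne_top (top_le_iff.1 (h ▸ hI hx))
  obtain ⟨p, hp⟩ := Ideal.nonempty_minimalPrimes htop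
  have hp' : p.IsPrime := hp.1.1
  obtain ⟨s, hs, hsI⟩ := exists_smul_mem_of_fg p.primeCompl p I (IsNoetherian.noetherian p)
    fun a ha ↦ exists_notMem_mul_mem hIrad hp ha
  obtain ⟨i₁, hi₁, e, h, hh, H⟩ := (M.isCartier W).exists_pow_smul_iterate_mem_chain hq
    (fun i ↦ sections (N i) W) (fun i j hij ↦ sections_mono (hN hij) W)
    (fun i m hm ↦ C_mem_sections hm) hp ⟨s, hs, hsI⟩
    (fun j hj P hP hIP ↦ exists_smul_iterate_mem (by omega) hW ⟨P, hP⟩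
      (hO i₀ le_rfl j hj _ (by
        by_contra hzO
        exact hIP (hI hzO)))) fun i e ↦ hM (N i) W hW p hp' e
  have hmem : O ⊔ X.basicOpen h ∈ 𝒪 := by
    refine ⟨i₁, fun i hi j hj x hx ↦ ?_⟩
    rcases hx with hx | hx
    · exact hO i (hi₁.le.trans hi) j hj x hx
    · obtain ⟨n, hn⟩ := H j (hi.le.trans hj)
      exact ⟨_, hx, hW.basicOpen h, e, iterate_mem_sections_basicOpen (by omega) hW h
        fun m hm ↦ hn m (sections_mono (hN hi) W hm)⟩
  refine hmax _ hmem (lt_of_le_of_ne le_sup_left fun heq ↦ ?_)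
  let z : Spec Γ(X, W) := ⟨p, hp'⟩
  have hzh : z ∈ hW.fromSpec ⁻¹ᵁ X.basicOpen h := by
    rw [hW.fromSpec_preimage_basicOpen]
    exact hh
  have hzO : hW.fromSpec z ∈ O := by
    rw [heq]
    exact Or.inr hzh
  have hzW : hW.fromSpec z ∈ W := hW.range_fromSpec.le (Set.mem_range_self z)
  -- Were the point `z` of `p` in `O`, a basic open neighbourhood of it inside `O` would be given by
  -- some f ∈ I ⊆ p, which vanishes at `z`.
  obtain ⟨f, hf, hzf⟩ := hW.exists_basicOpen_le ⟨_, hzO⟩ hzW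
  have hzf' : z ∈ hW.fromSpec ⁻¹ᵁ X.basicOpen f := hzf
  rw [hW.fromSpec_preimage_basicOpen] at hzf'
  have hfI : f ∈ I := by
    refine (Submodule.mem_iInf _).2 fun ⟨y, hy⟩ ↦ ?_
    by_contra hyf
    refine hy (hf ?_)
    have : y ∈ hW.fromSpec ⁻¹ᵁ X.basicOpen f := by
      rw [hW.fromSpec_preimage_basicOpen]
      exact hyf
    exact this
  exact hzf' (hp.1.2 hfI)

/-- Descending chains of Cartier submodules stabilize up to nilpotence. -/
theorem exists_nilpotentCokernel [IsNoetherian X] (hq : 2 ≤ q) (hM : M.HasGenericBounds)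
    (N : ℕ → Subobject M) (hN : Antitone N) :
    ∃ i₀ : ℕ, ∀ i ≥ i₀, NilpotentCokernel (Subobject.ofLE (N (i + 1)) (N i) (hN i.le_succ)) := by
  obtain ⟨i₀, hi₀⟩ := exists_forall_leNear hq hM N hN
  refine ⟨i₀, fun i hi ↦ ?_⟩
  choose U hxU hU e he using hi₀ i hi (i + 1) i.le_succ
  obtain ⟨T, hT⟩ := isCompact_univ.elim_finite_subcover (fun x ↦ (U x : Set X)) (fun x ↦ (U x).2)
    fun x _ ↦ Set.mem_iUnion.2 ⟨x, hxU x⟩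
  -- Quasi-compactness turns the local exponents into one.
  refine nilpotentCokernel_of_cover (by omega) _ (T.sup e) fun x ↦ ?_
  obtain ⟨y, hy, hxy⟩ := Set.mem_iUnion₂.1 (hT (Set.mem_univ x))
  refine ⟨U y, hxy, hU y, fun n ↦ exists_ofLE_app_eq _ _ ?_⟩
  rw [hom_iterate_C]
  obtain ⟨k, hk⟩ := Nat.exists_eq_add_of_le' (Finset.le_sup hy : e y ≤ T.sup e)
  rw [hk, Function.iterate_add_apply]
  exact IsCartier.iterate_mem (C := (M.C.app (op (U y))).hom) (fun m hm ↦ C_mem_sections hm) k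
    (he y _ ⟨n, rfl⟩)

end CohCart
end CartierModules

/-! ### Generic bounds when Frobenius is finite -/

namespace CartierModules
open Scheme.Modules Limits

theorem CohCart.hasGenericBounds_of_isFFinite {𝔽 : Type u} [Field 𝔽] [Fintype 𝔽] {X : Scheme.{u}}
    [IsLocallyNoetherian X] (s : X ⟶ Spec (CommRingCat.of 𝔽)) (hs : IsFFinite s)
    (M : CohCart X (Fintype.card 𝔽)) : M.HasGenericBounds := by
  intro S W hW p hp e B
  have := IsLocallyNoetherian.component_noetherian ⟨W, hW⟩
  have := M.finite W hW
  have : IsFinite (frobenius s) := hs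
  have hfin : (powHom s W).Finite := IsFinite.finite_app (frobenius s) W hW
  exact (M.isCartier W).generically_bounded_of_finite Fintype.one_lt_card (powHom s W) hfin
    (fun _ ↦ rfl) p ((M.isCartier W).image_stable (fun m hm ↦ C_mem_sections hm) e)
    ((M.isCartier W).generated_stable _) ((M.isCartier W).le_generated _)

end CartierModules

/-! ### Subsheaves defined on affine opens -/

namespace CartierModules
open Scheme.Modules Limits
variable {X : Scheme.{u}} {q : ℕ}

/-- The ideal of scalars sending `m` into `T` contains, for each prime, a power of a function not
vanishing there, so no maximal ideal contains it. -/
theorem mem_of_locally_pow_smul_mem {K : Type*} [AddCommGroup K] {U : X.Opens} [Module Γ(X, U) K]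
    (hU : IsAffineOpen U) (T : Submodule Γ(X, U) K) {m : K}
    (h : ∀ x ∈ U, ∃ f : Γ(X, U), x ∈ X.basicOpen f ∧ ∃ n : ℕ, f ^ n • m ∈ T) : m ∈ T := by
  let J := T.colon {m}
  suffices hJ : J = ⊤ by
    have : (1 : Γ(X, U)) ∈ J := hJ ▸ Submodule.mem_top
    simpa using Submodule.mem_colon_singleton.1 this
  by_contra hJ
  obtain ⟨P, hP, hJP⟩ := Ideal.exists_le_maximal J hJ
  let z : Spec Γ(X, U) := ⟨P, hP.isPrime⟩
  obtain ⟨f, hf, n, hn⟩ := h (hU.fromSpec z) (hU.range_fromSpec.le (Set.mem_range_self z))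
  have hz : z ∈ hU.fromSpec ⁻¹ᵁ X.basicOpen f := hf
  rw [hU.fromSpec_preimage_basicOpen] at hz
  exact hz (hP.isPrime.mem_of_pow_mem n (hJP (Submodule.mem_colon_singleton.2 hn)))

theorem res_res (M : X.Modules) {U V W : X.Opens} (h : V ≤ U) (h' : W ≤ V) (m : Γ(M, U)) :
    M.presheaf.map (homOfLE h').op (M.presheaf.map (homOfLE h).op m) =
      M.presheaf.map (homOfLE (h'.trans h)).op m :=
  congr($(M.presheaf.map_comp (homOfLE h).op (homOfLE h').op) m).symm

theorem res_self (M : X.Modules) {U : X.Opens} (m : Γ(M, U)) :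
    M.presheaf.map (homOfLE le_rfl).op m = m :=
  congr($(M.presheaf.map_id (op U)) m)

/-- Submodules of the sections over the affine opens which are compatible with restriction and
localization. -/
structure AffineSystem (M : X.Modules) where
  /-- the submodules (the values at opens that are not affine are irrelevant) -/
  obj (U : X.Opens) : Submodule Γ(X, U) Γ(M, U)
  map_mem {U V : X.Opens} (h : V ≤ U) (hU : IsAffineOpen U) (hV : IsAffineOpen V) {m : Γ(M, U)}
    (hm : m ∈ obj U) : M.presheaf.map (homOfLE h).op m ∈ obj V
  exists_smul {U : X.Opens} (hU : IsAffineOpen U) (f : Γ(X, U)) {x : Γ(M, X.basicOpen f)}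
    (hx : x ∈ obj (X.basicOpen f)) : ∃ n : ℕ, ∃ y ∈ obj U,
      M.presheaf.map (homOfLE (X.basicOpen_le f)).op y =
        X.presheaf.map (homOfLE (X.basicOpen_le f)).op f ^ n • x

namespace AffineSystem

variable {M : X.Modules} (A : AffineSystem M)

theorem exists_pow_smul_mem [M.IsQuasicoherent] {U : X.Opens} (hU : IsAffineOpen U) (f : Γ(X, U))
    {m : Γ(M, U)}
    (hm : M.presheaf.map (homOfLE (X.basicOpen_le f)).op m ∈ A.obj (X.basicOpen f)) :
    ∃ n : ℕ, f ^ n • m ∈ A.obj U := by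
  obtain ⟨n, y, hy, h⟩ := A.exists_smul hU f hm
  obtain ⟨k, hk⟩ := (isLocAt_of_isQuasicoherent M hU).smul_eq_zero f (f ^ n • m - y) (by
    rw [map_sub, h, Scheme.Modules.map_smul, map_pow, sub_self])
  rw [smul_sub, sub_eq_zero, smul_smul, ← pow_add] at hk
  exact ⟨k + n, hk ▸ Submodule.smul_mem _ _ hy⟩

theorem mem_of_locally [M.IsQuasicoherent] {U : X.Opens} (hU : IsAffineOpen U) {m : Γ(M, U)}
    (h : ∀ x ∈ U, ∃ f : Γ(X, U), x ∈ X.basicOpen f ∧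
      M.presheaf.map (homOfLE (X.basicOpen_le f)).op m ∈ A.obj (X.basicOpen f)) :
    m ∈ A.obj U :=
  mem_of_locally_pow_smul_mem hU _ fun x hx ↦ by
    obtain ⟨f, hf, hm⟩ := h x hx
    exact ⟨f, hf, A.exists_pow_smul_mem hU f hm⟩

/-- The sections over `V` whose restrictions to affine opens are in the given submodules. -/
def sections (V : X.Opens) : Submodule Γ(X, V) Γ(M, V) where
  carrier := {m | ∀ (U : X.Opens) (h : U ≤ V), IsAffineOpen U →
    M.presheaf.map (homOfLE h).op m ∈ A.obj U}
  add_mem' ha hb U h hU := by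
    rw [map_add]
    exact Submodule.add_mem _ (ha U h hU) (hb U h hU)
  zero_mem' U h hU := by
    rw [map_zero]
    exact Submodule.zero_mem _
  smul_mem' r m hm U h hU := by
    rw [Scheme.Modules.map_smul]
    exact Submodule.smul_mem _ _ (hm U h hU)

theorem map_mem_sections {V V' : X.Opens} (h : V' ≤ V) {m : Γ(M, V)} (hm : m ∈ A.sections V) :
    M.presheaf.map (homOfLE h).op m ∈ A.sections V' := fun U hU hU' ↦ by
  rw [res_res]
  exact hm U (hU.trans h) hU'

/-- The sections whose restrictions to affine opens are in the given submodules. -/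
def submodule : PresheafOfModules.Submodule M.val where
  obj V := A.sections V.unop
  map f _ hm := A.map_mem_sections f.unop.le hm

theorem mem_submodule {V : X.Opens} {m : Γ(M, V)} : m ∈ A.submodule.obj (op V) ↔
    ∀ (U : X.Opens) (h : U ≤ V), IsAffineOpen U → M.presheaf.map (homOfLE h).op m ∈ A.obj U :=
  Iff.rfl

theorem mem_submodule_iff {U : X.Opens} (hU : IsAffineOpen U) {m : Γ(M, U)} :
    m ∈ A.submodule.obj (op U) ↔ m ∈ A.obj U :=
  ⟨fun h ↦ res_self M m ▸ h U le_rfl hU, fun h _ hV hV' ↦ A.map_mem hV hU hV' h⟩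

theorem isSheaf_submodule [M.IsQuasicoherent] :
    TopCat.Presheaf.IsSheaf (X := X) A.submodule.toPresheafOfModules.presheaf := by
  rw [TopCat.Presheaf.isSheaf_iff_isSheafUniqueGluing]
  intro ι U sf hsf
  let F : TopCat.Sheaf Ab.{u} X := ⟨M.presheaf, M.isSheaf⟩
  obtain ⟨s, hs, huniq⟩ := F.existsUnique_gluing U (fun i ↦ (sf i).1)
    fun i j ↦ congrArg Subtype.val (hsf i j)
  have hmem : s ∈ A.submodule.obj (op (iSup U)) := by
    refine A.mem_submodule.2 fun V hV hV' ↦ A.mem_of_locally hV' fun x hx ↦ ?_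
    obtain ⟨i, hi⟩ := Opens.mem_iSup.1 (hV hx)
    obtain ⟨f, hf, hxf⟩ := hV'.exists_basicOpen_le ⟨x, hi⟩ hx
    refine ⟨f, hxf, ?_⟩
    rw [res_res]
    have h := (sf i).2 _ hf (hV'.basicOpen f)
    have h' : M.presheaf.map (homOfLE (le_iSup U i)).op s = (sf i).1 := hs i
    rwa [← h', res_res] at h
  exact ⟨⟨s, hmem⟩, fun i ↦ Subtype.ext (hs i), fun t ht ↦
    Subtype.ext (huniq t.1 fun i ↦ congrArg Subtype.val (ht i))⟩

/-- The subsheaf of modules defined by a system of submodules over the affine opens. -/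
def toModules [M.IsQuasicoherent] : X.Modules := ⟨A.submodule.toPresheafOfModules, A.isSheaf_submodule⟩

/-- The inclusion of the subsheaf of modules. -/
def toModulesι [M.IsQuasicoherent] : A.toModules ⟶ M := ⟨A.submodule.ι⟩

variable [M.IsQuasicoherent]

theorem toModulesι_injective (U : X.Opens) : Function.Injective (A.toModulesι.app U) :=
  Subtype.val_injective

theorem range_toModulesι {U : X.Opens} (hU : IsAffineOpen U) (m : Γ(M, U)) :
    (∃ a, A.toModulesι.app U a = m) ↔ m ∈ A.obj U := by
  rw [← A.mem_submodule_iff hU]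
  exact ⟨fun ⟨a, ha⟩ ↦ ha ▸ a.2, fun h ↦ ⟨⟨m, h⟩, rfl⟩⟩

instance : Mono A.toModulesι := by
  refine ⟨fun f g h ↦ Scheme.Modules.hom_ext _ _ fun U ↦ ?_⟩
  ext m
  exact A.toModulesι_injective U congr(($h).app U m)

theorem isQuasicoherent_toModules : A.toModules.IsQuasicoherent := by
  refine isQuasicoherent_of_forall_isLocAt _ fun U hU ↦ ⟨fun f s ↦ ?_, fun f t ht ↦ ?_⟩
  · obtain ⟨n, y, hy, h⟩ := A.exists_smul hU f
      ((A.range_toModulesι (hU.basicOpen f) _).1 ⟨s, rfl⟩)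
    obtain ⟨y, rfl⟩ := (A.range_toModulesι hU _).2 hy
    refine ⟨n, y, A.toModulesι_injective _ ?_⟩
    rw [app_naturality, h, Hom.app_smul]
  · obtain ⟨n, hn⟩ := (isLocAt_of_isQuasicoherent M hU).smul_eq_zero f (A.toModulesι.app U t) (by
      rw [← app_naturality, ht, map_zero])
    exact ⟨n, A.toModulesι_injective _ (by rw [Hom.app_smul, hn, map_zero])⟩

end AffineSystem

namespace CohCart

variable {M : CohCart X q} (A : AffineSystem M.mod)
  (hA : ∀ U, IsAffineOpen U → ∀ m ∈ A.obj U, M.C.app (op U) m ∈ A.obj U)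

theorem toModulesι_stable (hA : ∀ U, IsAffineOpen U → ∀ m ∈ A.obj U, M.C.app (op U) m ∈ A.obj U)
    (U : X.Opens) (a : Γ(A.toModules, U)) :
    ∃ b, A.toModulesι.app U b = M.C.app (op U) (A.toModulesι.app U a) :=
  ⟨⟨M.C.app (op U) a.1, fun V hV hV' ↦
    C_naturality M hV a.1 ▸ hA V hV' _ (a.2 V hV hV')⟩, rfl⟩

variable [IsLocallyNoetherian X]

/-- The Cartier submodule defined by a system of Cartier submodules over the affine opens. -/
def ofSystem : CohCart X q :=
  sub A.toModulesι A.isQuasicoherent_toModules (toModulesι_stable A hA)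

/-- The inclusion of `ofSystem`. -/
def ofSystemι : ofSystem A hA ⟶ M := subι _ _ _

instance : Mono (ofSystemι A hA).hom := inferInstanceAs (Mono A.toModulesι)

theorem range_ofSystemι {U : X.Opens} (hU : IsAffineOpen U) (m : Γ(M.mod, U)) :
    (∃ a, (ofSystemι A hA).hom.app U a = m) ↔ m ∈ A.obj U :=
  A.range_toModulesι hU m

end CohCart
end CartierModules

/-! ### Images of iterates and the quotient killed by an ideal sheaf -/

namespace CartierModules
open Scheme.Modules Limits
variable {X : Scheme.{u}} {q : ℕ}

theorem exists_map_eq_pow_mul {U : X.Opens} (hU : IsAffineOpen U) (f : Γ(X, U))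
    (x : Γ(X, X.basicOpen f)) : ∃ (n : ℕ) (y : Γ(X, U)),
      X.presheaf.map (homOfLE (X.basicOpen_le f)).op y =
        X.presheaf.map (homOfLE (X.basicOpen_le f)).op f ^ n * x := by
  have := hU.isLocalization_basicOpen f
  obtain ⟨⟨y, ⟨_, n, rfl⟩⟩, hy⟩ := IsLocalization.surj (.powers f) x
  refine ⟨n, y, hy.symm.trans ?_⟩
  rw [mul_comm]
  exact congrArg (· * x) (map_pow (X.presheaf.map (homOfLE (X.basicOpen_le f)).op).hom f n)

theorem exists_pow_mul_eq_zero {U : X.Opens} (hU : IsAffineOpen U) (f : Γ(X, U))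
    {x : Γ(X, U)} (hx : X.presheaf.map (homOfLE (X.basicOpen_le f)).op x = 0) :
    ∃ n : ℕ, f ^ n * x = 0 := by
  have := hU.isLocalization_basicOpen f
  obtain ⟨⟨_, n, rfl⟩, hn⟩ := (IsLocalization.map_eq_zero_iff (.powers f) Γ(X, X.basicOpen f) x).1 hx
  exact ⟨n, hn⟩

section Ideal

variable {Z : Scheme.{u}} (i : Z ⟶ X)

/-- The ideal of sections over `U` that vanish on `Z`. -/
abbrev kerIdeal (U : X.Opens) : Ideal Γ(X, U) := RingHom.ker (i.app U).hom

theorem app_map {U V : X.Opens} (h : V ≤ U) (a : Γ(X, U)) :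
    i.app V (X.presheaf.map (homOfLE h).op a) =
      Z.presheaf.map (homOfLE (i.preimage_mono h)).op (i.app U a) :=
  congr($(i.naturality (homOfLE h).op) a)

theorem map_mem_kerIdeal {U V : X.Opens} (h : V ≤ U) {a : Γ(X, U)} (ha : a ∈ kerIdeal i U) :
    X.presheaf.map (homOfLE h).op a ∈ kerIdeal i V := by
  have ha : i.app U a = 0 := ha
  have : i.app V (X.presheaf.map (homOfLE h).op a) = 0 := by rw [app_map, ha, map_zero]
  exact this

theorem exists_mem_kerIdeal [IsAffineHom i] {U : X.Opens} (hU : IsAffineOpen U) (f : Γ(X, U))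
    {a : Γ(X, X.basicOpen f)} (ha : a ∈ kerIdeal i (X.basicOpen f)) :
    ∃ (n : ℕ), ∃ b ∈ kerIdeal i U, X.presheaf.map (homOfLE (X.basicOpen_le f)).op b =
        X.presheaf.map (homOfLE (X.basicOpen_le f)).op f ^ n * a := by
  have ha : i.app _ a = 0 := ha
  obtain ⟨n, b, hb⟩ := exists_map_eq_pow_mul hU f a
  have h : Z.presheaf.map (homOfLE (Z.basicOpen_le (i.app U f))).op (i.app U b) = 0 := by
    have h₁ := congrArg (i.app _) hb
    rw [map_mul, ha, mul_zero, app_map] at h₁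
    have h₂ := i.preimage_basicOpen f
    have h₃ := congrArg (Z.presheaf.map (homOfLE h₂.ge).op) h₁
    rw [map_zero] at h₃
    refine Eq.trans ?_ h₃
    exact congr($(Z.presheaf.map_comp (homOfLE (i.preimage_mono (X.basicOpen_le f))).op
      (homOfLE h₂.ge).op) (i.app U b))
  obtain ⟨k, hk⟩ := exists_pow_mul_eq_zero (hU.preimage i) _ h
  refine ⟨k + n, f ^ k * b, ?_, ?_⟩
  · have : i.app U (f ^ k * b) = 0 := by rw [map_mul, map_pow, hk]
    exact this
  · rw [map_mul, hb, map_pow, pow_add, mul_assoc]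

end Ideal

namespace CohCart

variable (M : CohCart X q)

/-- The images of an iterate of the structural map. -/
def imageSystem (hq : 0 < q) (e : ℕ) : AffineSystem M.mod where
  obj U := (M.isCartier U).image e ⊤
  map_mem h _ _ m hm := by
    obtain ⟨m, -, rfl⟩ := hm
    exact ⟨_, trivial, iterate_C_naturality M h e m⟩
  exists_smul {U} hU f x hx := by
    obtain ⟨s, -, rfl⟩ := hx
    obtain ⟨n, t, ht⟩ := (isLocAt_of_isQuasicoherent M.mod hU).exists_smul f s
    -- The exponent q^e - 1, with the factor f^n already in t, completes (f^n)^(q^e), which leaves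
    -- C^e as f^n.
    refine ⟨n, _, ⟨(f ^ n) ^ (q ^ e - 1) • t, trivial, rfl⟩, ?_⟩
    have hle : 1 ≤ q ^ e := Nat.one_le_pow e q hq
    refine (iterate_C_naturality M _ e _).symm.trans ?_
    rw [Scheme.Modules.map_smul, ht, smul_smul, map_pow, map_pow, ← pow_succ,
      Nat.sub_add_cancel hle, iterate_C_pow_smul]

/-- The Cartier submodules generated by the product with an ideal sheaf. -/
def generatedSystem (hq : 0 < q) {Z : Scheme.{u}} (i : Z ⟶ X) [IsAffineHom i] :
    AffineSystem M.mod where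
  obj U := (M.isCartier U).generated (kerIdeal i U • ⊤)
  map_mem {U V} h _ _ m hm := by
    induction hm using Submodule.iSup_induction' with
    | mem k x hx =>
      obtain ⟨x, hx, rfl⟩ := hx
      refine Submodule.mem_iSup_of_mem k ⟨M.mod.presheaf.map (homOfLE h).op x, ?_,
        iterate_C_naturality M h k x⟩
      induction hx using Submodule.smul_induction_on' with
      | smul r hr x _ =>
        rw [Scheme.Modules.map_smul]
        exact Submodule.smul_mem_smul (map_mem_kerIdeal i h hr) trivial
      | add x _ y _ hx hy => rw [map_add]; exact Submodule.add_mem _ hx hy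
    | zero => rw [map_zero]; exact Submodule.zero_mem _
    | add x y _ _ hx hy => rw [map_add]; exact Submodule.add_mem _ hx hy
  exists_smul {U} hU f x hx := by
    have hle := X.basicOpen_le f
    let A := (M.isCartier U).generated (kerIdeal i U • ⊤)
    let g := X.presheaf.map (homOfLE hle).op f
    -- The elements with a multiple by a power of g that extends to an element of A. This submodule
    -- is C-stable and contains the product with the ideal, hence everything it generates.
    let L : Submodule Γ(X, X.basicOpen f) Γ(M.mod, X.basicOpen f) :=
      { carrier := {x | ∃ n : ℕ, ∃ y ∈ A, M.mod.presheaf.map (homOfLE hle).op y = g ^ n • x}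
        add_mem' := by
          rintro x x' ⟨n, y, hy, h⟩ ⟨n', y', hy', h'⟩
          refine ⟨n + n', f ^ n' • y + f ^ n • y', Submodule.add_mem _ (Submodule.smul_mem _ _ hy)
            (Submodule.smul_mem _ _ hy'), ?_⟩
          rw [map_add, Scheme.Modules.map_smul, Scheme.Modules.map_smul, h, h', smul_add, pow_add,
            map_pow, map_pow, smul_smul, smul_smul, mul_comm]
        zero_mem' := ⟨0, 0, Submodule.zero_mem _, by rw [map_zero, smul_zero]⟩
        smul_mem' := by
          rintro r x ⟨n, y, hy, h⟩
          obtain ⟨k, r', hr'⟩ := exists_map_eq_pow_mul hU f r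
          refine ⟨k + n, r' • y, Submodule.smul_mem _ _ hy, ?_⟩
          rw [Scheme.Modules.map_smul, h, hr', smul_smul, smul_smul]
          congr 1
          change g ^ k * r * g ^ n = _
          ring }
    refine (M.isCartier _).generated_le (L := L) ?_ ?_ hx
    · rintro x ⟨n, y, hy, h⟩
      refine ⟨n, _, (M.isCartier U).generated_stable _ _
        (Submodule.smul_mem _ ((f ^ n) ^ (q - 1)) hy), ?_⟩
      refine (C_naturality M _ _).symm.trans ?_
      rw [Scheme.Modules.map_smul, h, smul_smul, map_pow, map_pow]
      change M.C.app _ (((g ^ n) ^ (q - 1) * g ^ n) • x) = _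
      rw [← pow_succ, Nat.sub_add_cancel hq, M.pow_smul]
    · refine Submodule.smul_le.2 fun r hr m _ ↦ ?_
      obtain ⟨n, r', hr', h⟩ := exists_mem_kerIdeal i hU f hr
      obtain ⟨k, m', h'⟩ := (isLocAt_of_isQuasicoherent M.mod hU).exists_smul f m
      refine ⟨n + k, r' • m', (M.isCartier U).le_generated _
        (Submodule.smul_mem_smul hr' trivial), ?_⟩
      rw [Scheme.Modules.map_smul, h, h', smul_smul, smul_smul]
      congr 1
      change g ^ n * r * g ^ k = _
      ring

variable [IsLocallyNoetherian X]

/-- The image of an iterate of the structural map is a Cartier submodule. -/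
theorem exists_image (hq : 0 < q) (e : ℕ) : ∃ (B : CohCart X q) (j : B ⟶ M), Mono j.hom ∧
    ∀ U, IsAffineOpen U → ∀ m : Γ(M.mod, U), (∃ b, j.hom.app U b = m) ↔
      m ∈ (M.isCartier U).image e ⊤ := by
  have h : ∀ U, IsAffineOpen U → ∀ m ∈ (M.imageSystem hq e).obj U,
      M.C.app (op U) m ∈ (M.imageSystem hq e).obj U :=
    fun U _ ↦ (M.isCartier U).image_stable (N := ⊤) (fun _ _ ↦ trivial) e
  exact ⟨_, ofSystemι (M.imageSystem hq e) h, inferInstance, fun _ hU m ↦ range_ofSystemι _ h hU m⟩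

/-- The largest Cartier quotient killed by the ideal sheaf of `Z`. -/
theorem exists_quotient (hq : 0 < q) {Z : Scheme.{u}} (i : Z ⟶ X) [IsAffineHom i] :
    ∃ (F : CohCart X q) (π : M ⟶ F), ∀ U, IsAffineOpen U → Function.Surjective (π.hom.app U) ∧
      ∀ m : Γ(M.mod, U), π.hom.app U m = 0 ↔
        m ∈ (M.isCartier U).generated (kerIdeal i U • ⊤) := by
  have h : ∀ U, IsAffineOpen U → ∀ m ∈ (M.generatedSystem hq i).obj U,
      M.C.app (op U) m ∈ (M.generatedSystem hq i).obj U :=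
    fun U _ ↦ (M.isCartier U).generated_stable _
  let j := ofSystemι (M.generatedSystem hq i) h
  refine ⟨coker j, cokerπ j, fun U hU ↦ ⟨surjective_app_of_epi _ hU, fun m ↦ ?_⟩⟩
  refine Iff.trans ?_ (range_ofSystemι (M.generatedSystem hq i) h hU m)
  constructor
  · exact exists_of_cokernel_π_eq_zero j.hom hU m
  · rintro ⟨a, rfl⟩
    exact cokernel_π_app _ _

end CohCart
end CartierModules

/-! ### Finite generation is local -/

namespace CartierModules
open Scheme.Modules Limits
variable {X : Scheme.{u}} {q : ℕ}

variable {M : X.Modules}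

theorem isUnit_res {U : X.Opens} (f : Γ(X, U)) :
    IsUnit (X.presheaf.map (homOfLE (X.basicOpen_le f)).op f) :=
  RingedSpace.isUnit_res_basicOpen _ f

theorem mem_of_pow_smul_mem {R K : Type*} [CommRing R] [AddCommGroup K] [Module R K] {g : R}
    (hg : IsUnit g) {T : Submodule R K} {n : ℕ} {x : K} (h : g ^ n • x ∈ T) : x ∈ T := by
  obtain ⟨v, hv⟩ := hg.pow n
  rw [← hv] at h
  simpa [smul_smul] using Submodule.smul_mem _ (↑v⁻¹ : R) h

/-- The restrictions to a basic open of the elements of a submodule span its localization. -/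
theorem exists_of_mem_span {U : X.Opens} (hU : IsAffineOpen U) (f : Γ(X, U))
    {T : Submodule Γ(X, U) Γ(M, U)} {x : Γ(M, X.basicOpen f)}
    (hx : x ∈ Submodule.span Γ(X, X.basicOpen f)
      (M.presheaf.map (homOfLE (X.basicOpen_le f)).op '' T)) :
    ∃ (n : ℕ), ∃ y ∈ T, M.presheaf.map (homOfLE (X.basicOpen_le f)).op y =
      X.presheaf.map (homOfLE (X.basicOpen_le f)).op f ^ n • x := by
  induction hx using Submodule.span_induction with
  | mem x h =>
    obtain ⟨y, hy, rfl⟩ := h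
    exact ⟨0, y, hy, by rw [pow_zero, one_smul]⟩
  | zero => exact ⟨0, 0, Submodule.zero_mem _, by rw [map_zero, smul_zero]⟩
  | add x x' _ _ hx hx' =>
    obtain ⟨n, y, hy, h⟩ := hx
    obtain ⟨n', y', hy', h'⟩ := hx'
    refine ⟨n + n', f ^ n' • y + f ^ n • y', Submodule.add_mem _ (Submodule.smul_mem _ _ hy)
      (Submodule.smul_mem _ _ hy'), ?_⟩
    rw [map_add, Scheme.Modules.map_smul, Scheme.Modules.map_smul, h, h', smul_add, pow_add,
      map_pow, map_pow, smul_smul, smul_smul, mul_comm]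
  | smul r x _ hx =>
    obtain ⟨n, y, hy, h⟩ := hx
    obtain ⟨k, r', hr'⟩ := exists_map_eq_pow_mul hU f r
    refine ⟨k + n, r' • y, Submodule.smul_mem _ _ hy, ?_⟩
    rw [Scheme.Modules.map_smul, h, hr', smul_smul, smul_smul]
    congr 1
    ring

/-- The restriction of a finite spanning set to a basic open is spanning. -/
theorem span_res_eq_top {U : X.Opens} (hM : IsLocAt M U) (f : Γ(X, U)) {S : Set Γ(M, U)}
    (hS : Submodule.span Γ(X, U) S = ⊤) : Submodule.span Γ(X, X.basicOpen f)
      (M.presheaf.map (homOfLE (X.basicOpen_le f)).op '' S) = ⊤ := by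
  refine eq_top_iff.2 fun x _ ↦ ?_
  obtain ⟨n, t, ht⟩ := hM.exists_smul f x
  refine mem_of_pow_smul_mem (isUnit_res f) (n := n) (ht ▸ ?_)
  have key (y) (hy : y ∈ Submodule.span Γ(X, U) S) :
      M.presheaf.map (homOfLE (X.basicOpen_le f)).op y ∈ Submodule.span Γ(X, X.basicOpen f)
        (M.presheaf.map (homOfLE (X.basicOpen_le f)).op '' S) := by
    induction hy using Submodule.span_induction with
    | mem y hy => exact Submodule.subset_span ⟨y, hy, rfl⟩
    | zero => rw [map_zero]; exact Submodule.zero_mem _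
    | add y z _ _ hy hz => rw [map_add]; exact Submodule.add_mem _ hy hz
    | smul r y _ hy =>
      rw [Scheme.Modules.map_smul]
      exact Submodule.smul_mem _ _ hy
  exact key t (hS ▸ Submodule.mem_top)

theorem exists_finite_of_basicOpen [M.IsQuasicoherent] {U : X.Opens} (hU : IsAffineOpen U)
    (f : Γ(X, U)) [h : Module.Finite Γ(X, X.basicOpen f) Γ(M, X.basicOpen f)] :
    ∃ S : Set Γ(M, U), S.Finite ∧ ∀ m, ∃ n : ℕ, f ^ n • m ∈ Submodule.span Γ(X, U) S := by
  have hM := isLocAt_of_isQuasicoherent M hU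
  obtain ⟨S', hS'⟩ := h
  choose n t ht using hM.exists_smul f
  refine ⟨t '' S', S'.finite_toSet.image t, fun m ↦ ?_⟩
  have hspan : Submodule.span Γ(X, X.basicOpen f) (M.presheaf.map (homOfLE (X.basicOpen_le f)).op ''
      (Submodule.span Γ(X, U) (t '' S'))) = ⊤ := by
    rw [eq_top_iff, ← hS', Submodule.span_le]
    exact fun x hx ↦ mem_of_pow_smul_mem (isUnit_res f) (n := n x)
      (ht x ▸ Submodule.subset_span ⟨t x, Submodule.subset_span ⟨x, hx, rfl⟩, rfl⟩)
  obtain ⟨k, y, hy, h⟩ := exists_of_mem_span hU f (hspan ▸ Submodule.mem_top :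
    M.presheaf.map (homOfLE (X.basicOpen_le f)).op m ∈ _)
  obtain ⟨l, hl⟩ := hM.smul_eq_zero f (f ^ k • m - y) (by
    rw [map_sub, h, Scheme.Modules.map_smul, map_pow, sub_self])
  rw [smul_sub, sub_eq_zero, smul_smul, ← pow_add] at hl
  exact ⟨l + k, hl ▸ Submodule.smul_mem _ _ hy⟩

theorem finite_basicOpen [M.IsQuasicoherent] {U : X.Opens} (hU : IsAffineOpen U)
    (f : Γ(X, U)) [h : Module.Finite Γ(X, U) Γ(M, U)] :
    Module.Finite Γ(X, X.basicOpen f) Γ(M, X.basicOpen f) := by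
  obtain ⟨S, hS⟩ := h
  exact ⟨⟨(S.finite_toSet.image _).toFinset, by
    rw [Set.Finite.coe_toFinset]
    exact span_res_eq_top (isLocAt_of_isQuasicoherent M hU) f hS⟩⟩

/-- Quasi-coherent sheaves of finite type have finite sections over all affine opens. -/
theorem finite_of_locally [M.IsQuasicoherent]
    (h : ∀ x : X, ∃ U : X.Opens, x ∈ U ∧ IsAffineOpen U ∧ Module.Finite Γ(X, U) Γ(M, U))
    {V : X.Opens} (hV : IsAffineOpen V) : Module.Finite Γ(X, V) Γ(M, V) := by
  have H (x : V) : ∃ f : Γ(X, V), x.1 ∈ X.basicOpen f ∧ ∃ S : Set Γ(M, V), S.Finite ∧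
      ∀ m, ∃ n : ℕ, f ^ n • m ∈ Submodule.span Γ(X, V) S := by
    obtain ⟨U, hxU, hU, hfin⟩ := h x
    obtain ⟨f, g, hfg, hx⟩ := exists_basicOpen_le_affine_inter hV hU x ⟨x.2, hxU⟩
    have := finite_basicOpen (M := M) hU g
    rw [← hfg] at this
    exact ⟨f, hx, exists_finite_of_basicOpen hV f⟩
  choose f hf S hS hfS using H
  obtain ⟨T, hT⟩ := hV.isCompact.elim_finite_subcover (fun x : V ↦ (X.basicOpen (f x) : Set X))
    (fun x ↦ (X.basicOpen (f x)).2) fun x hx ↦ Set.mem_iUnion.2 ⟨⟨x, hx⟩, hf ⟨x, hx⟩⟩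
  have hfin : (⋃ x ∈ T, S x).Finite := T.finite_toSet.biUnion fun x _ ↦ hS x
  refine ⟨⟨hfin.toFinset, ?_⟩⟩
  rw [Set.Finite.coe_toFinset]
  refine eq_top_iff.2 fun m _ ↦ mem_of_locally_pow_smul_mem hV _ fun x hx ↦ ?_
  obtain ⟨y, hy, hxy⟩ := Set.mem_iUnion₂.1 (hT hx)
  obtain ⟨n, hn⟩ := hfS y m
  exact ⟨f y, hxy, n, Submodule.span_mono (Set.subset_biUnion_of_mem hy) hn⟩

end CartierModules

/-! ### Restriction to a closed subscheme of a module killed by its ideal sheaf -/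

namespace CartierModules
open Scheme.Modules Limits

section Transport

variable {X Z : Scheme.{u}}

/-- The ideal sheaf of `Z` annihilates `F`. -/
def IsKilledBy (i : Z ⟶ X) (F : X.Modules) : Prop :=
  ∀ U : X.Opens, IsAffineOpen U → ∀ r ∈ kerIdeal i U, ∀ n : Γ(F, U), r • n = 0

theorem IsKilledBy.smul_eq_smul {i : Z ⟶ X} {F : X.Modules} (hF : IsKilledBy i F) {U : X.Opens} (hU : IsAffineOpen U)
    {a b : Γ(X, U)} (h : i.app U a = i.app U b) (n : Γ(F, U)) : a • n = b • n := by
  have : i.app U (a - b) = 0 := by rw [map_sub, h, sub_self]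
  rw [← sub_eq_zero, ← sub_smul]
  exact hF U hU _ this n

variable (i : Z ⟶ X) [IsClosedImmersion i]

/-- The largest open of `X` whose preimage in the closed subscheme `Z` is contained in `V`. -/
def extOpen (V : Z.Opens) : X.Opens :=
  ⟨(i '' (V : Set Z)ᶜ)ᶜ, (i.isClosedEmbedding.isClosedMap _ V.2.isClosed_compl).isOpen_compl⟩

theorem le_extOpen_iff {U : X.Opens} {V : Z.Opens} : U ≤ extOpen i V ↔ i ⁻¹ᵁ U ≤ V := by
  constructor
  · intro h z hz
    by_contra hzV
    exact h hz ⟨z, hzV, rfl⟩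
  · rintro h _ hx ⟨z, hz, rfl⟩
    exact hz (h hx)

theorem extOpen_mono : Monotone (extOpen i) := fun _ _ h ↦
  (le_extOpen_iff i).2 (((le_extOpen_iff i).1 le_rfl).trans h)

theorem mem_extOpen {V : Z.Opens} {z : Z} : i z ∈ extOpen i V ↔ z ∈ V := by
  refine ⟨fun h ↦ (le_extOpen_iff i).1 le_rfl h, ?_⟩
  rintro hz ⟨z', hz', h⟩
  exact hz' (i.isClosedEmbedding.injective h ▸ hz)

theorem le_extOpen_of_le {U : X.Opens} {V : Z.Opens} (h : i ⁻¹ᵁ U ≤ V) : U ≤ extOpen i V :=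
  (le_extOpen_iff i).2 h

theorem extOpen_inf (V V' : Z.Opens) : extOpen i V ⊓ extOpen i V' ≤ extOpen i (V ⊓ V') :=
  le_extOpen_of_le i (le_inf (((le_extOpen_iff i).1 inf_le_left)) (((le_extOpen_iff i).1 inf_le_right)))

variable {i} {F : X.Modules}

/-- Over an affine open missing `Z` the ideal contains 1. Here `extOpen i ⊥` is the complement of
`Z`. -/
theorem IsKilledBy.eq_zero (hF : IsKilledBy i F) {U : X.Opens} (hU : U ≤ extOpen i ⊥)
    (n : Γ(F, U)) : n = 0 := by
  refine section_ext_affine F fun V hV hV' ↦ ?_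
  have h : i ⁻¹ᵁ V = ⊥ := le_bot_iff.1 ((le_extOpen_iff i).1 (hV.trans hU))
  have : Subsingleton Γ(Z, i ⁻¹ᵁ V) := h ▸ inferInstance
  have h1 : (1 : Γ(X, V)) ∈ kerIdeal i V := Subsingleton.elim (i.app V 1) 0
  rw [map_zero, ← one_smul Γ(X, V) (F.presheaf.map (homOfLE hV).op n)]
  exact hF V hV' _ h1 _

/-- `t` is the product of the function `r` on `Z` with the section `s` of `F`. -/
def IsProd {V : Z.Opens} (r : Γ(Z, V)) (s t : Γ(F, extOpen i V)) : Prop :=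
  ∀ (U : X.Opens) (h : U ≤ extOpen i V), IsAffineOpen U → ∀ a : Γ(X, U),
    i.app U a = Z.presheaf.map (homOfLE ((le_extOpen_iff i).1 h)).op r →
    F.presheaf.map (homOfLE h).op t = a • F.presheaf.map (homOfLE h).op s

theorem IsProd.unique {V : Z.Opens} {r : Γ(Z, V)} {s t t' : Γ(F, extOpen i V)}
    (h : IsProd r s t) (h' : IsProd r s t') : t = t' := by
  refine section_ext_affine F fun U hU hU' ↦ ?_
  obtain ⟨a, ha⟩ := i.app_surjective U hU' (Z.presheaf.map (homOfLE ((le_extOpen_iff i).1 hU)).op r)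
  rw [h U hU hU' a ha, h' U hU hU' a ha]

theorem IsProd.res {V V' : Z.Opens} (hV : V' ≤ V) {r : Γ(Z, V)} {s t : Γ(F, extOpen i V)}
    (h : IsProd r s t) : IsProd (Z.presheaf.map (homOfLE hV).op r)
      (F.presheaf.map (homOfLE (extOpen_mono i hV)).op s)
      (F.presheaf.map (homOfLE (extOpen_mono i hV)).op t) := by
  intro U hU hU' a ha
  rw [res_res, res_res]
  refine h U _ hU' a (ha.trans ?_)
  exact congr($(Z.presheaf.map_comp (homOfLE hV).op
    (homOfLE ((le_extOpen_iff i).1 hU)).op) r).symm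

/-- The function `r` lifts to `X` over affine opens. Two lifts act alike since the ideal kills `F`,
so the local products glue. -/
theorem exists_isProd (hF : IsKilledBy i F) {V : Z.Opens} (r : Γ(Z, V)) (s : Γ(F, extOpen i V)) :
    ∃ t, IsProd r s t := by
  let F' : TopCat.Sheaf Ab.{u} X := ⟨F.presheaf, F.isSheaf⟩
  let I := {U : X.Opens // U ≤ extOpen i V ∧ IsAffineOpen U}
  choose a ha using fun U : I ↦ i.app_surjective U.1 U.2.2
    (Z.presheaf.map (homOfLE ((le_extOpen_iff i).1 U.2.1)).op r)
  have hlift {U W : X.Opens} (hU : U ≤ extOpen i V) (hW : W ≤ U) (hW' : W ≤ extOpen i V)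
      {b : Γ(X, U)} (hb : i.app U b = Z.presheaf.map (homOfLE ((le_extOpen_iff i).1 hU)).op r) :
      i.app W (X.presheaf.map (homOfLE hW).op b) =
        Z.presheaf.map (homOfLE ((le_extOpen_iff i).1 hW')).op r := by
    rw [app_map, hb]
    exact congr($(Z.presheaf.map_comp (homOfLE ((le_extOpen_iff i).1 hU)).op
      (homOfLE (i.preimage_mono hW)).op) r).symm
  obtain ⟨t, ht, -⟩ := F'.existsUnique_gluing' (fun U : I ↦ U.1) (extOpen i V)
    (fun U ↦ homOfLE U.2.1) (fun x hx ↦ by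
      obtain ⟨_, ⟨U, hU, rfl⟩, hxU, hUV⟩ := X.isBasis_affineOpens.exists_subset_of_mem_open hx
        (extOpen i V).2
      exact Opens.mem_iSup.2 ⟨⟨U, hUV, hU⟩, hxU⟩)
    (fun U ↦ a U • F.presheaf.map (homOfLE U.2.1).op s) fun U U' ↦ by
      refine section_ext_affine F fun W hW hW' ↦ ?_
      have h₁ := hW.trans inf_le_left
      have h₂ := hW.trans inf_le_right
      refine (res_res F inf_le_left hW _).trans (Eq.trans ?_ (res_res F inf_le_right hW _).symm)
      rw [Scheme.Modules.map_smul, Scheme.Modules.map_smul, res_res, res_res]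
      refine hF.smul_eq_smul hW' ?_ _
      rw [hlift U.2.1 h₁ (h₁.trans U.2.1) (ha U), hlift U'.2.1 h₂ (h₁.trans U.2.1) (ha U')]
  have ht (U : I) : F.presheaf.map (homOfLE U.2.1).op t = a U • F.presheaf.map (homOfLE U.2.1).op s :=
    ht U
  exact ⟨t, fun U hU hU' b hb ↦ (ht ⟨U, hU, hU'⟩).trans
    (hF.smul_eq_smul hU' ((ha ⟨U, hU, hU'⟩).trans hb.symm) _)⟩

/-- The underlying presheaf of the restriction of `F` to `Z`. -/
def closedPresheaf (i : Z ⟶ X) [IsClosedImmersion i] (F : X.Modules) : TopCat.Presheaf Ab.{u} Z :=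
  (extOpen_mono i).functor.op ⋙ F.presheaf

theorem isSheaf_closedPresheaf (hF : IsKilledBy i F) :
    TopCat.Presheaf.IsSheaf (X := Z) (closedPresheaf i F) := by
  rw [TopCat.Presheaf.isSheaf_iff_isSheafUniqueGluing]
  intro ι U sf hsf
  let F' : TopCat.Sheaf Ab.{u} X := ⟨F.presheaf, F.isSheaf⟩
  -- The opens `extOpen i (U a)` need not cover off `Z`. The index `none` adds the complement of
  -- `Z`, where `F` has only the zero section.
  let U' : Option ι → X.Opens := fun o ↦ o.elim (extOpen i ⊥) fun a ↦ extOpen i (U a)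
  have hle (o) : U' o ≤ extOpen i (iSup U) := by
    cases o with
    | none => exact extOpen_mono i bot_le
    | some a => exact extOpen_mono i (le_iSup U a)
  let sf' (o) : Γ(F, U' o) := match o with
    | none => 0
    | some a => sf a
  obtain ⟨t, ht, huniq⟩ := F'.existsUnique_gluing' U' (extOpen i (iSup U)) (fun o ↦ homOfLE (hle o))
    (fun x hx ↦ by
      by_cases h : x ∈ extOpen i ⊥
      · exact Opens.mem_iSup.2 ⟨none, h⟩
      · obtain ⟨z, -, rfl⟩ := not_not.1 h
        obtain ⟨a, ha⟩ := Opens.mem_iSup.1 ((mem_extOpen i).1 hx)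
        exact Opens.mem_iSup.2 ⟨some a, (mem_extOpen i).2 ha⟩) sf' (by
      rintro (_ | a) (_ | b)
      · rfl
      · exact (hF.eq_zero (U := extOpen i ⊥ ⊓ extOpen i (U b)) inf_le_left _).trans
          (hF.eq_zero (U := extOpen i ⊥ ⊓ extOpen i (U b)) inf_le_left _).symm
      · exact (hF.eq_zero (U := extOpen i (U a) ⊓ extOpen i ⊥) inf_le_right _).trans
          (hF.eq_zero (U := extOpen i (U a) ⊓ extOpen i ⊥) inf_le_right _).symm
      · have := congrArg (F.presheaf.map (homOfLE (extOpen_inf i (U a) (U b))).op) (hsf a b)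
        exact (res_res F _ _ _).symm.trans (this.trans (res_res F _ _ _)))
  refine ⟨t, fun a ↦ ht (some a), fun t' ht' ↦ huniq t' fun o ↦ ?_⟩
  cases o with
  | none => exact (hF.eq_zero (U := extOpen i ⊥) le_rfl _).trans rfl
  | some a => exact ht' a

/-- The action of the functions on `Z`. -/
@[reducible]
def closedSMul (hF : IsKilledBy i F) (V : Z.Opens) : SMul Γ(Z, V) Γ(F, extOpen i V) :=
  ⟨fun r s ↦ (exists_isProd hF r s).choose⟩

/-- The module structure over the functions on `Z`. -/
@[reducible]
def closedModule (hF : IsKilledBy i F) (V : Z.Opens) : Module Γ(Z, V) Γ(F, extOpen i V) :=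
  let _ := closedSMul hF V
  have spec (r : Γ(Z, V)) (s : Γ(F, extOpen i V)) : IsProd r s (r • s) :=
    (exists_isProd hF r s).choose_spec
  { one_smul s := (spec 1 s).unique fun U h hU a ha ↦ by
      rw [map_one] at ha
      have := hF.smul_eq_smul hU (ha.trans (map_one _).symm) (F.presheaf.map (homOfLE h).op s)
      rw [this, one_smul]
    mul_smul r r' s := (spec (r * r') s).unique fun U h hU a ha ↦ by
      obtain ⟨b, hb⟩ := i.app_surjective U hU (Z.presheaf.map (homOfLE ((le_extOpen_iff i).1 h)).op r)
      obtain ⟨c, hc⟩ := i.app_surjective U hU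
        (Z.presheaf.map (homOfLE ((le_extOpen_iff i).1 h)).op r')
      refine (spec r _ U h hU b hb).trans ?_
      rw [spec r' s U h hU c hc, smul_smul]
      exact hF.smul_eq_smul hU (by rw [map_mul, hb, hc, ha, map_mul]) _
    smul_zero r := (spec r 0).unique fun U h hU a ha ↦ by rw [map_zero, smul_zero]
    smul_add r s s' := (spec r (s + s')).unique fun U h hU a ha ↦ by
      rw [map_add, map_add, spec r s U h hU a ha, spec r s' U h hU a ha, smul_add]
    add_smul r r' s := (spec (r + r') s).unique fun U h hU a ha ↦ by
      obtain ⟨b, hb⟩ := i.app_surjective U hU (Z.presheaf.map (homOfLE ((le_extOpen_iff i).1 h)).op r)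
      obtain ⟨c, hc⟩ := i.app_surjective U hU
        (Z.presheaf.map (homOfLE ((le_extOpen_iff i).1 h)).op r')
      rw [map_add, spec r s U h hU b hb, spec r' s U h hU c hc, ← add_smul]
      exact hF.smul_eq_smul hU (by rw [map_add, hb, hc, ha, map_add]) _
    zero_smul s := (spec 0 s).unique fun U h hU a ha ↦ by
      rw [map_zero] at ha
      rw [map_zero, hF.smul_eq_smul hU (ha.trans (map_zero _).symm), zero_smul] }

theorem isProd_smul (hF : IsKilledBy i F) {V : Z.Opens} (r : Γ(Z, V)) (s : Γ(F, extOpen i V)) :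
    IsProd r s (letI := closedModule hF V; r • s) :=
  (exists_isProd hF r s).choose_spec

/-- The restriction to the closed subscheme `Z` of a module that is killed by the ideal sheaf. -/
def closedModules (hF : IsKilledBy i F) : Z.Modules where
  val := @PresheafOfModules.ofPresheaf _ _ Z.ringCatSheaf.obj (closedPresheaf i F)
    (fun V ↦ closedModule hF V.unop) fun _ _ f r s ↦
      ((isProd_smul hF r s).res f.unop.le).unique (isProd_smul hF _ _)
  isSheaf := isSheaf_closedPresheaf hF

theorem closedModules_isProd (hF : IsKilledBy i F) {V : Z.Opens} (r : Γ(Z, V))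
    (s : Γ(closedModules hF, V)) : IsProd (F := F) r s (r • s : Γ(closedModules hF, V)) :=
  isProd_smul hF r s

end Transport

end CartierModules

namespace CartierModules
open Scheme.Modules Limits

section Closed

variable {X Z : Scheme.{u}} {q : ℕ} {i : Z ⟶ X} [IsClosedImmersion i] {F : X.Modules}

/-- `extOpen i V` is covered by `U` and the complement of `Z`, and `F` vanishes on the latter. So
the restriction to `Z` can be computed on any `U` cutting out `V`. -/
theorem IsKilledBy.bijective_res (hF : IsKilledBy i F) {U : X.Opens} {V : Z.Opens}
    (h : i ⁻¹ᵁ U = V) :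
    Function.Bijective (F.presheaf.map (homOfLE (le_extOpen_of_le i h.le)).op) := by
  let F' : TopCat.Sheaf Ab.{u} X := ⟨F.presheaf, F.isSheaf⟩
  let U' : Bool → X.Opens := fun o ↦ bif o then U else extOpen i ⊥
  have hle (o) : U' o ≤ extOpen i V := by
    cases o with
    | false => exact extOpen_mono i bot_le
    | true => exact le_extOpen_of_le i h.le
  refine (Function.bijective_iff_existsUnique _).2 fun s ↦ ?_
  let sf (o) : Γ(F, U' o) := match o with
    | false => 0
    | true => s
  obtain ⟨t, ht, huniq⟩ := F'.existsUnique_gluing' U' (extOpen i V) (fun o ↦ homOfLE (hle o))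
    (fun x hx ↦ by
      by_cases h' : x ∈ extOpen i ⊥
      · exact Opens.mem_iSup.2 ⟨false, h'⟩
      · obtain ⟨z, -, rfl⟩ := not_not.1 h'
        have hz : z ∈ i ⁻¹ᵁ U := h.ge ((mem_extOpen i).1 hx)
        exact Opens.mem_iSup.2 ⟨true, hz⟩) sf (by
      rintro (_ | _) (_ | _)
      · rfl
      · exact (hF.eq_zero (U := extOpen i ⊥ ⊓ U) inf_le_left _).trans
          (hF.eq_zero (U := extOpen i ⊥ ⊓ U) inf_le_left _).symm
      · exact (hF.eq_zero (U := U ⊓ extOpen i ⊥) inf_le_right _).trans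
          (hF.eq_zero (U := U ⊓ extOpen i ⊥) inf_le_right _).symm
      · rfl)
  refine ⟨t, ht true, fun t' ht' ↦ huniq t' fun o ↦ ?_⟩
  cases o with
  | false => exact (hF.eq_zero (U := extOpen i ⊥) le_rfl _).trans rfl
  | true => exact ht'

/-- Sections of the restriction to `Z` as sections over an open of `X`. -/
def closedRes (hF : IsKilledBy i F) {U : X.Opens} {V : Z.Opens} (h : i ⁻¹ᵁ U = V) :
    Γ(closedModules hF, V) →+ Γ(F, U) :=
  (F.presheaf.map (homOfLE (le_extOpen_of_le i h.le)).op).hom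

theorem closedRes_bijective (hF : IsKilledBy i F) {U : X.Opens} {V : Z.Opens} (h : i ⁻¹ᵁ U = V) :
    Function.Bijective (closedRes hF h) := hF.bijective_res h

theorem closedRes_smul (hF : IsKilledBy i F) {U : X.Opens} {V : Z.Opens} (h : i ⁻¹ᵁ U = V)
    (hU : IsAffineOpen U) {r : Γ(Z, V)} {a : Γ(X, U)}
    (ha : i.app U a = Z.presheaf.map (homOfLE h.le).op r) (s : Γ(closedModules hF, V)) :
    closedRes hF h (r • s) = a • closedRes hF h s :=
  closedModules_isProd hF r s U _ hU a ha

theorem closedRes_map (hF : IsKilledBy i F) {U U' : X.Opens} {V V' : Z.Opens} (h : i ⁻¹ᵁ U = V)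
    (h' : i ⁻¹ᵁ U' = V') (hU : U' ≤ U) (hV : V' ≤ V) (s : Γ(closedModules hF, V)) :
    closedRes hF h' ((closedModules hF).presheaf.map (homOfLE hV).op s) =
      F.presheaf.map (homOfLE hU).op (closedRes hF h s) :=
  (res_res F _ _ _).trans (res_res F _ hU _).symm

theorem isLocAt_closedModules (hF : IsKilledBy i F) {U : X.Opens} (hU : IsAffineOpen U)
    (hloc : IsLocAt F U) : IsLocAt (closedModules hF) (i ⁻¹ᵁ U) := by
  refine ⟨fun f s ↦ ?_, fun f t ht ↦ ?_⟩
  all_goals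
    obtain ⟨g, rfl⟩ := i.app_surjective U hU f
    have hD := i.preimage_basicOpen g
    have hlift (n : ℕ) : i.app (X.basicOpen g) (X.presheaf.map (homOfLE (X.basicOpen_le g)).op g ^ n) =
        Z.presheaf.map (homOfLE hD.le).op
          (Z.presheaf.map (homOfLE (Z.basicOpen_le (i.app U g))).op (i.app U g) ^ n) := by
      rw [map_pow, map_pow, app_map]
      exact congrArg (· ^ n) congr($(Z.presheaf.map_comp (homOfLE (Z.basicOpen_le (i.app U g))).op
        (homOfLE hD.le).op) (i.app U g))
  · obtain ⟨n, t, ht⟩ := hloc.exists_smul g (closedRes hF hD s)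
    obtain ⟨t, rfl⟩ := (closedRes_bijective hF rfl).2 t
    refine ⟨n, t, (closedRes_bijective hF hD).1 ?_⟩
    rw [closedRes_map hF rfl hD (X.basicOpen_le g), ht]
    exact (closedRes_smul hF hD (hU.basicOpen g) (hlift n) s).symm
  · obtain ⟨n, hn⟩ := hloc.smul_eq_zero g (closedRes hF rfl t) (by
      rw [← closedRes_map hF rfl hD (X.basicOpen_le g) (Z.basicOpen_le _), ht, map_zero])
    refine ⟨n, (closedRes_bijective hF rfl).1 ?_⟩
    rw [map_zero, ← hn]
    refine closedRes_smul hF rfl hU ?_ t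
    rw [map_pow]
    exact congr($(Z.presheaf.map_id _) _).symm

theorem exists_affine_preimage (i : Z ⟶ X) [IsClosedImmersion i] (z : Z) :
    ∃ U : X.Opens, IsAffineOpen U ∧ z ∈ i ⁻¹ᵁ U := by
  obtain ⟨_, ⟨U, hU, rfl⟩, hxU, -⟩ :=
    X.isBasis_affineOpens.exists_subset_of_mem_open (Set.mem_univ (i z)) isOpen_univ
  exact ⟨U, hU, hxU⟩

theorem isQuasicoherent_closedModules [F.IsQuasicoherent] (hF : IsKilledBy i F) :
    (closedModules hF).IsQuasicoherent := by
  refine isQuasicoherent_of_isLocAt _ fun z ↦ ?_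
  obtain ⟨U, hU, hz⟩ := exists_affine_preimage i z
  exact ⟨_, hU.preimage i, hz, isLocAt_closedModules hF hU (isLocAt_of_isQuasicoherent F hU)⟩

theorem finite_closedModules (hF : IsKilledBy i F) {U : X.Opens} (hU : IsAffineOpen U)
    [h : Module.Finite Γ(X, U) Γ(F, U)] :
    Module.Finite Γ(Z, i ⁻¹ᵁ U) Γ(closedModules hF, i ⁻¹ᵁ U) := by
  obtain ⟨S, hS⟩ := h
  have hb := closedRes_bijective hF (U := U) rfl
  have hfin : ((closedRes hF (U := U) rfl) ⁻¹' (S : Set Γ(F, U))).Finite :=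
    S.finite_toSet.preimage hb.1.injOn
  refine ⟨⟨hfin.toFinset, ?_⟩⟩
  rw [Set.Finite.coe_toFinset, eq_top_iff]
  intro t _
  have key (x) (hx : x ∈ Submodule.span Γ(X, U) (S : Set Γ(F, U))) :
      ∃ t ∈ Submodule.span Γ(Z, i ⁻¹ᵁ U) ((closedRes hF (U := U) rfl) ⁻¹' (S : Set Γ(F, U))),
        closedRes hF rfl t = x := by
    induction hx using Submodule.span_induction with
    | mem x hx =>
      obtain ⟨t, rfl⟩ := hb.2 x
      exact ⟨t, Submodule.subset_span hx, rfl⟩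
    | zero => exact ⟨0, Submodule.zero_mem _, map_zero _⟩
    | add x y _ _ hx hy =>
      obtain ⟨t, ht, rfl⟩ := hx
      obtain ⟨t', ht', rfl⟩ := hy
      exact ⟨_, Submodule.add_mem _ ht ht', map_add _ _ _⟩
    | smul a x _ hx =>
      obtain ⟨t, ht, rfl⟩ := hx
      exact ⟨_, Submodule.smul_mem _ (i.app U a) ht,
        closedRes_smul hF rfl hU congr($(Z.presheaf.map_id _) _).symm t⟩
  obtain ⟨t', ht', h⟩ := key (closedRes hF rfl t) (hS ▸ Submodule.mem_top)
  exact hb.1 h ▸ ht'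

namespace CohCart

variable {M : CohCart X q}

/-- The restriction to a closed subscheme of a Cartier module that is killed by its ideal sheaf. -/
def closed (M : CohCart X q) (hM : IsKilledBy i M.mod) : CohCart Z q where
  mod := closedModules hM
  quasicoherent := isQuasicoherent_closedModules hM
  finite V hV := by
    have := isQuasicoherent_closedModules hM
    refine finite_of_locally (fun z ↦ ?_) hV
    obtain ⟨U, hU, hz⟩ := exists_affine_preimage i z
    have := M.finite U hU
    exact ⟨_, hz, hU.preimage i, finite_closedModules hM hU⟩
  C := Functor.whiskerLeft (extOpen_mono i).functor.op M.C
  pow_smul V r s := by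
    refine IsProd.unique (r := r) (s := M.C.app (op (extOpen i V)) s) (fun U h hU a ha ↦ ?_)
      (closedModules_isProd hM r _)
    have h₁ := closedModules_isProd hM (r ^ q) s U h hU (a ^ q) (by rw [map_pow, map_pow, ha])
    have h₂ := C_naturality M h ((r ^ q • s : Γ(closedModules hM, V)))
    refine h₂.symm.trans ?_
    rw [h₁, M.pow_smul]
    exact congrArg (a • ·) (C_naturality M h s)

theorem closedRes_C (hM : IsKilledBy i M.mod) {U : X.Opens} {V : Z.Opens} (h : i ⁻¹ᵁ U = V)
    (s : Γ((M.closed hM).mod, V)) :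
    closedRes hM h ((M.closed hM).C.app (op V) s) = M.C.app (op U) (closedRes hM h s) :=
  (C_naturality M _ _).symm

end CohCart

end Closed

end CartierModules

/-! ### Stalks, and the generic bound on an integral scheme -/

namespace CartierModules
open Scheme.Modules Limits
variable {X : Scheme.{u}} {q : ℕ}

namespace CohCart

variable (M : CohCart X q)

/-- The map from sections to the stalk. -/
def germHom (U : X.Opens) (x : X) (hx : x ∈ U) : Γ(M.mod, U) →+ M.stalk x :=
  (TopCat.Presheaf.germ M.mod.presheaf U x hx).hom

theorem germHom_smul {U : X.Opens} {x : X} (hx : x ∈ U) (r : Γ(X, U)) (m : Γ(M.mod, U)) :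
    M.germHom U x hx (r • m) = X.presheaf.germ U x hx r • M.germHom U x hx m :=
  PresheafOfModules.germ_smul (R := X.presheaf) M.mod.val x U hx r m

theorem germHom_C {U : X.Opens} {x : X} (hx : x ∈ U) (m : Γ(M.mod, U)) :
    M.germHom U x hx (M.C.app (op U) m) = M.stalkC x (M.germHom U x hx m) :=
  (TopCat.Presheaf.stalkFunctor_map_germ_apply U x hx M.C m).symm

theorem germHom_res {U V : X.Opens} (h : V ≤ U) {x : X} (hx : x ∈ V) (m : Γ(M.mod, U)) :
    M.germHom V x hx (M.mod.presheaf.map (homOfLE h).op m) = M.germHom U x (h hx) m :=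
  TopCat.Presheaf.germ_res_apply M.mod.presheaf (homOfLE h) x hx m

theorem exists_germHom_eq {x : X} (m : M.stalk x) :
    ∃ (U : X.Opens) (hx : x ∈ U) (m' : Γ(M.mod, U)), M.germHom U x hx m' = m := by
  obtain ⟨U, hx, m', h⟩ := TopCat.Presheaf.exists_germ_eq M.mod.presheaf m
  exact ⟨U, hx, m', h⟩

theorem isCartier_stalk (x : X) : IsCartier (X.presheaf.stalk x) q (M.stalkC x).hom := by
  refine ⟨fun r m ↦ ?_⟩
  obtain ⟨U, hU, r, rfl⟩ := X.presheaf.exists_germ_eq r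
  obtain ⟨V, hV, m, rfl⟩ := M.exists_germHom_eq m
  have hx : x ∈ U ⊓ V := ⟨hU, hV⟩
  have h₁ := X.presheaf.germ_res_apply (homOfLE (inf_le_left : U ⊓ V ≤ U)) x hx r
  have h₂ := M.germHom_res (inf_le_right : U ⊓ V ≤ V) hx m
  rw [← h₁, ← h₂, ← map_pow, ← germHom_smul]
  refine (M.germHom_C _ _).symm.trans ?_
  rw [M.pow_smul, germHom_smul, germHom_C]

/-- Basic opens of an affine open are a neighbourhood basis at each of its points. -/
theorem exists_basicOpen_le_of_mem {U V : X.Opens} (hU : IsAffineOpen U) {x : X} (hxU : x ∈ U)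
    (hxV : x ∈ V) : ∃ f ∉ (hU.primeIdealOf ⟨x, hxU⟩).asIdeal, X.basicOpen f ≤ V ∧
      x ∈ X.basicOpen f := by
  obtain ⟨f, hf, hxf⟩ := hU.exists_basicOpen_le ⟨x, hxV⟩ hxU
  refine ⟨f, ?_, hf, hxf⟩
  have : hU.primeIdealOf ⟨x, hxU⟩ ∈ hU.fromSpec ⁻¹ᵁ X.basicOpen f := by
    change hU.fromSpec (hU.primeIdealOf ⟨x, hxU⟩) ∈ X.basicOpen f
    rw [hU.fromSpec_primeIdealOf]
    exact hxf
  rw [hU.fromSpec_preimage_basicOpen] at this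
  exact this

/-- Quasi-coherence makes the germ map a localization at the prime of `x`, so `notMem_minimalPrimes`
applies to the stalk. -/
theorem primeIdealOf_notMem_minimalPrimes [IsLocallyNoetherian X] (hq : 0 < q) {U : X.Opens}
    (hU : IsAffineOpen U) {x : X} (hx : x ∈ U) (H : M.FiniteLengthQuotientsNilpotentAt x)
    {N : Submodule Γ(X, U) Γ(M.mod, U)} (hN : ∀ m ∈ N, M.C.app (op U) m ∈ N) {e : ℕ}
    (he : ∀ k, (M.isCartier U).image e ⊤ ≤ (M.isCartier U).image (e + k) ⊤ ⊔ N) :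
    (hU.primeIdealOf ⟨x, hx⟩).asIdeal ∉
      (N.colon ((M.isCartier U).image e ⊤ : Set Γ(M.mod, U))).minimalPrimes := by
  have := IsLocallyNoetherian.component_noetherian ⟨U, hU⟩
  have := M.finite U hU
  let := X.presheaf.algebra_section_stalk (⟨x, hx⟩ : U)
  have hloc : IsLocalization.AtPrime (X.presheaf.stalk x) (hU.primeIdealOf ⟨x, hx⟩).asIdeal :=
    hU.isLocalization_stalk ⟨x, hx⟩
  have hM := isLocAt_of_isQuasicoherent M.mod hU
  have : (hU.primeIdealOf ⟨x, hx⟩).asIdeal.IsPrime := (hU.primeIdealOf ⟨x, hx⟩).2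
  refine IsCartier.notMem_minimalPrimes hq (M.isCartier U) (M.isCartier_stalk x) _
    (M.germHom U x hx) (M.germHom_smul hx) (M.germHom_C hx) (fun k ↦ ?_) (fun k hk ↦ ?_)
    H hN he
  · obtain ⟨V, hV, m, rfl⟩ := M.exists_germHom_eq k
    obtain ⟨f, hf, hfV, hxf⟩ := exists_basicOpen_le_of_mem hU hx hV
    obtain ⟨n, t, ht⟩ := hM.exists_smul f (M.mod.presheaf.map (homOfLE hfV).op m)
    refine ⟨f ^ n, fun h ↦ hf (this.mem_of_pow_mem n h), t, ?_⟩
    have h := congrArg (M.germHom _ x hxf) ht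
    rw [germHom_smul, germHom_res, germHom_res, map_pow, X.presheaf.germ_res_apply] at h
    rw [h, map_pow]
    rfl
  · obtain ⟨V, hV, i₁, i₂, h⟩ := TopCat.Presheaf.germ_eq M.mod.presheaf x hx hx k 0
      (hk.trans (map_zero (M.germHom U x hx)).symm)
    obtain ⟨f, hf, hfV, hxf⟩ := exists_basicOpen_le_of_mem hU hx hV
    obtain ⟨n, hn⟩ := hM.smul_eq_zero f k (by
      have h' := congrArg (M.mod.presheaf.map (homOfLE hfV).op) h
      rw [map_zero, map_zero] at h'
      exact (res_res M.mod i₁.le hfV k).symm.trans h')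
    exact ⟨f ^ n, fun h ↦ hf (this.mem_of_pow_mem n h), hn⟩

/-- Any `f` with a nonempty basic open set inside `O` serves as bound. For each `N` it lies in every
minimal prime of `J`, the annihilator of the stable image modulo `N`, so a power of it lies in `J`.
-/
theorem genericallyBounded_bot [IsLocallyNoetherian X] [IsIntegral X] (hq : 2 ≤ q) {O : X.Opens}
    (hO : (O : Set X).Nonempty)
    (H : ∀ x ∈ O, x ≠ genericPoint X → M.FiniteLengthQuotientsNilpotentAt x) {U : X.Opens}
    (hU : IsAffineOpen U) (hne : (U : Set X).Nonempty) :
    IsCartier.GenericallyBounded (⊥ : Ideal Γ(X, U)) (M.C.app (op U)).hom := by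
  have := IsLocallyNoetherian.component_noetherian ⟨U, hU⟩
  have := M.finite U hU
  have : Nonempty U := hne.to_subtype
  obtain ⟨x, hxO, hxU⟩ := nonempty_preirreducible_inter O.2 U.2 hO hne
  obtain ⟨f, hf, hxf⟩ := hU.exists_basicOpen_le ⟨x, hxO⟩ hxU
  refine ⟨f, ?_, fun N hN ⟨s, hs, hsN⟩ ↦ ?_⟩
  · rintro rfl
    rw [X.basicOpen_zero] at hxf
    exact hxf
  obtain ⟨e, he⟩ := (M.isCartier U).exists_image_eq hq (N := ⊤) fun _ _ ↦ trivial
  set J := N.colon ((M.isCartier U).image e ⊤ : Set Γ(M.mod, U)) with hJ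
  have hsJ : s ∈ J := Submodule.mem_colon.2 fun m _ ↦ hsN m
  have hfJ : f ∈ J.radical := by
    rw [← Ideal.sInf_minimalPrimes, Submodule.mem_sInf]
    intro (P : Ideal Γ(X, U)) hP
    by_contra hfP
    have hP' : P.IsPrime := hP.1.1
    let z : Spec Γ(X, U) := ⟨P, hP'⟩
    have hzf : hU.fromSpec z ∈ X.basicOpen f := by
      have : z ∈ hU.fromSpec ⁻¹ᵁ X.basicOpen f := by
        rw [hU.fromSpec_preimage_basicOpen]
        exact hfP
      exact this
    have hzU := X.basicOpen_le f hzf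
    have hz : hU.primeIdealOf ⟨_, hzU⟩ = z :=
      hU.isOpenImmersion_fromSpec.base_open.injective (hU.fromSpec_primeIdealOf _)
    refine M.primeIdealOf_notMem_minimalPrimes (by omega) hU hzU (H _ (hf hzf) ?_) hN (e := e)
      (fun k ↦ (he (e + k) (Nat.le_add_right e k)).ge.trans le_sup_left) (by rw [hz]; exact hP)
    -- The generic point, where the hypothesis is silent, is excluded: `P` contains the nonzero `s`.
    intro hgen
    have h₁ := hU.primeIdealOf_genericPoint
    have h₂ : z = genericPoint (Spec Γ(X, U)) := by
      rw [← hz, ← h₁]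
      congr 1
      exact Subtype.ext hgen
    rw [genericPoint_eq_bot_of_affine] at h₂
    have : P = ⊥ := congrArg PrimeSpectrum.asIdeal h₂
    exact hs (this ▸ hP.1.2 hsJ)
  obtain ⟨n, hn⟩ := hfJ
  exact ⟨n, e, fun m ↦ Submodule.mem_colon.1 hn _ ⟨m, trivial, rfl⟩⟩

end CohCart

end CartierModules

/-! ### Integral closed subschemes from primes, and generic bounds in the second case -/

namespace CartierModules
open Scheme.Modules Limits
variable {X : Scheme.{u}} {q : ℕ}

theorem toImage_app_injective {Y : Scheme.{u}} (f : Y ⟶ X) [QuasiCompact f] (V : f.image.Opens) :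
    Function.Injective (f.toImage.app V) :=
  (TopCat.Presheaf.app_injective_iff_stalkFunctor_map_injective (F := f.image.sheaf)
    f.toImage.c).1 f.stalkFunctor_toImage_injective V

/-- The scheme theoretic image of an integral scheme is integral. -/
theorem isIntegral_image {Y : Scheme.{u}} (f : Y ⟶ X) [QuasiCompact f] [IsIntegral Y] :
    IsIntegral f.image where
  nonempty := ⟨f.toImage (Classical.arbitrary Y)⟩
  component_integral V hV := by
    obtain ⟨y, hy⟩ := f.toImage.denseRange.exists_mem_open V.2 (Set.nonempty_coe_sort.1 hV)
    have : Nonempty (f.toImage ⁻¹ᵁ V) := ⟨⟨y, hy⟩⟩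
    exact (toImage_app_injective f V).isDomain (f.toImage.app V).hom

/-- The prime ideals over affine opens define integral closed subschemes. -/
theorem exists_isIntegral_kerIdeal_eq [IsLocallyNoetherian X] {W : X.Opens} (hW : IsAffineOpen W)
    (p : Ideal Γ(X, W)) (hp : p.IsPrime) : ∃ (Z : Scheme.{u}) (i : Z ⟶ X), IsClosedImmersion i ∧
      IsIntegral Z ∧ kerIdeal i W = p ∧ ((i ⁻¹ᵁ W : Z.Opens) : Set Z).Nonempty := by
  let z : Spec Γ(X, W) := ⟨p, hp⟩
  let x := hW.fromSpec z
  have hx : x ∈ W := hW.range_fromSpec.le (Set.mem_range_self z)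
  -- The subscheme is the scheme-theoretic image of the residue field at the point of `p`: its ideal
  -- over `W` is the kernel of evaluation there.
  let f := X.fromSpecResidueField x
  have hf (y) : f y = x := (X.range_fromSpecResidueField x).le (Set.mem_range_self y)
  refine ⟨f.image, f.imageι, inferInstance, isIntegral_image f, ?_, ?_⟩
  · have hker : kerIdeal f.imageι W = RingHom.ker (f.app W).hom :=
      (f.ker.ker_subschemeι_app ⟨W, hW⟩).trans (f.ker_apply ⟨W, hW⟩)
    rw [hker]
    ext a
    rw [RingHom.mem_ker]
    change f.app W a = 0 ↔ a ∈ z.asIdeal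
    rw [← basicOpen_eq_bot_iff, ← Scheme.Hom.preimage_basicOpen]
    have hmem : x ∈ X.basicOpen a ↔ a ∉ z.asIdeal := by
      change z ∈ hW.fromSpec ⁻¹ᵁ X.basicOpen a ↔ _
      rw [hW.fromSpec_preimage_basicOpen]
      rfl
    rw [← not_iff_not, ← hmem]
    constructor
    · intro h
      obtain ⟨y, hy⟩ := Set.nonempty_iff_ne_empty.2 fun h' ↦ h (Opens.ext h')
      have hy : f y ∈ X.basicOpen a := hy
      rwa [hf y] at hy
    · intro h h'
      let y : Spec (X.residueField x) := Classical.arbitrary _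
      have h₁ : f y ∈ X.basicOpen a := by rwa [hf y]
      have h₂ : y ∈ f ⁻¹ᵁ X.basicOpen a := h₁
      rw [h'] at h₂
      exact h₂
  · let y : Spec (X.residueField x) := Classical.arbitrary _
    refine ⟨f.toImage y, ?_⟩
    change f.imageι (f.toImage y) ∈ W
    rw [← Scheme.Hom.comp_apply, f.toImage_imageι, hf y]
    exact hx

namespace CohCart

/-- The module B divided by the Cartier submodule generated by p B is globalized to a coherent
Cartier module on X killed by the ideal of Z. Its restriction to Z satisfies the generic bound at 0,
which is pulled back to B. -/
theorem hasGenericBounds_of_gabberCondition [IsLocallyNoetherian X] (hq : 2 ≤ q)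
    (h : GabberCondition X q) (M : CohCart X q) : M.HasGenericBounds := by
  intro S W hW p hp e B
  obtain ⟨Z, i, hi, hZ, rfl, hne⟩ := exists_isIntegral_kerIdeal_eq hW p hp
  have : IsLocallyNoetherian Z := LocallyOfFiniteType.isLocallyNoetherian i
  obtain ⟨B', j, hj, hB'⟩ := (S : CohCart X q).exists_image (by omega) e
  obtain ⟨F, π, hπ⟩ := B'.exists_quotient (by omega) i
  have hF : IsKilledBy i F.mod := by
    intro U hU r hr n
    obtain ⟨n, rfl⟩ := (hπ U hU).1 n
    rw [← Hom.app_smul, (hπ U hU).2]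
    exact (B'.isCartier U).le_generated _ (Submodule.smul_mem_smul hr trivial)
  obtain ⟨O, hO, hOx⟩ := h Z i (F.closed hF)
  have hgen := (F.closed hF).genericallyBounded_bot hq hO hOx (hW.preimage i) hne
  let κ : Γ(B'.mod, W) →ₗ[Γ(X, W)] Γ(M.mod, W) := sectionsMap S W ∘ₗ
    { (j.hom.app W).hom with map_smul' := Hom.app_smul j.hom }
  have hκ : Function.Injective κ := by
    have := mono_hom_of_mono S.arrow
    exact (injective_app S.arrow.hom W).comp (injective_app j.hom W)
  have hκC (b) : κ (B'.C.app (op W) b) = M.C.app (op W) (κ b) :=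
    (congrArg (sectionsMap S W) (hom_C j W b)).trans (hom_C S.arrow W _)
  have hrange : LinearMap.range κ = B := by
    ext m
    constructor
    · rintro ⟨b, rfl⟩
      obtain ⟨s, -, hs⟩ := (hB' W hW _).1 ⟨b, rfl⟩
      refine ⟨sectionsMap S W s, ⟨s, rfl⟩, ?_⟩
      refine (hom_iterate_C S.arrow W e s).symm.trans ?_
      exact congrArg (sectionsMap S W) hs
    · rintro ⟨_, ⟨s, rfl⟩, rfl⟩
      obtain ⟨b, hb⟩ := (hB' W hW _).2 ⟨s, trivial, rfl⟩
      exact ⟨b, (congrArg (sectionsMap S W) hb).trans (hom_iterate_C S.arrow W e s)⟩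
  let E : Γ(B'.mod, W) ≃ₗ[Γ(X, W)] B :=
    (LinearEquiv.ofInjective κ hκ).trans (LinearEquiv.ofEq _ _ hrange)
  have hE (b) : (E b : Γ(M.mod, W)) = κ b := rfl
  have hBC : ∀ m ∈ B, M.C.app (op W) m ∈ B :=
    (M.isCartier W).image_stable (fun m hm ↦ C_mem_sections hm) e
  let ρ := AddEquiv.ofBijective (closedRes hF (U := W) rfl) (closedRes_bijective hF rfl)
  let θ : B →+ Γ((F.closed hF).mod, i ⁻¹ᵁ W) :=
    ρ.symm.toAddMonoidHom.comp ((π.hom.app W).hom.comp E.symm.toLinearMap.toAddMonoidHom)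
  have hθ (b : B) : closedRes hF rfl (θ b) = π.hom.app W (E.symm b) := ρ.apply_symm_apply _
  have hρ := (closedRes_bijective hF (U := W) rfl).1
  obtain ⟨f, hf, H⟩ := IsCartier.exists_of_genericallyBounded
    (ψ := (i.app W).hom) (i.app_surjective W hW) hBC θ
    (ρ.symm.surjective.comp ((hπ W hW).1.comp E.symm.surjective))
    (fun r b ↦ hρ (by
      rw [hθ, _root_.map_smul, Hom.app_smul, ← hθ]
      exact (closedRes_smul hF rfl hW congr($(Z.presheaf.map_id _) _).symm (θ b)).symm))
    (fun b ↦ hρ (by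
      refine (hθ _).trans (Eq.trans ?_ (closedRes_C hF rfl (θ b)).symm)
      rw [hθ, ← hom_C]
      congr 1
      refine E.injective (Subtype.ext ?_)
      rw [E.apply_symm_apply, hE, hκC, ← hE, E.apply_symm_apply])) hgen
  refine ⟨f, hf, fun N hN hDN hNC hsN ↦ H N hN (fun b hb ↦ hDN ?_) hNC hsN⟩
  have h₁ := hθ b
  rw [hb] at h₁
  have h₂ := ((hπ W hW).2 _).1 (h₁.symm.trans (map_zero (closedRes hF rfl)))
  -- The kernel of `θ` is computed in the abstract module `B'`; this places it in the submodule
  -- generated by p B inside M, which N contains.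
  have h₃ : (B'.isCartier W).generated (kerIdeal i W • ⊤) ≤
      ((M.isCartier W).generated (kerIdeal i W • B)).comap κ := by
    refine (B'.isCartier W).generated_le (fun m hm ↦ ?_) (Submodule.smul_le.2 fun r hr m _ ↦ ?_)
    · rw [Submodule.mem_comap] at hm ⊢
      exact (hκC m).symm ▸ (M.isCartier W).generated_stable _ _ hm
    · rw [Submodule.mem_comap, _root_.map_smul]
      exact (M.isCartier W).le_generated _ (Submodule.smul_mem_smul hr (hrange ▸ ⟨m, rfl⟩))
  have h₄ : κ (E.symm b) = b := by rw [← hE, E.apply_symm_apply]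
  exact h₄ ▸ h₃ h₂

end CohCart

end CartierModules

end

theorem theorem4p6 {𝔽 : Type u} [Field 𝔽] [Fintype 𝔽] {X : Scheme.{u}}
    (s : X ⟶ Spec (CommRingCat.of 𝔽)) [IsSeparated s] [IsNoetherian X]
    (hX : CartierModules.IsFFinite s ∨ CartierModules.GabberCondition X (Fintype.card 𝔽)) :
    (∀ (M : CartierModules.CohCart X (Fintype.card 𝔽)) (N : ℕ → Subobject M) (hN : Antitone N),
      ∃ i₀ : ℕ, ∀ i ≥ i₀,
        CartierModules.CohCart.NilpotentCokernel
          (Subobject.ofLE (N (i + 1)) (N i) (hN i.le_succ))) ∧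
    (∀ A : CartierModules.CartierCrystal X (Fintype.card 𝔽),
      IsNoetherianObject A ∧ IsArtinianObject A ∧ CartierModules.HasFiniteLength A) := by
  have hq : 2 ≤ Fintype.card 𝔽 := Fintype.one_lt_card
  have hM (M : CartierModules.CohCart X (Fintype.card 𝔽)) : M.HasGenericBounds :=
    hX.elim (fun h ↦ M.hasGenericBounds_of_isFFinite s h)
      fun h ↦ M.hasGenericBounds_of_gabberCondition hq h
  have h := fun M : CartierModules.CohCart X (Fintype.card 𝔽) ↦
    M.exists_nilpotentCokernel hq (hM M)
  exact ⟨h, CartierModules.crystal_finiteness (by omega) h⟩
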